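/- Call a function $\Gamma:(\{0,1\}^{n})^{c}\to(\{0,1\}^{m})^{d}$ *$k$-majority-unique* if every nonempty set $S\subseteq(\{0,1\}^n)^c$ with $|S|\le k$ contains an $x$ such that more than $d/2$ of the indices $i\in\{1,\dots,d\}$ satisfy $\Gamma(x)_i\ne\Gamma(y)_i$ for all $y\in S\setminus\{x\}$. The model of computation is the word RAM with word size $w$ and the restricted instruction set (addition, subtraction, comparison, bitwise operations, shifts, random access to memory, no multiplication), augmented with a unit-cost instruction that returns a fresh uniformly random integer in $\{0,\dots,r-1\}$ for a given $1\le r\le 2^w$. Inputs and outputs of queries are stored as packed bit strings in a read-only input and a write-only output, which are not counted as space. All other memory is counted. **Theorem.** Let $C$ be a constant. There is a randomized word RAM data structure, given by a fixed initialization program and a fixed evaluation program, that takes as input positive integers $\lambda,n,\kappa$ with $\kappa\le Cn$ and initializes a function $$\Gamma:(\{0,1\}^{n})^{2^{\lambda}}\to(\{0,1\}^{n+\kappa+4})^{2^{\lambda+3}},$$ such that, with constants in the $O$-notation depending only on $C$, the following holds for every word size $w\ge 1$ that is large enough to address the space used (the space is at most $2^w$ words). - The space usage is $O(1+2^{n+\kappa+2\lambda}\,n/w)$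 words, and the initialization takes time $O(2^{n+\kappa+2\lambda}\,n/w+n+\lambda)$. - For every outcome of the initialization, the evaluation program computes $\Gamma$ correctly on every sequence of queries, in time $O\bigl(2^{\lambda}(\lambda+2^{\lambda}n/w)\bigr)$ per query. - With probability at least $1-2^{-n+1}$ over the initialization, $\Gamma$ is $2^{\kappa}$-majority-unique. -/

import Mathlib

/-! ### Unique neighbours

Strings of `c` characters of `n` bits are functions `Fin c → BitVec n`. A function
`Γ : (Fin c → BitVec n) → (Fin d → BitVec m)` is viewed as a bipartite graph of left degree `d`
with right vertex set `Fin d × BitVec m`. -/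

/-- The set of outputs `Γ(S) = {(i, Γ(x)ᵢ) : x ∈ S, 1 ≤ i ≤ d}` of a set `S` of inputs. -/
def outputs {n c m d : ℕ} (Γ : (Fin c → BitVec n) → (Fin d → BitVec m))
    (S : Finset (Fin c → BitVec n)) : Finset (Fin d × BitVec m) :=
  S.biUnion fun x => Finset.univ.image fun i => (i, Γ x i)

/-- Every nonempty set of at most `k` inputs contains an element with more than `l` unique
neighbours. -/
def HasUniqueNeighbors {n c m d : ℕ} (Γ : (Fin c → BitVec n) → (Fin d → BitVec m))
    (k : ℕ) (l : ℝ) : Prop :=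
  ∀ S : Finset (Fin c → BitVec n), S.Nonempty → S.card ≤ k →
    ∃ x ∈ S, l < ((outputs Γ {x} \ outputs Γ (S \ {x})).card : ℝ)

/-- `Γ` is `k`-majority-unique. -/
def IsMajorityUnique {n c m d : ℕ} (Γ : (Fin c → BitVec n) → (Fin d → BitVec m))
    (k : ℕ) : Prop :=
  ∃ l : ℝ, (d : ℝ) / 2 ≤ l ∧ HasUniqueNeighbors Γ k l

/-! ### The word RAM

A word RAM with word size `w`, in the form of a structured language over a fixed finite set of
registers, with the restricted instruction set (addition, subtraction, comparison, bitwise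
operations, shifts; no multiplication), random access to a memory of words, and an instruction
that generates random integers. A program is a fixed piece of syntax; it does not depend on `w`. -/

namespace WordRAM

/-- The arithmetic instructions. -/
inductive BinOp where
  | add | sub | and | or | xor | shl | shr | lt

/-- Words are `w`-bit vectors; addition and subtraction are modulo `2 ^ w`, shifts by `w` or more
positions give `0`, and `lt` is unsigned comparison with result `0` or `1`. -/
def BinOp.eval {w : ℕ} : BinOp → BitVec w → BitVec w → BitVec w
  | add, x, y => x + y
  | sub, x, y => x - y
  | and, x, y => x &&& y
  | or, x, y => x ||| y
  | xor, x, y => x ^^^ y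
  | shl, x, y => x <<< y
  | shr, x, y => x >>> y
  | lt, x, y => if x.toNat < y.toNat then 1 else 0

/-- Programs. Registers are named by natural numbers, `d` is always the destination register.
* `const d v`: put the constant `v` into `d`;
* `op o d a b`: put the result of `o` on registers `a` and `b` into `d`;
* `load d a`: put the memory cell whose address is in `a` into `d`;
* `store a b`: put register `b` into the memory cell whose address is in `a`;
* `input d a`: put the input word whose index is in `a` into `d` (the input is read-only);
* `output a b`: make register `b` the output word whose index is in `a` (the output is write-only);
* `rand d a`: put a fresh uniformly random integer from `{0, …, r - 1}` into `d`, where `r` is the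
  value of register `a`, or `2 ^ w` if that value is `0`;
* `seq p q`, `cond a p q`, `loop a p`: sequential composition; `p` if register `a` is nonzero and
  `q` otherwise; repeat `p` as long as register `a` is nonzero. -/
inductive Prog where
  | const (d v : ℕ)
  | op (o : BinOp) (d a b : ℕ)
  | load (d a : ℕ)
  | store (a b : ℕ)
  | input (d a : ℕ)
  | output (a b : ℕ)
  | rand (d a : ℕ)
  | seq (p q : Prog)
  | cond (a : ℕ) (p q : Prog)
  | loop (a : ℕ) (p : Prog)

/-- The state of a machine of word size `w`: registers, memory, input words, output words. -/
structure State (w : ℕ) where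
  reg : ℕ → BitVec w
  mem : ℕ → BitVec w
  inp : ℕ → BitVec w
  out : ℕ → BitVec w

/-- Put the word `v` into register `d`. -/
def State.setReg {w : ℕ} (s : State w) (d : ℕ) (v : BitVec w) : State w :=
  { s with reg := Function.update s.reg d v }

/-- The number of values from which `rand` chooses when its argument is `a`. -/
def randBound {w : ℕ} (a : BitVec w) : ℕ := if a.toNat = 0 then 2 ^ w else a.toNat

theorem randBound_pos {w : ℕ} (a : BitVec w) : 0 < randBound a := by
  unfold randBound
  split_ifs with h
  · positivity
  · omega

/-- The uniform distribution on `{0, …, randBound a - 1}`, as words. -/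
noncomputable def randWord {w : ℕ} (a : BitVec w) : PMF (BitVec w) :=
  (PMF.uniformOfFinset (Finset.range (randBound a))
    (Finset.nonempty_range_iff.mpr (randBound_pos a).ne')).map (BitVec.ofNat w)

/-- `exec S t K s` is the distribution of the outcome of executing the programs in the list `K`
one after the other, starting in state `s`, on a machine with memory cells `0, …, S - 1`, where
each instruction and each evaluation of a control structure takes one step. The outcome is
`some s'` if execution ends in state `s'` after at most `t` steps, and it is `none` if it takes
more than `t` steps or accesses memory at an address `≥ S`. -/
noncomputable def exec {w : ℕ} (S : ℕ) : ℕ → List Prog → State w → PMF (Option (State w))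
  | _, [], s => PMF.pure (some s)
  | 0, _ :: _, _ => PMF.pure none
  | t + 1, .const d v :: K, s => exec S t K (s.setReg d (BitVec.ofNat w v))
  | t + 1, .op o d a b :: K, s => exec S t K (s.setReg d (o.eval (s.reg a) (s.reg b)))
  | t + 1, .load d a :: K, s =>
      if (s.reg a).toNat < S then exec S t K (s.setReg d (s.mem (s.reg a).toNat))
      else PMF.pure none
  | t + 1, .store a b :: K, s =>
      if (s.reg a).toNat < S then
        exec S t K { s with mem := Function.update s.mem (s.reg a).toNat (s.reg b) }
      else PMF.pure none
  | t + 1, .input d a :: K, s => exec S t K (s.setReg d (s.inp (s.reg a).toNat))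
  | t + 1, .output a b :: K, s =>
      exec S t K { s with out := Function.update s.out (s.reg a).toNat (s.reg b) }
  | t + 1, .rand d a :: K, s => (randWord (s.reg a)).bind fun v => exec S t K (s.setReg d v)
  | t + 1, .seq p q :: K, s => exec S t (p :: q :: K) s
  | t + 1, .cond a p q :: K, s => if s.reg a ≠ 0 then exec S t (p :: K) s else exec S t (q :: K) s
  | t + 1, .loop a p :: K, s =>
      if s.reg a ≠ 0 then exec S t (p :: .loop a p :: K) s else exec S t K s

/-- The initial registers: the parameters `l`, `n`, `κ` and the word size `w` are in registers
`0`, `1`, `2`, `3`, and all other registers are zero. -/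
def paramRegs (w l n κ : ℕ) : ℕ → BitVec w
  | 0 => BitVec.ofNat w l
  | 1 => BitVec.ofNat w n
  | 2 => BitVec.ofNat w κ
  | 3 => BitVec.ofNat w w
  | _ => 0

/-- The words of `buf`, read as a sequence of bits, start with the `c * n` bits of the string `x`
of `c` characters of `n` bits. -/
def Packed {w n c : ℕ} (x : Fin c → BitVec n) (buf : ℕ → BitVec w) : Prop :=
  ∀ (i : Fin c) (b : Fin n),
    (buf ((i * n + b) / w)).getLsbD ((i * n + b) % w) = (x i).getLsbD b

/-- The memory content `σ` represents `Γ`: on a machine with `S` memory cells, started with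
registers `r`, the program `ev` computes `Γ` within `T` steps on each input of an arbitrary sequence
of queries to the data structure `σ`. The set `I` contains the memory contents that can occur
between queries. -/
def Represents {w n c m d : ℕ} (S T : ℕ) (ev : Prog) (r : ℕ → BitVec w) (σ : ℕ → BitVec w)
    (Γ : (Fin c → BitVec n) → (Fin d → BitVec m)) : Prop :=
  ∃ I : Set (ℕ → BitVec w), σ ∈ I ∧
    ∀ M ∈ I, ∀ (x : Fin c → BitVec n) (inp : ℕ → BitVec w), Packed x inp →
      ∀ o ∈ (exec S T [ev] { reg := r, mem := M, inp := inp, out := fun _ => 0 }).support,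
        ∃ s : State w, o = some s ∧ s.mem ∈ I ∧ Packed (Γ x) s.out

end WordRAM

/-! The data structure is a recursive form of simple tabulation. At level `t`, a string of length `2
^ t` accesses `2 ^ (δ + t)` random tables by characters of `M` bits (`idx`), and the XOR of the
entries found is a vector of `2 ^ (δ + t + 1)` fields (`out`). A string of length `2 ^ (t + 1)` is
halved; its character for table `f` of the next level joins the low bits of field `f` for the first
half with the high bits of field `f` for the second half. The value of `Γ` consists of the lowest `n
+ κ + 4` bits of `2 ^ (l + 3)` fields of level `l`.

Unique neighbours give independence. Suppose that every nonempty set of at most `2 ^ κ` strings has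
a member that reads a table entry read by no other member. Peeling off such members one by one shows
that the tables of this level can be altered so as to produce arbitrary outputs on the set
(`exists_table`). These alterations permute the outcomes of the random filling and leave the
accesses at this level unchanged, so counting along their orbits (`card_mul_le_of_act`,
`card_many_collisions_le`) bounds probabilities as if the outputs on the set were independent and
uniform.

Independence gives few collisions. A coordinate that collides with an earlier element is encoded by
that element instead of by its value. Hence `z` such collisions among the coordinates of `A`, with
`α` bits per field and `8 d` fields, have probability at most `2 ^ (8 d |A|) (|A| / 2 ^ α) ^ z`.
This is small enough for a union bound over all sets `A` (`card_union_bound`), so most elements of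
every small set are unique in most of their fields (`MostlyUnique`).

Few collisions give unique neighbours one level up. Let `A` be a set of pairs of halves and `B` the
set of its first halves. Separating the elements of `B` takes about `log |B|` bits, and a typical
first half has about `|A| / |B|` second halves attached, which takes `log |A| - log |B|` bits. The
sum stays near `κ`, but the right division of a field depends on `A`. The fields therefore offer all
divisions on a grid of step `e`, about `n / 4`. As `κ ≤ C n`, a constant number `2 ^ γ` of them
suffices, and the rounding costs about `3 e` bits, which the `n + 20` spare bits of a field pay for
(`exists_unique_pair`, `uniqueOn_succ`). Level `0` is trivial. Level `t` fails with probability at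
most `2 ^ -(n + t + 1)` and the final majority step with at most `2 ^ -n`, in total `2 ^ (1 - n)`
(`card_not_hasMajority_le`).

On the machine, fields lie at distance `2 ^ μ` with `2 ^ L` of them per word, so that addresses need
only shifts and additions, and one XOR of words treats a whole block of fields. The deterministic
programs are verified by a Hoare-style calculus on states of natural numbers (`WP`). Randomness
occurs only in the loop `randomFill`; the memory it leaves is the image of a uniformly random vector
of words (`map_exec_init`), and `tableSpace` makes the probability bound applicable to it. -/

/-! ### Counting functions with many collisions -/

namespace Tabulation

section Counting

open Finset

open Classical in
/-- The set of the outcomes in `E`. -/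
noncomputable def outcomes {Ω : Type*} [Fintype Ω] (E : Ω → Prop) : Finset Ω := univ.filter E

@[simp]
theorem mem_outcomes {Ω : Type*} [Fintype Ω] {E : Ω → Prop} {ω : Ω} : ω ∈ outcomes E ↔ E ω := by
  simp [outcomes]

/-- The number of outcomes in `E`. -/
noncomputable def count {Ω : Type*} [Fintype Ω] (E : Ω → Prop) : ℕ := (outcomes E).card

/-- If every act of `Y` permutes `Ω` and every orbit map hits `E` at most `B` times, then the
density of `E` is at most `B / |Y|`. -/
theorem card_mul_le_of_act {Ω Y : Type*} [Fintype Ω] [Fintype Y] (act : Y → Ω → Ω)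
    (hact : ∀ y, Function.Injective (act y)) (E : Ω → Prop) (B : ℕ)
    (hB : ∀ ω, count (fun y => E (act y ω)) ≤ B) :
    count E * Fintype.card Y ≤ B * Fintype.card Ω := by
  classical
  unfold count outcomes at *
  have h1 : ∀ y, (univ.filter fun ω => E (act y ω)).card = (univ.filter E).card := by
    intro y
    have hb : Function.Bijective (act y) := (Finite.injective_iff_bijective).1 (hact y)
    refine card_bij (fun ω _ => act y ω) (by simp) (fun a _ b _ h => hact y h) ?_
    intro b hb'
    obtain ⟨a, rfl⟩ := hb.2 b
    exact ⟨a, by simpa using hb', rfl⟩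
  have h2 : ∑ y : Y, (univ.filter fun ω => E (act y ω)).card
      = ∑ ω : Ω, (univ.filter fun y => E (act y ω)).card := by
    simp only [card_filter]
    exact sum_comm
  simp only [h1, sum_const, card_univ, smul_eq_mul] at h2
  calc (univ.filter E).card * Fintype.card Y
      = ∑ ω : Ω, (univ.filter fun y => E (act y ω)).card := by rw [mul_comm]; exact h2
    _ ≤ ∑ _ω : Ω, B := sum_le_sum fun ω _ => hB ω
    _ = B * Fintype.card Ω := by simp [mul_comm]

variable {α ι R : Type*} [Fintype α] [Fintype ι] [Fintype R] [DecidableEq α] [DecidableEq ι]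
  [DecidableEq R]

/-- Encoding argument: `φ` is determined by its values off `Z` together with, for each element of
`Z`, one earlier element with the same value. Decoding proceeds by well-founded induction along `α`,
so each position in `Z` costs `|α|` choices instead of `|R|`. -/
theorem card_colliding_at_le [LinearOrder α] (Z : Finset (α × ι)) :
    (univ.filter fun φ : α → ι → R => ∀ z ∈ Z, ∃ a < z.1, φ a z.2 = φ z.1 z.2).card
      * Fintype.card R ^ Z.card
      ≤ Fintype.card α ^ Z.card * Fintype.card R ^ (Fintype.card α * Fintype.card ι) := by
  classical
  let Ψ := {φ : α → ι → R // ∀ z ∈ Z, ∃ a < z.1, φ a z.2 = φ z.1 z.2}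
  let f : Ψ → (Z → α) × ({z // z ∉ Z} → R) := fun φ =>
    (fun z => (φ.2 z.1 z.2).choose, fun z => φ.1 z.1.1 z.1.2)
  have hf : Function.Injective f := by
    intro φ ψ h
    have h1 : ∀ z : Z, (φ.2 z.1 z.2).choose = (ψ.2 z.1 z.2).choose :=
      fun z => congrFun (congrArg Prod.fst h) z
    have h2 : ∀ z : {z // z ∉ Z}, φ.1 z.1.1 z.1.2 = ψ.1 z.1.1 z.1.2 :=
      fun z => congrFun (congrArg Prod.snd h) z
    apply Subtype.ext
    have key : ∀ a : α, ∀ i, φ.1 a i = ψ.1 a i := by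
      intro a
      induction a using WellFoundedLT.induction with
      | _ a ih =>
        intro i
        by_cases hz : (a, i) ∈ Z
        · have e1 := (φ.2 (a, i) hz).choose_spec
          have e2 := (ψ.2 (a, i) hz).choose_spec
          have e3 := h1 ⟨(a, i), hz⟩
          dsimp only at e1 e2 e3
          rw [← e1.2, ← e2.2, ← e3]
          exact ih _ e1.1 i
        · exact h2 ⟨(a, i), hz⟩
    funext a i
    exact key a i
  have hc := Fintype.card_le_of_injective f hf
  have hcz : Fintype.card {z // z ∉ Z} + Z.card = Fintype.card α * Fintype.card ι := by
    have h3 := Fintype.card_subtype_compl (fun z : α × ι => z ∈ Z)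
    have h4 : Fintype.card {z // z ∈ Z} = Z.card := Fintype.card_coe Z
    have h5 : Z.card ≤ Fintype.card (α × ι) := card_le_univ Z
    rw [Fintype.card_prod] at h3 h5
    omega
  rw [Fintype.card_prod, Fintype.card_fun, Fintype.card_fun, Fintype.card_coe] at hc
  rw [← hcz, pow_add, ← mul_assoc]
  refine Nat.mul_le_mul_right _ ?_
  rw [← Fintype.card_subtype]
  exact hc

/-- Union over the sets `Z` of exactly `z` colliding positions; their number, a binomial
coefficient, is bounded crudely by `2 ^ (|α| |ι|)`. -/
theorem card_many_colliding_le [LinearOrder α] (z : ℕ) :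
    (univ.filter fun φ : α → ι → R =>
        z ≤ (univ.filter fun q : α × ι => ∃ a < q.1, φ a q.2 = φ q.1 q.2).card).card
      * Fintype.card R ^ z
      ≤ 2 ^ (Fintype.card α * Fintype.card ι) *
        (Fintype.card α ^ z * Fintype.card R ^ (Fintype.card α * Fintype.card ι)) := by
  classical
  have hsub : (univ.filter fun φ : α → ι → R =>
        z ≤ (univ.filter fun q : α × ι => ∃ a < q.1, φ a q.2 = φ q.1 q.2).card)
      ⊆ (powersetCard z (univ : Finset (α × ι))).biUnion fun Z =>
        univ.filter fun φ : α → ι → R => ∀ q ∈ Z, ∃ a < q.1, φ a q.2 = φ q.1 q.2 := by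
    intro φ hφ
    rw [mem_filter] at hφ
    obtain ⟨Z, hZ, hZc⟩ := exists_subset_card_eq hφ.2
    rw [mem_biUnion]
    refine ⟨Z, by simp [mem_powersetCard, hZc], ?_⟩
    rw [mem_filter]
    exact ⟨mem_univ _, fun q hq => (mem_filter.1 (hZ hq)).2⟩
  calc _ ≤ (∑ Z ∈ powersetCard z (univ : Finset (α × ι)),
        (univ.filter fun φ : α → ι → R => ∀ q ∈ Z, ∃ a < q.1, φ a q.2 = φ q.1 q.2).card)
          * Fintype.card R ^ z := Nat.mul_le_mul_right _ ((card_le_card hsub).trans card_biUnion_le)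
    _ = ∑ Z ∈ powersetCard z (univ : Finset (α × ι)),
        (univ.filter fun φ : α → ι → R => ∀ q ∈ Z, ∃ a < q.1, φ a q.2 = φ q.1 q.2).card
          * Fintype.card R ^ z := sum_mul _ _ _
    _ ≤ ∑ Z ∈ powersetCard z (univ : Finset (α × ι)),
        Fintype.card α ^ z * Fintype.card R ^ (Fintype.card α * Fintype.card ι) := by
        refine sum_le_sum fun Z hZ => ?_
        have hZc := (mem_powersetCard.1 hZ).2
        have := card_colliding_at_le (R := R) Z
        rwa [hZc] at this
    _ = (powersetCard z (univ : Finset (α × ι))).card *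
        (Fintype.card α ^ z * Fintype.card R ^ (Fintype.card α * Fintype.card ι)) := by
        rw [sum_const, smul_eq_mul]
    _ ≤ _ := by
        refine Nat.mul_le_mul_right _ ?_
        rw [card_powersetCard, card_univ, Fintype.card_prod]
        exact Nat.choose_le_two_pow _ _

/-- A nonunique element that collides with no earlier one is the first of its fibre. Such elements
have distinct values, and each of these values is taken by some later, colliding element, so there
are at most as many of them as of colliding ones. -/
theorem card_nonunique_le {α R : Type*} [Fintype α] [DecidableEq α] [DecidableEq R]
    [LinearOrder α] (ψ : α → R) :
    (univ.filter fun a => ∃ b, b ≠ a ∧ ψ b = ψ a).card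
      ≤ 2 * (univ.filter fun a => ∃ b < a, ψ b = ψ a).card := by
  classical
  set c := univ.filter fun a => ∃ b < a, ψ b = ψ a with hc
  set n := univ.filter fun a => ∃ b, b ≠ a ∧ ψ b = ψ a with hn
  have h1 : (n \ c).card ≤ c.card := by
    have hinj : Set.InjOn ψ (n \ c : Finset α) := by
      intro a ha b hb hab
      by_contra hne
      simp only [hc, hn, coe_sdiff, coe_filter, mem_univ, true_and, Set.mem_sdiff,
        Set.mem_ofPred_eq] at ha hb
      rcases lt_or_gt_of_ne hne with h | h
      · exact hb.2 ⟨a, h, hab⟩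
      · exact ha.2 ⟨b, h, hab.symm⟩
    rw [← card_image_of_injOn hinj]
    refine (card_le_card ?_).trans (card_image_le (s := c) (f := ψ))
    intro r hr
    obtain ⟨a, ha, rfl⟩ := mem_image.1 hr
    simp only [hc, hn, mem_sdiff, mem_filter, mem_univ, true_and] at ha
    obtain ⟨⟨b, hba, hb⟩, h⟩ := ha
    rcases lt_or_gt_of_ne hba with h' | h'
    · exact absurd ⟨b, h', hb⟩ h
    · exact mem_image.2 ⟨b, by simp only [hc, mem_filter, mem_univ, true_and]; exact ⟨a, h', hb.symm⟩, hb⟩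
  have h2 := card_le_card_sdiff_add_card (s := n) (t := c)
  omega

/-- The number of functions with at least `2 z` coordinates that are not unique. -/
theorem card_many_nonunique_le (z : ℕ) :
    (univ.filter fun φ : α → ι → R =>
        2 * z ≤ ∑ a, (univ.filter fun i => ∃ b, b ≠ a ∧ φ b i = φ a i).card).card
      * Fintype.card R ^ z
      ≤ 2 ^ (Fintype.card α * Fintype.card ι) *
        (Fintype.card α ^ z * Fintype.card R ^ (Fintype.card α * Fintype.card ι)) := by
  classical
  -- Any order will do; it only gives a meaning to "earlier".
  let _ : LinearOrder α := LinearOrder.lift' (Fintype.equivFin α) (Fintype.equivFin α).injective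
  refine le_trans (Nat.mul_le_mul_right _ (card_le_card ?_))
    (card_many_colliding_le (α := α) (ι := ι) (R := R) z)
  intro φ hφ
  rw [mem_filter] at hφ ⊢
  refine ⟨mem_univ _, ?_⟩
  have h1 : ∑ a, (univ.filter fun i => ∃ b, b ≠ a ∧ φ b i = φ a i).card
      = ∑ i, (univ.filter fun a => ∃ b, b ≠ a ∧ φ b i = φ a i).card := by
    simp only [card_filter]
    exact sum_comm
  have h2 : (univ.filter fun q : α × ι => ∃ a < q.1, φ a q.2 = φ q.1 q.2).card
      = ∑ i, (univ.filter fun a => ∃ b < a, φ b i = φ a i).card := by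
    simp only [card_filter]
    rw [Fintype.sum_prod_type, sum_comm]
  have h3 : ∑ i, (univ.filter fun a => ∃ b, b ≠ a ∧ φ b i = φ a i).card
      ≤ ∑ i, 2 * (univ.filter fun a => ∃ b < a, φ b i = φ a i).card :=
    sum_le_sum fun i _ => card_nonunique_le fun a => φ a i
  rw [← mul_sum] at h3
  omega

end Counting

end Tabulation

/-! ### Recursive tabulation hashing -/

namespace Tabulation

/-- The bitwise exclusive or of `φ 0, …, φ (F - 1)`. -/
def xsum : ℕ → (ℕ → ℕ) → ℕ
  | 0, _ => 0
  | F + 1, φ => xsum F φ ^^^ φ F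

theorem xsum_congr {F : ℕ} {φ ψ : ℕ → ℕ} (h : ∀ f < F, φ f = ψ f) : xsum F φ = xsum F ψ := by
  induction F with
  | zero => rfl
  | succ F ih => simp only [xsum]; rw [ih fun f hf => h f (by omega), h F (by omega)]

theorem xsum_xor (F : ℕ) (φ ψ : ℕ → ℕ) :
    xsum F (fun f => φ f ^^^ ψ f) = xsum F φ ^^^ xsum F ψ := by
  induction F with
  | zero => simp [xsum]
  | succ F ih =>
    simp only [xsum, ih]
    apply Nat.eq_of_testBit_eq; intro i
    simp only [Nat.testBit_xor]
    grind

theorem xsum_single (F f₀ d : ℕ) :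
    xsum F (fun f => if f = f₀ then d else 0) = if f₀ < F then d else 0 := by
  induction F with
  | zero => rfl
  | succ F ih =>
    simp only [xsum, ih]
    rcases lt_trichotomy f₀ F with h | h | h
    · rw [if_pos h, if_neg (by omega), if_pos (by omega), Nat.xor_zero]
    · subst h; simp
    · rw [if_neg (by omega), if_neg (by omega), if_neg (by omega), Nat.xor_zero]

theorem xsum_lt {M F : ℕ} {φ : ℕ → ℕ} (h : ∀ f < F, φ f < 2 ^ M) : xsum F φ < 2 ^ M := by
  induction F with
  | zero => exact Nat.two_pow_pos M
  | succ F ih => exact Nat.xor_lt_two_pow (ih fun f hf => h f (by omega)) (h F (by omega))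

/-- The parameters: fields have `M` bits, an entry of a table of level `t` has `2 ^ (δ + t + 1)`
fields, and a field is divided after its lowest bits in one of `2 ^ γ` ways, in steps of `e` bits. -/
structure Params where
  M : ℕ
  e : ℕ
  γ : ℕ
  δ : ℕ

variable (P : Params)

/-- The number of low bits in the division of field `f`. -/
def Params.cut (f : ℕ) : ℕ := (f % 2 ^ P.γ + 2) * P.e + 8

/-- The lowest `a` bits of `u` together with the other bits of `v`. -/
def comb (a u v : ℕ) : ℕ := u % 2 ^ a + v / 2 ^ a * 2 ^ a

/-- The address of field `g` of entry `v` of table `f` of level `t`. -/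
def cell (t f v g : ℕ) : ℕ := ((2 ^ (P.δ + t) + f) * 2 ^ P.M + v) * 2 ^ (P.δ + t + 1) + g

/-- Simple tabulation of the characters `I 0, I 1, …` with the tables of level `t`. -/
def out (T : ℕ → ℕ) (t : ℕ) (I : ℕ → ℕ) (g : ℕ) : ℕ :=
  xsum (2 ^ (P.δ + t)) fun f => T (cell P t f (I f) g)

/-- The characters by which a string `x` of length `2 ^ t` accesses the tables of level `t`. -/
def idx (T : ℕ → ℕ) : ℕ → (ℕ → ℕ) → ℕ → ℕ
  | 0, x, _ => x 0
  | t + 1, x, f => comb (P.cut f) (out P T t (idx T t x) f)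
      (out P T t (idx T t fun i => x (2 ^ t + i)) f)

variable {P}

theorem comb_self (a u : ℕ) : comb a u u = u := by
  unfold comb
  rw [mul_comm]
  exact Nat.mod_add_div u _

theorem comb_mod (a u v : ℕ) : comb a u v % 2 ^ a = u % 2 ^ a := by
  unfold comb
  rw [Nat.add_mul_mod_self_right, Nat.mod_mod]

theorem comb_div (a u v : ℕ) : comb a u v / 2 ^ a = v / 2 ^ a := by
  unfold comb
  rw [Nat.add_mul_div_right _ _ (Nat.two_pow_pos a), Nat.div_eq_of_lt (Nat.mod_lt _ (Nat.two_pow_pos a)),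
    zero_add]

theorem comb_lt {M a u v : ℕ} (hu : u < 2 ^ M) (hv : v < 2 ^ M) : comb a u v < 2 ^ M := by
  rcases le_total a M with h | h
  · obtain ⟨c, rfl⟩ := Nat.exists_eq_add_of_le h
    rw [pow_add] at hv ⊢
    have h1 := (Nat.div_lt_iff_lt_mul (Nat.two_pow_pos a)).2 (by rwa [mul_comm] at hv)
    have h2 := Nat.mod_lt u (Nat.two_pow_pos a)
    unfold comb
    calc u % 2 ^ a + v / 2 ^ a * 2 ^ a < 2 ^ a + v / 2 ^ a * 2 ^ a := by omega
      _ = (v / 2 ^ a + 1) * 2 ^ a := by ring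
      _ ≤ 2 ^ c * 2 ^ a := Nat.mul_le_mul_right _ h1
      _ = 2 ^ a * 2 ^ c := mul_comm _ _
  · have : v / 2 ^ a = 0 := Nat.div_eq_of_lt (hv.trans_le (Nat.pow_le_pow_right (by omega) h))
    unfold comb
    rw [this, zero_mul, add_zero]
    exact (Nat.mod_le _ _).trans_lt hu

theorem cell_div {t f v g : ℕ} (hg : g < 2 ^ (P.δ + t + 1)) :
    cell P t f v g / 2 ^ (P.δ + t + 1) = (2 ^ (P.δ + t) + f) * 2 ^ P.M + v := by
  unfold cell
  rw [mul_comm, Nat.mul_add_div (Nat.two_pow_pos _), Nat.div_eq_of_lt hg, add_zero]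

theorem cell_mod {t f v g : ℕ} (hg : g < 2 ^ (P.δ + t + 1)) :
    cell P t f v g % 2 ^ (P.δ + t + 1) = g := by
  unfold cell
  rw [mul_comm, Nat.mul_add_mod, Nat.mod_eq_of_lt hg]

theorem entry_inj {t f v f' v' : ℕ} (hv : v < 2 ^ P.M) (hv' : v' < 2 ^ P.M)
    (h : (2 ^ (P.δ + t) + f) * 2 ^ P.M + v = (2 ^ (P.δ + t) + f') * 2 ^ P.M + v') :
    f = f' ∧ v = v' := by
  have h1 := congrArg (· / 2 ^ P.M) h
  have h2 := congrArg (· % 2 ^ P.M) h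
  rw [mul_comm, Nat.mul_add_div (Nat.two_pow_pos _), Nat.div_eq_of_lt hv, mul_comm,
    Nat.mul_add_div (Nat.two_pow_pos _), Nat.div_eq_of_lt hv'] at h1
  rw [mul_comm, Nat.mul_add_mod, Nat.mod_eq_of_lt hv, mul_comm, Nat.mul_add_mod,
    Nat.mod_eq_of_lt hv'] at h2
  omega

theorem entry_lt {t f v : ℕ} (hf : f < 2 ^ (P.δ + t)) (hv : v < 2 ^ P.M) :
    (2 ^ (P.δ + t) + f) * 2 ^ P.M + v < 2 ^ (P.δ + t + 1 + P.M) := by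
  rw [show 2 ^ (P.δ + t + 1 + P.M) = (2 ^ (P.δ + t) + 2 ^ (P.δ + t)) * 2 ^ P.M by ring]
  nlinarith [Nat.two_pow_pos P.M]

theorem cell_lt {t f v g : ℕ} (hf : f < 2 ^ (P.δ + t)) (hv : v < 2 ^ P.M)
    (hg : g < 2 ^ (P.δ + t + 1)) : cell P t f v g < 2 ^ (P.M + 2 * P.δ + 2 * t + 2) := by
  have h := entry_lt hf hv
  rw [show P.M + 2 * P.δ + 2 * t + 2 = (P.δ + t + 1 + P.M) + (P.δ + t + 1) by ring,
    pow_add _ (P.δ + t + 1 + P.M)]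
  unfold cell
  nlinarith

/-- The summand `2 ^ (δ + t)` in the number of an entry acts as a leading bit `1`. With `cell_lt`,
level `t` occupies a dyadic interval of addresses, disjoint from those of the other levels, and no
offsets have to be stored. -/
theorem le_cell (t f v g : ℕ) : 2 ^ (P.M + 2 * P.δ + 2 * t + 1) ≤ cell P t f v g := by
  rw [show P.M + 2 * P.δ + 2 * t + 1 = (P.δ + t) + P.M + (P.δ + t + 1) by ring, pow_add, pow_add]
  unfold cell
  have : 2 ^ (P.δ + t) * 2 ^ P.M ≤ (2 ^ (P.δ + t) + f) * 2 ^ P.M + v := by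
    nlinarith [Nat.two_pow_pos P.M]
  exact (Nat.mul_le_mul_right _ this).trans (Nat.le_add_right _ _)

theorem out_xor (T K : ℕ → ℕ) (t : ℕ) (I : ℕ → ℕ) (g : ℕ) :
    out P (fun a => T a ^^^ K a) t I g = out P T t I g ^^^ out P K t I g := xsum_xor _ _ _

theorem out_lt {T : ℕ → ℕ} (hT : ∀ a, T a < 2 ^ P.M) (t : ℕ) (I : ℕ → ℕ) (g : ℕ) :
    out P T t I g < 2 ^ P.M := xsum_lt fun _ _ => hT _

theorem idx_lt {T : ℕ → ℕ} (hT : ∀ a, T a < 2 ^ P.M) {t : ℕ} {x : ℕ → ℕ}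
    (hx : ∀ i < 2 ^ t, x i < 2 ^ P.M) (f : ℕ) : idx P T t x f < 2 ^ P.M := by
  cases t with
  | zero => exact hx 0 (by simp)
  | succ t => exact comb_lt (out_lt hT _ _ _) (out_lt hT _ _ _)

theorem out_congr_index {T : ℕ → ℕ} {t : ℕ} {I I' : ℕ → ℕ} (h : ∀ f < 2 ^ (P.δ + t), I f = I' f)
    (g : ℕ) : out P T t I g = out P T t I' g := xsum_congr fun f hf => by rw [h f hf]

theorem idx_congr_string (T : ℕ → ℕ) {t : ℕ} {x x' : ℕ → ℕ} (h : ∀ i < 2 ^ t, x i = x' i) (f : ℕ) :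
    idx P T t x f = idx P T t x' f := by
  induction t generalizing x x' f with
  | zero => exact h 0 (by simp)
  | succ t ih =>
    rw [pow_succ] at h
    simp only [idx]
    rw [show idx P T t x = idx P T t x' from funext fun f => ih (fun i hi => h i (by omega)) f,
      show (idx P T t fun i => x (2 ^ t + i)) = idx P T t fun i => x' (2 ^ t + i) from
        funext fun f => ih (fun i hi => h _ (by omega)) f]

theorem out_congr_table {T T' : ℕ → ℕ} {t : ℕ}
    (h : ∀ a < 2 ^ (P.M + 2 * P.δ + 2 * t + 2), T a = T' a) {I : ℕ → ℕ}
    (hI : ∀ f, I f < 2 ^ P.M) {g : ℕ} (hg : g < 2 ^ (P.δ + t + 1)) :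
    out P T t I g = out P T' t I g := xsum_congr fun _ hf => h _ (cell_lt hf (hI _) hg)

/-- The access to the tables of level `t` depends only on the tables of the lower levels. -/
theorem idx_congr_table {T T' : ℕ → ℕ} (hT : ∀ a, T a < 2 ^ P.M) {t : ℕ}
    (h : ∀ a < 2 ^ (P.M + 2 * P.δ + 2 * t + 1), T a = T' a)
    {x : ℕ → ℕ} (hx : ∀ i, x i < 2 ^ P.M) {f : ℕ} (hf : f < 2 ^ (P.δ + t)) :
    idx P T t x f = idx P T' t x f := by
  induction t generalizing x f with
  | zero => rfl
  | succ t ih =>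
    have h' : ∀ a < 2 ^ (P.M + 2 * P.δ + 2 * t + 2), T a = T' a := fun a ha =>
      h a (ha.trans_le (Nat.pow_le_pow_right (by omega) (by omega)))
    have key : ∀ y : ℕ → ℕ, (∀ i, y i < 2 ^ P.M) →
        out P T t (idx P T t y) f = out P T' t (idx P T' t y) f := by
      intro y hy
      rw [out_congr_table h' (fun f => idx_lt hT (fun i _ => hy i) f) hf]
      exact out_congr_index (fun f hf => ih (fun a ha =>
        h' a (ha.trans_le (Nat.pow_le_pow_right (by omega) (by omega)))) hy hf) _
    simp only [idx]
    rw [key x hx, key _ fun i => hx _]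

/-- If the access to the tables of level `t` has the unique neighbour property on `A`, then the
tables of level `t` can be chosen so that simple tabulation takes arbitrary values on `A`. -/
theorem exists_table {U : Type*} [DecidableEq U] {t : ℕ} {F : U → ℕ → ℕ}
    (hF : ∀ x f, F x f < 2 ^ P.M) (A : Finset U)
    (hA : ∀ B ⊆ A, B.Nonempty → ∃ x ∈ B, ∃ f < 2 ^ (P.δ + t), ∀ y ∈ B, y ≠ x → F y f ≠ F x f)
    (Y : U → ℕ → ℕ) (hY : ∀ x g, Y x g < 2 ^ P.M) :
    ∃ K : ℕ → ℕ, (∀ a, K a < 2 ^ P.M) ∧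
      (∀ a, K a ≠ 0 → 2 ^ (P.M + 2 * P.δ + 2 * t + 1) ≤ a ∧ a < 2 ^ (P.M + 2 * P.δ + 2 * t + 2)) ∧
      ∀ x ∈ A, ∀ g < 2 ^ (P.δ + t + 1), out P K t (F x) g = Y x g := by
  induction A using Finset.strongInduction with
  | H A ih =>
    rcases A.eq_empty_or_nonempty with rfl | hne
    · exact ⟨fun _ => 0, fun _ => Nat.two_pow_pos _, by simp, by simp⟩
    -- Peeling: `K` serves all elements but `x`. The entry `F x f` of table `f` is read by `x`
    -- alone, so adding the discrepancy `D` there corrects `x` without disturbing the others.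
    · obtain ⟨x, hx, f, hf, hu⟩ := hA A subset_rfl hne
      obtain ⟨K, hK1, hK2, hK3⟩ := ih (A.erase x) (Finset.erase_ssubset hx)
        fun B hB => hA B (hB.trans (Finset.erase_subset _ _))
      let r := (2 ^ (P.δ + t) + f) * 2 ^ P.M + F x f
      let D : ℕ → ℕ := fun g => Y x g ^^^ out P K t (F x) g
      have hD : ∀ g, D g < 2 ^ P.M := fun g => Nat.xor_lt_two_pow (hY x g) (out_lt hK1 _ _ _)
      let L : ℕ → ℕ := fun a =>
        if a / 2 ^ (P.δ + t + 1) = r then D (a % 2 ^ (P.δ + t + 1)) else 0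
      have hL : ∀ f' v g, g < 2 ^ (P.δ + t + 1) → v < 2 ^ P.M →
          L (cell P t f' v g) = if f' = f ∧ v = F x f then D g else 0 := by
        intro f' v g hg hv
        simp only [L, cell_div hg, cell_mod hg]
        refine if_congr ⟨fun h => entry_inj hv (hF _ _) h, ?_⟩ rfl rfl
        rintro ⟨rfl, rfl⟩
        rfl
      refine ⟨fun a => K a ^^^ L a, fun a => ?_, fun a ha => ?_, fun y hy g hg => ?_⟩
      · refine Nat.xor_lt_two_pow (hK1 a) ?_
        simp only [L]
        split_ifs
        · exact hD _
        · exact Nat.two_pow_pos _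
      · by_cases h : K a = 0
        · have h' : L a ≠ 0 := by
            intro h'; simp [h, h'] at ha
          simp only [L] at h'
          have h2 : a / 2 ^ (P.δ + t + 1) = r := by
            by_contra h3; exact h' (if_neg h3)
          have h3 : a = cell P t f (F x f) (a % 2 ^ (P.δ + t + 1)) := by
            unfold cell
            have := Nat.div_add_mod a (2 ^ (P.δ + t + 1))
            rw [h2, mul_comm] at this
            exact this.symm
          rw [h3]
          exact ⟨le_cell _ _ _ _, cell_lt hf (hF _ _) (Nat.mod_lt _ (Nat.two_pow_pos _))⟩
        · exact hK2 a h
      · rw [out_xor]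
        have h1 : out P L t (F y) g = xsum (2 ^ (P.δ + t))
            fun f' => if f' = f then (if F y f = F x f then D g else 0) else 0 := by
          refine xsum_congr fun f' _ => ?_
          rw [hL _ _ _ hg (hF _ _)]
          by_cases h : f' = f
          · subst h; simp
          · simp [h]
        rw [h1, xsum_single, if_pos hf]
        by_cases hyx : y = x
        · subst hyx
          rw [if_pos rfl]
          simp only [D]
          rw [Nat.xor_comm (Y y g), ← Nat.xor_assoc, Nat.xor_self, Nat.zero_xor]
        · rw [if_neg (hu y hy hyx), Nat.xor_zero]
          exact hK3 y (Finset.mem_erase.2 ⟨hyx, hy⟩) g hg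

end Tabulation

/-! ### Independence of outputs under unique neighbours -/

namespace Tabulation

theorem card_bitVec (w : ℕ) : Fintype.card (BitVec w) = 2 ^ w := by
  rw [Fintype.card_congr (β := Fin (2 ^ w)) ⟨BitVec.toFin, BitVec.ofFin, fun _ => rfl, fun _ => rfl⟩,
    Fintype.card_fin]

/-- A finite set of outcomes, each of which fills the table fields with addresses below
`2 ^ (M + 2 δ + 2 l + 2)`; the outcomes can be translated by any filling. -/
structure TableSpace (P : Params) (l : ℕ) (Ω : Type*) where
  T : Ω → ℕ → ℕ
  T_lt : ∀ ω a, T ω a < 2 ^ P.M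
  flip : (ℕ → ℕ) → Ω → Ω
  flip_inj : ∀ K, Function.Injective (flip K)
  T_flip : ∀ K, (∀ a, K a < 2 ^ P.M) → ∀ ω a, a < 2 ^ (P.M + 2 * P.δ + 2 * l + 2) →
    T (flip K ω) a = T ω a ^^^ K a

/-- Each nonempty set of at most `k` elements has an element with a unique neighbour. -/
def UniqueOn {U : Type*} (F : U → ℕ → ℕ) (D k : ℕ) : Prop :=
  ∀ A : Finset U, A.Nonempty → A.card ≤ k → ∃ x ∈ A, ∃ f < D, ∀ y ∈ A, y ≠ x → F y f ≠ F x f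

open Classical in
/-- The number of coordinates in which `ψ a` is not unique among the elements of `A`. -/
noncomputable def nonunique {U ι : Type*} [Fintype ι] (A : Finset U) (ψ : U → ι → ℕ) (a : U) :
    ℕ :=
  (Finset.univ.filter fun i => ∃ b ∈ A, b ≠ a ∧ ψ b i = ψ a i).card

section Sampling

open Finset Classical

variable {P : Params} {l : ℕ} {Ω : Type*} [Fintype Ω] (S : TableSpace P l Ω)

/-- The values on `A` of `α` bits from each of some fields of the outputs of level `t` are
independent and uniformly distributed if the access to the tables has unique neighbours, and many
collisions are unlikely. -/
theorem card_many_collisions_le {t : ℕ} (ht : t ≤ l) {U : Type*} {k : ℕ} (X : U → ℕ → ℕ)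
    (hX : ∀ x i, X x i < 2 ^ P.M) (A : Finset U) (hA : A.card ≤ k)
    {ι : Type*} [Fintype ι] (fld : ι → ℕ) (hfld : Function.Injective fld)
    (hfld' : ∀ i, fld i < 2 ^ (P.δ + t + 1)) (α : ℕ) (proj emb : ℕ → ℕ)
    (hproj : ∀ v, v < 2 ^ P.M → proj v < 2 ^ α) (hemb : ∀ y, y < 2 ^ α → emb y < 2 ^ P.M)
    (hpe : ∀ v y, y < 2 ^ α → proj (v ^^^ emb y) = proj v ^^^ y) (z : ℕ) :
    count (fun ω : Ω => UniqueOn (fun x => idx P (S.T ω) t (X x)) (2 ^ (P.δ + t)) k ∧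
        2 * z ≤ ∑ a ∈ A, nonunique A
          (fun x i => proj (out P (S.T ω) t (idx P (S.T ω) t (X x)) (fld i))) a)
      * (2 ^ α) ^ z ≤ 2 ^ (A.card * Fintype.card ι) * A.card ^ z * Fintype.card Ω := by
  let Y := A → ι → BitVec α
  -- The access is cut off after the existing tables, so that all of `F ω` is determined by the
  -- tables of lower levels and `F (act y ω) = F ω` holds as an equality of functions.
  let F : Ω → U → ℕ → ℕ := fun ω x f => if f < 2 ^ (P.δ + t) then idx P (S.T ω) t (X x) f else 0
  have hF : ∀ ω x f, F ω x f < 2 ^ P.M := by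
    intro ω x f
    simp only [F]
    split_ifs
    · exact idx_lt (S.T_lt ω) (fun i _ => hX x i) f
    · exact Nat.two_pow_pos _
  have hout : ∀ ω (T : ℕ → ℕ) x g, out P T t (idx P (S.T ω) t (X x)) g = out P T t (F ω x) g :=
    fun ω T x g => out_congr_index (fun f hf => by simp only [F, if_pos hf]) g
  let Ok : (U → ℕ → ℕ) → Prop := fun G => ∀ B ⊆ A, B.Nonempty →
    ∃ x ∈ B, ∃ f < 2 ^ (P.δ + t), ∀ y ∈ B, y ≠ x → G y f ≠ G x f
  have hOk : ∀ ω, UniqueOn (fun x => idx P (S.T ω) t (X x)) (2 ^ (P.δ + t)) k → Ok (F ω) := by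
    intro ω h B hBA hB
    obtain ⟨x, hx, f, hf, hu⟩ := h B hB ((card_le_card hBA).trans hA)
    refine ⟨x, hx, f, hf, fun y hy hyx => ?_⟩
    simpa only [F, if_pos hf] using hu y hy hyx
  let Yx : Y → U → ℕ → ℕ := fun y x =>
    if h : x ∈ A then Function.extend fld (fun i => emb (y ⟨x, h⟩ i).toNat) fun _ => 0 else fun _ => 0
  have hYx : ∀ y x g, Yx y x g < 2 ^ P.M := by
    intro y x g
    simp only [Yx]
    split_ifs with h
    · rw [Function.extend_def]
      split_ifs
      · exact hemb _ (BitVec.isLt _)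
      · exact Nat.two_pow_pos _
    · exact Nat.two_pow_pos _
  have hYx' : ∀ y (a : A) i, Yx y a (fld i) = emb (y a i).toNat := by
    intro y a i
    simp only [Yx, dif_pos a.2]
    rw [hfld.extend_apply]
  -- The filling is chosen from the access `G` and the target `y` only, not from the outcome. The
  -- translation by it touches only level `t` and so preserves the access; therefore it can be
  -- undone, which makes `act y` injective.
  have hex : ∀ (G : U → ℕ → ℕ) (y : Y), ∃ K : ℕ → ℕ, (∀ x f, G x f < 2 ^ P.M) → Ok G →
      (∀ a, K a < 2 ^ P.M) ∧
      (∀ a, K a ≠ 0 → 2 ^ (P.M + 2 * P.δ + 2 * t + 1) ≤ a ∧ a < 2 ^ (P.M + 2 * P.δ + 2 * t + 2)) ∧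
      ∀ x ∈ A, ∀ g < 2 ^ (P.δ + t + 1), out P K t (G x) g = Yx y x g := by
    intro G y
    by_cases hG : (∀ x f, G x f < 2 ^ P.M) ∧ Ok G
    · obtain ⟨K, hK⟩ := exists_table hG.1 A hG.2 (Yx y) (hYx y)
      exact ⟨K, fun _ _ => hK⟩
    · exact ⟨fun _ => 0, fun h1 h2 => absurd ⟨h1, h2⟩ hG⟩
  choose κ hκ using hex
  let act : Y → Ω → Ω := fun y ω => if Ok (F ω) then S.flip (κ (F ω) y) ω else ω
  have hle : 2 ^ (P.M + 2 * P.δ + 2 * t + 2) ≤ 2 ^ (P.M + 2 * P.δ + 2 * l + 2) :=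
    Nat.pow_le_pow_right (by omega) (by omega)
  have hFact : ∀ y ω, F (act y ω) = F ω := by
    intro y ω
    by_cases h : Ok (F ω)
    · simp only [act, if_pos h]
      funext x f
      simp only [F]
      split_ifs with hf
      · refine idx_congr_table (S.T_lt _) (fun a ha => ?_) (hX x) hf
        obtain ⟨h1, h2, -⟩ := hκ (F ω) y (hF ω) h
        rw [S.T_flip _ h1 _ _ (lt_of_lt_of_le ha ((Nat.pow_le_pow_right (by omega)
          (by omega)).trans hle))]
        have : κ (F ω) y a = 0 := by
          by_contra h3
          exact absurd (h2 a h3).1 (not_le.2 ha)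
        rw [this, Nat.xor_zero]
      · rfl
    · simp only [act, if_neg h]
  have hact : ∀ y, Function.Injective (act y) := by
    intro y ω ω' h
    have hFF : F ω = F ω' := by rw [← hFact y ω, ← hFact y ω', h]
    simp only [act, hFF] at h
    split_ifs at h
    · exact S.flip_inj _ h
    · exact h
  let C : Finset Y := univ.filter fun φ : Y =>
    2 * z ≤ ∑ a, (univ.filter fun i => ∃ b, b ≠ a ∧ φ b i = φ a i).card
  have hB : ∀ ω, count (fun y => UniqueOn (fun x => idx P (S.T (act y ω)) t (X x))
      (2 ^ (P.δ + t)) k ∧ 2 * z ≤ ∑ a ∈ A, nonunique A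
          (fun x i => proj (out P (S.T (act y ω)) t (idx P (S.T (act y ω)) t (X x)) (fld i))) a)
      ≤ C.card := by
    intro ω
    unfold count
    by_cases h : Ok (F ω)
    -- Along the orbit of `ω` the projected outputs on `A` are `base ^^^ y`, which is injective in
    -- `y`. The bad `y` are thus no more than the functions with many collisions.
    · let base : Y := fun a i => BitVec.ofNat α (proj (out P (S.T ω) t (F ω a) (fld i)))
      let sh : Y → Y := fun y a i => base a i ^^^ y a i
      have hsh : Function.Injective sh := by
        intro y y' hy
        funext a i
        have h1 := congrFun (congrFun hy a) i
        simp only [sh] at h1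
        have h2 := congrArg (fun v => base a i ^^^ v) h1
        simpa [← BitVec.xor_assoc] using h2
      rw [← card_image_of_injective _ hsh]
      refine card_le_card fun φ hφ => ?_
      obtain ⟨y, hy, rfl⟩ := mem_image.1 hφ
      rw [mem_outcomes] at hy
      simp only [C, mem_filter, mem_univ, true_and]
      refine hy.2.trans (le_of_eq ?_)
      have hv : ∀ (a : A) i, proj (out P (S.T (act y ω)) t (idx P (S.T (act y ω)) t (X a)) (fld i))
          = (sh y a i).toNat := by
        intro a i
        obtain ⟨h1, h2, h3⟩ := hκ (F ω) y (hF ω) h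
        rw [hout, hFact]
        have h4 : out P (S.T (act y ω)) t (F ω a) (fld i)
            = out P (S.T ω) t (F ω a) (fld i) ^^^ out P (κ (F ω) y) t (F ω a) (fld i) := by
          rw [← out_xor]
          refine out_congr_table (fun b hb => ?_) (hF ω a) (hfld' i)
          simp only [act, if_pos h]
          exact S.T_flip _ h1 _ _ (hb.trans_le hle)
        rw [h4, h3 a a.2 _ (hfld' i), hYx', hpe _ _ (BitVec.isLt _)]
        simp only [sh, base, BitVec.toNat_xor, BitVec.toNat_ofNat]
        rw [Nat.mod_eq_of_lt (hproj _ (out_lt (S.T_lt ω) _ _ _))]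
      rw [← sum_coe_sort]
      refine sum_congr rfl fun a _ => ?_
      unfold nonunique
      congr 1
      ext i
      simp only [mem_filter, mem_univ, true_and]
      constructor
      · rintro ⟨b, hb, hba, he⟩
        refine ⟨⟨b, hb⟩, fun h => hba (congrArg Subtype.val h), ?_⟩
        have e1 := hv ⟨b, hb⟩ i
        have e2 := hv a i
        dsimp only at e1
        rw [e1, e2] at he
        exact BitVec.eq_of_toNat_eq he
      · rintro ⟨b, hba, he⟩
        refine ⟨b, b.2, fun h => hba (Subtype.ext h), ?_⟩
        rw [hv b i, hv a i, he]
    · refine le_of_eq_of_le ?_ (Nat.zero_le _)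
      rw [card_eq_zero, eq_empty_iff_forall_notMem]
      intro y hy
      obtain ⟨hy, -⟩ := mem_outcomes.1 hy
      have := hOk _ hy
      rw [hFact] at this
      exact h this
  have h1 := card_mul_le_of_act act hact (fun ω => UniqueOn (fun x => idx P (S.T ω) t (X x))
      (2 ^ (P.δ + t)) k ∧ 2 * z ≤ ∑ a ∈ A, nonunique A
          (fun x i => proj (out P (S.T ω) t (idx P (S.T ω) t (X x)) (fld i))) a) C.card hB
  have h2 := card_many_nonunique_le (α := A) (ι := ι) (R := BitVec α) z
  have hcR := card_bitVec α
  have hcY : Fintype.card Y = (2 ^ α) ^ (A.card * Fintype.card ι) := by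
    simp only [Y, Fintype.card_fun, hcR, Fintype.card_coe]
    rw [← pow_mul, ← pow_mul, ← pow_mul]
    congr 1
    ring
  rw [hcR, Fintype.card_coe] at h2
  rw [hcY] at h1
  refine Nat.le_of_mul_le_mul_right (c := (2 ^ α) ^ (A.card * Fintype.card ι)) ?_
    (by positivity)
  set E := count fun ω : Ω => UniqueOn (fun x => idx P (S.T ω) t (X x)) (2 ^ (P.δ + t)) k ∧
        2 * z ≤ ∑ a ∈ A, nonunique A
          (fun x i => proj (out P (S.T ω) t (idx P (S.T ω) t (X x)) (fld i))) a
  calc E * (2 ^ α) ^ z * (2 ^ α) ^ (A.card * Fintype.card ι)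
      = E * (2 ^ α) ^ (A.card * Fintype.card ι) * (2 ^ α) ^ z := by ring
    _ ≤ C.card * Fintype.card Ω * (2 ^ α) ^ z := Nat.mul_le_mul_right _ h1
    _ = C.card * (2 ^ α) ^ z * Fintype.card Ω := by ring
    _ ≤ 2 ^ (A.card * Fintype.card ι) * (A.card ^ z * (2 ^ α) ^ (A.card * Fintype.card ι))
        * Fintype.card Ω := by
        refine Nat.mul_le_mul_right _ (le_of_eq_of_le ?_ h2)
        congr 2
    _ = _ := by ring

end Sampling

end Tabulation

/-! ### From mostly unique halves to a unique pair -/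

namespace Tabulation

open Classical in
/-- In each nonempty set of at most `p` elements, at most half of the elements fail to have more
than half of their coordinates unique. -/
def MostlyUnique {U ι : Type*} [Fintype ι] (ψ : U → ι → ℕ) (p : ℕ) : Prop :=
  ∀ A : Finset U, A.Nonempty → A.card ≤ p →
    2 * (A.filter fun a => Fintype.card ι ≤ 2 * nonunique A ψ a).card ≤ A.card

section Step

open Finset Classical

/-- Pigeonhole: for `a` and for `b` fewer than half of the coordinates are spoilt, so the spoilt
coordinates do not cover `ι`. -/
theorem exists_unique_coordinate {U ι : Type*} [Fintype ι] {A : Finset U}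
    {ψ : U → ι → ℕ} {a : U} {B : Finset U} {χ : U → ι → ℕ} {b : U}
    (ha : ¬ Fintype.card ι ≤ 2 * nonunique A ψ a) (hb : ¬ Fintype.card ι ≤ 2 * nonunique B χ b) :
    ∃ i, (∀ y ∈ A, y ≠ a → ψ y i ≠ ψ a i) ∧ ∀ y ∈ B, y ≠ b → χ y i ≠ χ b i := by
  by_contra! h
  have hu : (univ : Finset ι) ⊆ (univ.filter fun i => ∃ b ∈ A, b ≠ a ∧ ψ b i = ψ a i) ∪
      (univ.filter fun i => ∃ y ∈ B, y ≠ b ∧ χ y i = χ b i) := by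
    intro i _
    rw [mem_union, mem_filter, mem_filter]
    by_cases h1 : ∃ b ∈ A, b ≠ a ∧ ψ b i = ψ a i
    · exact Or.inl ⟨mem_univ _, h1⟩
    · push Not at h1
      exact Or.inr ⟨mem_univ _, h i h1⟩
  have := (card_le_card hu).trans (card_union_le _ _)
  rw [card_univ] at this
  unfold nonunique at ha hb
  omega

/-- If the first characters `ψ j` are mostly unique on sets of size `2 ^ ((j + 1) e)` and the second
characters `χ j` on sets of size `2 ^ (κ + 1 - j e)` (or `2 ^ κ`, if that is less), then some pair of characters is unique. -/
theorem exists_unique_pair {U ι : Type*} [Fintype ι] {e κ : ℕ} (he : 0 < e)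
    (ψ χ : ℕ → U → ι → ℕ)
    (hψ : ∀ j, j * e ≤ κ → MostlyUnique (ψ j) (2 ^ min ((j + 1) * e) κ))
    (hχ : ∀ j, j * e ≤ κ → MostlyUnique (χ j) (2 ^ min (κ + 1 - j * e) κ))
    (A : Finset (U × U)) (hA : A.Nonempty) (hAk : A.card ≤ 2 ^ κ) :
    ∃ x ∈ A, ∃ j, j * e ≤ κ ∧ ∃ i, ∀ y ∈ A, y ≠ x → ψ j y.1 i = ψ j x.1 i →
      χ j y.2 i ≠ χ j x.2 i := by
  set B := A.image Prod.fst with hB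
  have hBne : B.Nonempty := hA.image _
  let fib : U → Finset U := fun a => (A.filter fun x => x.1 = a).image Prod.snd
  have hfib : ∀ a, (fib a).card = (A.filter fun x => x.1 = a).card := by
    intro a
    refine card_image_of_injOn ?_
    rintro ⟨x1, x2⟩ hx ⟨y1, y2⟩ hy h
    simp only [coe_filter, Set.mem_ofPred_eq] at hx hy
    simp only at h
    rw [hx.2, hy.2, h]
  have hsum : ∑ a ∈ B, (fib a).card = A.card := by
    simp only [hfib]
    exact (card_eq_sum_card_image Prod.fst A).symm
  have hp : B.card ≤ 2 ^ κ := card_image_le.trans hAk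
  have hp0 : 0 < B.card := hBne.card_pos
  set j := Nat.log 2 B.card / e with hj
  have hje : j * e ≤ Nat.log 2 B.card := Nat.div_mul_le_self _ _
  have hlog : Nat.log 2 B.card ≤ κ := by
    calc Nat.log 2 B.card ≤ Nat.log 2 (2 ^ κ) := Nat.log_mono_right hp
      _ = κ := Nat.log_pow (by norm_num) _
  have hjκ : j * e ≤ κ := hje.trans hlog
  have hlo : 2 ^ (j * e) ≤ B.card :=
    (Nat.pow_le_pow_right (by omega) hje).trans (Nat.pow_log_le_self 2 hp0.ne')
  have hhi : B.card ≤ 2 ^ ((j + 1) * e) := by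
    refine (Nat.lt_pow_succ_log_self (b := 2) (by norm_num) B.card).le.trans
      (Nat.pow_le_pow_right (by omega) ?_)
    have := Nat.lt_mul_div_succ (Nat.log 2 B.card) he
    rw [← hj, mul_comm] at this
    exact this
  -- By Markov's inequality, fewer than half of the first halves have a fibre of more than twice the
  -- average size `|A| / |B|`. At most half are `bad`, so some first half is neither.
  set big := B.filter fun a => 2 * A.card < (fib a).card * B.card
  set bad := B.filter fun a => Fintype.card ι ≤ 2 * nonunique B (ψ j) a
  have hbad : 2 * bad.card ≤ B.card := hψ j hjκ B hBne (by
    rcases min_choice ((j + 1) * e) κ with h | h <;> rw [h]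
    exacts [hhi, hp])
  have hbig : 2 * big.card < B.card := by
    by_contra! h
    have hbne : big.Nonempty := by
      rw [← card_pos]; omega
    have h1 : ∑ _a ∈ big, 2 * A.card < ∑ a ∈ big, (fib a).card * B.card :=
      sum_lt_sum_of_nonempty hbne fun a ha => (mem_filter.1 ha).2
    have h2 : ∑ a ∈ big, (fib a).card * B.card ≤ A.card * B.card := by
      rw [← sum_mul, ← hsum]
      exact Nat.mul_le_mul_right _ (sum_le_sum_of_subset (filter_subset _ _))
    rw [sum_const, smul_eq_mul] at h1
    have h3 : big.card * (2 * A.card) < A.card * B.card := h1.trans_le h2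
    have h4 : 0 < A.card := hA.card_pos
    nlinarith
  obtain ⟨a, haB, ha⟩ : ∃ a ∈ B, a ∉ big ∪ bad := by
    by_contra! h
    have := (card_le_card (show B ⊆ big ∪ bad from h)).trans (card_union_le _ _)
    omega
  rw [mem_union, not_or] at ha
  have ha1 : (fib a).card * B.card ≤ 2 * A.card := by
    by_contra h
    exact ha.1 (mem_filter.2 ⟨haB, not_le.1 h⟩)
  have ha2 : ¬ Fintype.card ι ≤ 2 * nonunique B (ψ j) a := fun h => ha.2 (mem_filter.2 ⟨haB, h⟩)
  have hfne : (fib a).Nonempty := by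
    obtain ⟨x, hx, hxa⟩ := mem_image.1 haB
    exact ⟨x.2, mem_image.2 ⟨x, mem_filter.2 ⟨hx, hxa⟩, rfl⟩⟩
  have hfc : (fib a).card ≤ 2 ^ (κ + 1 - j * e) := by
    refine Nat.le_of_mul_le_mul_right (c := 2 ^ (j * e)) ?_ (by positivity)
    rw [← pow_add, Nat.sub_add_cancel (by omega), pow_succ]
    calc (fib a).card * 2 ^ (j * e) ≤ (fib a).card * B.card := Nat.mul_le_mul_left _ hlo
      _ ≤ 2 * A.card := ha1
      _ ≤ 2 ^ κ * 2 := by omega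
  obtain ⟨b, hb, hb2⟩ : ∃ b ∈ fib a, ¬ Fintype.card ι ≤ 2 * nonunique (fib a) (χ j) b := by
    by_contra! h
    have h1 := hχ j hjκ (fib a) hfne (by
      rcases min_choice (κ + 1 - j * e) κ with h | h <;> rw [h]
      exacts [hfc, (hfib a).le.trans ((card_filter_le _ _).trans hAk)])
    rw [filter_true_of_mem h] at h1
    have := hfne.card_pos
    omega
  obtain ⟨x, hx, hxb⟩ := mem_image.1 hb
  rw [mem_filter] at hx
  obtain ⟨i, hi1, hi2⟩ := exists_unique_coordinate ha2 hb2
  refine ⟨x, hx.1, j, hjκ, i, fun y hy hyx hψy hχy => ?_⟩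
  rw [hx.2] at hψy
  rw [hxb] at hχy
  have hy1 : y.1 = a := by
    by_contra h
    exact hi1 y.1 (mem_image_of_mem _ hy) h hψy
  have hy2 : y.2 = b := by
    by_contra h
    exact hi2 y.2 (mem_image.2 ⟨y, mem_filter.2 ⟨hy, hy1⟩, rfl⟩) h hχy
  exact hyx (Prod.ext (hy1.trans hx.2.symm) (hy2.trans hxb.symm))

end Step

/-! ### Union bound over all sets of strings -/

section Union

open Finset Classical

/-- Union bound over the nonempty sets `A`. -/
theorem card_union_bound {Ω U : Type*} [Fintype Ω] [Fintype U] (E : Ω → Prop)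
    (Ev : Finset U → Ω → Prop) (hE : ∀ ω, E ω → ∃ A : Finset U, A.Nonempty ∧ Ev A ω)
    {a b : ℕ} (hU : Fintype.card U = 2 ^ a) (hab : a ≤ b)
    (hEv : ∀ A : Finset U, A.Nonempty →
      count (Ev A) * (2 ^ b) ^ A.card ≤ Fintype.card Ω) :
    (count E : ℝ) ≤ Fintype.card Ω * (2 * (2 ^ a / 2 ^ b)) := by
  unfold count at hEv ⊢
  have h1 : (outcomes E).card ≤
      ∑ A ∈ (univ : Finset (Finset U)).filter Finset.Nonempty, (outcomes (Ev A)).card := by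
    refine (card_le_card (t := ((univ : Finset (Finset U)).filter Finset.Nonempty).biUnion
      fun A => outcomes (Ev A)) ?_).trans card_biUnion_le
    intro ω hω
    obtain ⟨A, hA, h⟩ := hE ω (mem_outcomes.1 hω)
    exact mem_biUnion.2 ⟨A, mem_filter.2 ⟨mem_univ _, hA⟩, mem_outcomes.2 h⟩
  set r : ℝ := 1 / 2 ^ b with hr
  have hr0 : 0 ≤ r := by positivity
  have h2 : ∀ A : Finset U, A.Nonempty →
      ((outcomes (Ev A)).card : ℝ) ≤ Fintype.card Ω * r ^ A.card := by
    intro A hA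
    have := hEv A hA
    rw [hr, one_div, inv_pow, ← div_eq_mul_inv, le_div_iff₀ (by positivity)]
    exact_mod_cast this
  -- Binomial theorem. Removing the empty set leaves `(1 + r) ^ (2 ^ a) - 1 ≤ exp x - 1 ≤ 2 x` with
  -- `x = 2 ^ a r ≤ 1`.
  have h3 : ∑ A : Finset U, r ^ A.card = (1 + r) ^ (2 ^ a) := by
    have := Finset.sum_pow_mul_eq_add_pow r 1 (univ : Finset U)
    simp only [one_pow, mul_one, powerset_univ, card_univ, hU] at this
    rw [this, add_comm]
  have h4 : ∑ A ∈ (univ : Finset (Finset U)).filter Finset.Nonempty, r ^ A.card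
      = (1 + r) ^ (2 ^ a) - 1 := by
    rw [← h3, ← sum_filter_add_sum_filter_not univ (Finset.Nonempty) fun A : Finset U => r ^ A.card]
    have : (univ.filter fun A : Finset U => ¬ A.Nonempty) = {∅} := by
      ext A; simp
    rw [this]
    simp
  have h5 : (1 + r) ^ (2 ^ a) - 1 ≤ 2 * (2 ^ a / 2 ^ b) := by
    have hx : (2 : ℝ) ^ a * r = 2 ^ a / 2 ^ b := by rw [hr]; ring
    have hx1 : (2 : ℝ) ^ a * r ≤ 1 := by
      rw [hx, div_le_one (by positivity)]
      exact pow_le_pow_right₀ (by norm_num) hab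
    have h6 : (1 + r) ^ (2 ^ a) ≤ Real.exp (2 ^ a * r) := by
      have h7 : (1 + r) ^ (2 ^ a) ≤ Real.exp r ^ (2 ^ a) :=
        pow_le_pow_left₀ (by positivity) (by rw [add_comm]; exact Real.add_one_le_exp r) _
      rw [← Real.exp_nat_mul] at h7
      exact_mod_cast h7
    have h8 := Real.abs_exp_sub_one_le (x := 2 ^ a * r) (by
      rw [abs_of_nonneg (by positivity)]; exact hx1)
    rw [abs_of_nonneg (a := 2 ^ a * r) (by positivity)] at h8
    have h9 := (abs_le.1 h8).2
    rw [← hx]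
    linarith
  calc ((outcomes E).card : ℝ)
      ≤ ∑ A ∈ (univ : Finset (Finset U)).filter Finset.Nonempty, ((outcomes (Ev A)).card : ℝ) := by
        exact_mod_cast h1
    _ ≤ ∑ A ∈ (univ : Finset (Finset U)).filter Finset.Nonempty, Fintype.card Ω * r ^ A.card :=
        sum_le_sum fun A hA => h2 A (mem_filter.1 hA).2
    _ = Fintype.card Ω * ((1 + r) ^ (2 ^ a) - 1) := by rw [← mul_sum, h4]
    _ ≤ _ := mul_le_mul_of_nonneg_left h5 (by positivity)

/-- The probability that `α` bits of each of some fields of the outputs of level `t` are not mostly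
unique on sets of size `2 ^ s`. -/
theorem card_not_mostlyUnique_le {P : Params} {l : ℕ} {Ω : Type*} [Fintype Ω]
    (S : TableSpace P l Ω) {t : ℕ} (ht : t ≤ l) {U : Type*} [Fintype U] {κ : ℕ} (X : U → ℕ → ℕ)
    (hX : ∀ x i, X x i < 2 ^ P.M) {d : ℕ} (fld : Fin (8 * d) → ℕ)
    (hfld : Function.Injective fld)
    (hfld' : ∀ i, fld i < 2 ^ (P.δ + t + 1)) (α : ℕ) (proj emb : ℕ → ℕ)
    (hproj : ∀ v, v < 2 ^ P.M → proj v < 2 ^ α) (hemb : ∀ y, y < 2 ^ α → emb y < 2 ^ P.M)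
    (hpe : ∀ v y, y < 2 ^ α → proj (v ^^^ emb y) = proj v ^^^ y) {s a b g : ℕ} (hs : s ≤ κ)
    (hα : s + 8 + g ≤ α) (hU : Fintype.card U = 2 ^ a) (hab : a ≤ b) (hb : b ≤ g * d) :
    (count (fun ω : Ω => UniqueOn (fun x => idx P (S.T ω) t (X x)) (2 ^ (P.δ + t)) (2 ^ κ) ∧
        ¬ MostlyUnique (fun x i => proj (out P (S.T ω) t (idx P (S.T ω) t (X x)) (fld i)))
          (2 ^ s)) : ℝ) ≤ Fintype.card Ω * (2 * (2 ^ a / 2 ^ b)) := by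
  refine card_union_bound (fun ω : Ω => UniqueOn (fun x => idx P (S.T ω) t (X x))
      (2 ^ (P.δ + t)) (2 ^ κ) ∧
        ¬ MostlyUnique (fun x i => proj (out P (S.T ω) t (idx P (S.T ω) t (X x)) (fld i)))
          (2 ^ s)) (fun A ω => A.card ≤ 2 ^ s ∧
    UniqueOn (fun x => idx P (S.T ω) t (X x)) (2 ^ (P.δ + t)) (2 ^ κ) ∧
        2 * (d * A.card) ≤ ∑ a ∈ A, nonunique A
          (fun x i => proj (out P (S.T ω) t (idx P (S.T ω) t (X x)) (fld i))) a) ?_ hU hab ?_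
  · rintro ω ⟨h1, h2⟩
    unfold MostlyUnique at h2
    push Not at h2
    obtain ⟨A, hA, hAc, h3⟩ := h2
    refine ⟨A, hA, hAc, h1, ?_⟩
    rw [Fintype.card_fin] at h3
    set ψ := fun x i => proj (out P (S.T ω) t (idx P (S.T ω) t (X x)) (fld i))
    set bad := A.filter fun a => 8 * d ≤ 2 * nonunique A ψ a
    -- More than half of the elements have at least `4 d` nonunique fields each, hence `2 d |A|` in
    -- total; this is the event for `z = d |A|`.
    have h4 : ∑ _a ∈ bad, 8 * d ≤ ∑ a ∈ bad, 2 * nonunique A ψ a :=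
      sum_le_sum fun a ha => (mem_filter.1 ha).2
    have h5 : ∑ a ∈ bad, 2 * nonunique A ψ a ≤ ∑ a ∈ A, 2 * nonunique A ψ a :=
      sum_le_sum_of_subset (filter_subset _ _)
    rw [sum_const, smul_eq_mul] at h4
    simp only [← mul_sum] at h4 h5
    have h6 : d * A.card ≤ d * (2 * bad.card) := Nat.mul_le_mul_left _ h3.le
    nlinarith
  · intro A hA
    by_cases hAs : A.card ≤ 2 ^ s
    swap
    · simp [hAs, count, outcomes]
    simp only [hAs, true_and]
    have h := card_many_collisions_le S ht (k := 2 ^ κ) X hX A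
      (hAs.trans (Nat.pow_le_pow_right (by omega) hs)) fld hfld hfld' α proj emb hproj hemb hpe
      (d * A.card)
    rw [Fintype.card_fin] at h
    refine Nat.le_of_mul_le_mul_left (c := 2 ^ ((s + 8) * (d * A.card))) ?_ (by positivity)
    set E := count fun ω : Ω => UniqueOn (fun x => idx P (S.T ω) t (X x)) (2 ^ (P.δ + t))
      (2 ^ κ) ∧ 2 * (d * A.card) ≤ ∑ a ∈ A, nonunique A
          (fun x i => proj (out P (S.T ω) t (idx P (S.T ω) t (X x)) (fld i))) a
    -- Bit budget per collision: `s` bits pay for the choice of the earlier element, `8` for the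
    -- choice of the colliding positions among `8 d |A|`, and the remaining `g` give the factor `2 ^
    -- (- b |A|)` needed in the union bound.
    have h1 : 2 ^ ((s + 8) * (d * A.card)) * (2 ^ b) ^ A.card ≤ (2 ^ α) ^ (d * A.card) := by
      rw [← pow_mul, ← pow_mul, ← pow_add]
      refine Nat.pow_le_pow_right (by omega) ?_
      calc (s + 8) * (d * A.card) + b * A.card
          ≤ (s + 8) * (d * A.card) + g * d * A.card :=
            Nat.add_le_add_left (Nat.mul_le_mul_right _ hb) _
        _ = (s + 8 + g) * (d * A.card) := by ring
        _ ≤ α * (d * A.card) := Nat.mul_le_mul_right _ hα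
    calc 2 ^ ((s + 8) * (d * A.card)) * (E * (2 ^ b) ^ A.card)
        = E * (2 ^ ((s + 8) * (d * A.card)) * (2 ^ b) ^ A.card) := by ring
      _ ≤ E * (2 ^ α) ^ (d * A.card) := Nat.mul_le_mul_left _ h1
      _ ≤ 2 ^ (A.card * (8 * d)) * A.card ^ (d * A.card) * Fintype.card Ω := h
      _ ≤ 2 ^ (A.card * (8 * d)) * (2 ^ s) ^ (d * A.card) * Fintype.card Ω :=
        Nat.mul_le_mul_right _ (Nat.mul_le_mul_left _ (Nat.pow_le_pow_left hAs _))
      _ = 2 ^ ((s + 8) * (d * A.card)) * Fintype.card Ω := by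
        rw [← pow_mul, ← pow_add]
        congr 2
        ring

end Union

end Tabulation

/-! ### Induction over the levels and the failure probability -/

namespace Tabulation

open Finset Classical

/-- The characters of a string, as numbers. -/
def str {n c : ℕ} (x : Fin c → BitVec n) (i : ℕ) : ℕ := if h : i < c then (x ⟨i, h⟩).toNat else 0

theorem str_lt {n c M : ℕ} (h : n ≤ M) (x : Fin c → BitVec n) (i : ℕ) : str x i < 2 ^ M := by
  unfold str
  split_ifs
  · exact (BitVec.isLt _).trans_le (Nat.pow_le_pow_right (by omega) h)
  · exact Nat.two_pow_pos _

/-- The conditions on the parameters for strings of characters of `n` bits and sets of size at most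
`2 ^ κ`. -/
structure Params.Fits (P : Params) (n κ : ℕ) : Prop where
  n_pos : 0 < n
  M_eq : P.M = n + κ + 20
  e_eq : P.e = n / 4 + 1
  δ_eq : P.δ = 2 * P.γ + 6
  γ_pos : 0 < P.γ
  div_lt : κ / P.e < 2 ^ P.γ

variable {P : Params} {n κ : ℕ}

/-- The lowest bits of the fields `j, 2 ^ γ + j, …` of the output of level `t`. -/
def lowPart (P : Params) (n : ℕ) (T : ℕ → ℕ) (t j : ℕ) (x : Fin (2 ^ t) → BitVec n)
    (i : Fin (8 * 2 ^ (P.γ + 4 + t))) : ℕ :=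
  out P T t (idx P T t (str x)) (i * 2 ^ P.γ + j) % 2 ^ ((j + 2) * P.e + 8)

/-- The highest bits of the fields `j, 2 ^ γ + j, …` of the output of level `t`. -/
def highPart (P : Params) (n : ℕ) (T : ℕ → ℕ) (t j : ℕ) (x : Fin (2 ^ t) → BitVec n)
    (i : Fin (8 * 2 ^ (P.γ + 4 + t))) : ℕ :=
  out P T t (idx P T t (str x)) (i * 2 ^ P.γ + j) / 2 ^ ((j + 2) * P.e + 8)

theorem Params.Fits.lt_of_mul_le (h : P.Fits n κ) {j : ℕ} (hj : j * P.e ≤ κ) : j < 2 ^ P.γ :=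
  ((Nat.le_div_iff_mul_le (by rw [h.e_eq]; omega)).2 hj).trans_lt h.div_lt

theorem field_lt (h : P.Fits n κ) {t j i : ℕ} (hj : j < 2 ^ P.γ) (hi : i < 8 * 2 ^ (P.γ + 4 + t)) :
    i * 2 ^ P.γ + j < 2 ^ (P.δ + t + 1) := by
  rw [h.δ_eq, show 2 * P.γ + 6 + t + 1 = 3 + (P.γ + 4 + t) + P.γ by ring, pow_add, pow_add 2 3]
  have : (i + 1) * 2 ^ P.γ ≤ (8 * 2 ^ (P.γ + 4 + t)) * 2 ^ P.γ := Nat.mul_le_mul_right _ hi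
  norm_num
  nlinarith

/-- At level `0` a string is a single character, and table `0` is accessed by this very character.
-/
theorem uniqueOn_zero (T : ℕ → ℕ) (k : ℕ) :
    UniqueOn (fun x : Fin (2 ^ 0) → BitVec n => idx P T 0 (str x)) (2 ^ (P.δ + 0)) k := by
  intro A hA _
  obtain ⟨x, hx⟩ := hA
  refine ⟨x, hx, 0, Nat.two_pow_pos _, fun y _ hyx he => hyx ?_⟩
  funext i
  have hi : i = ⟨0, by norm_num⟩ := Fin.ext (by have := i.2; simp at this ⊢)
  simp only [idx, str, pow_zero, Nat.lt_one_iff, dite_true] at he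
  rw [hi]
  exact BitVec.eq_of_toNat_eq he

/-- A string is identified with the pair of its halves. In the fields congruent to `j` modulo `2 ^
γ`, the character of the next level consists of exactly the `lowPart` of the first half and the
`highPart` of the second, so a unique pair from `exists_unique_pair` is a unique table entry. -/
theorem uniqueOn_succ (h : P.Fits n κ) (T : ℕ → ℕ) (t : ℕ)
    (hlow : ∀ j, j * P.e ≤ κ → MostlyUnique (lowPart P n T t j) (2 ^ min ((j + 1) * P.e) κ))
    (hhigh : ∀ j, j * P.e ≤ κ → MostlyUnique (highPart P n T t j) (2 ^ min (κ + 1 - j * P.e) κ)) :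
    UniqueOn (fun x : Fin (2 ^ (t + 1)) → BitVec n => idx P T (t + 1) (str x))
      (2 ^ (P.δ + (t + 1))) (2 ^ κ) := by
  have hpow : 2 ^ (t + 1) = 2 ^ t + 2 ^ t := by ring
  intro A hA hAk
  let lo : (Fin (2 ^ (t + 1)) → BitVec n) → Fin (2 ^ t) → BitVec n :=
    fun x i => x ⟨i, by omega⟩
  let hi : (Fin (2 ^ (t + 1)) → BitVec n) → Fin (2 ^ t) → BitVec n :=
    fun x i => x ⟨2 ^ t + i, by omega⟩
  have hlo : ∀ x f, idx P T t (str x) f = idx P T t (str (lo x)) f := by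
    intro x f
    refine idx_congr_string T (fun i hi => ?_) f
    simp only [str, lo, dif_pos hi, dif_pos (show i < 2 ^ (t + 1) by omega)]
  have hhi : ∀ x f, idx P T t (fun i => str x (2 ^ t + i)) f = idx P T t (str (hi x)) f := by
    intro x f
    refine idx_congr_string T (fun i hi' => ?_) f
    simp only [str, hi, dif_pos hi', dif_pos (show 2 ^ t + i < 2 ^ (t + 1) by omega)]
  let sp : (Fin (2 ^ (t + 1)) → BitVec n) → (Fin (2 ^ t) → BitVec n) × (Fin (2 ^ t) → BitVec n) :=
    fun x => (lo x, hi x)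
  have hsp : Function.Injective sp := by
    intro x y hxy
    funext i
    by_cases hi' : i.val < 2 ^ t
    · exact congrFun (congrArg Prod.fst hxy) ⟨i, hi'⟩
    · have := congrFun (congrArg Prod.snd hxy) ⟨i - 2 ^ t, by have := i.2; omega⟩
      simp only [sp, hi] at this
      have e : (⟨2 ^ t + (i.val - 2 ^ t), by have := i.2; omega⟩ : Fin (2 ^ (t + 1))) = i :=
        Fin.ext (by simp; omega)
      rwa [e] at this
  obtain ⟨p, hp, j, hj, i, hu⟩ := exists_unique_pair (show 0 < P.e by rw [h.e_eq]; omega) _ _ hlow hhigh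
    (A.image sp) (hA.image _) (card_image_le.trans hAk)
  obtain ⟨x, hx, rfl⟩ := mem_image.1 hp
  have hjJ := h.lt_of_mul_le hj
  have hcut : P.cut (i * 2 ^ P.γ + j) = (j + 2) * P.e + 8 := by
    unfold Params.cut
    rw [mul_comm i.val, Nat.mul_add_mod, Nat.mod_eq_of_lt hjJ]
  refine ⟨x, hx, i * 2 ^ P.γ + j, field_lt h hjJ i.2, fun y hy hyx he => ?_⟩
  simp only [idx, hcut] at he
  rw [funext (hlo x), funext (hlo y), funext (hhi x), funext (hhi y)] at he
  refine hu (sp y) (mem_image_of_mem _ hy) (fun h => hyx (hsp h)) ?_ ?_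
  · have := congrArg (· % 2 ^ ((j + 2) * P.e + 8)) he
    simp only [comb_mod] at this
    exact this
  · have := congrArg (· / 2 ^ ((j + 2) * P.e + 8)) he
    simp only [comb_div] at this
    exact this

/-- The `i`-th character of the value of the function represented by the tables. -/
def value (P : Params) (n κ l : ℕ) (T : ℕ → ℕ) (x : Fin (2 ^ l) → BitVec n) (i : Fin (2 ^ (l + 3))) :
    ℕ :=
  out P T l (idx P T l (str x)) i % 2 ^ (n + κ + 4)

section

variable {l : ℕ} {Ω : Type*} [Fintype Ω]

theorem card_strings (n t : ℕ) : Fintype.card (Fin (2 ^ t) → BitVec n) = 2 ^ (n * 2 ^ t) := by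
  rw [Fintype.card_fun, Fintype.card_fin, Fintype.card_congr (β := Fin (2 ^ n))
    ⟨BitVec.toFin, BitVec.ofFin, fun _ => rfl, fun _ => rfl⟩, Fintype.card_fin, pow_mul]

/-- Each of the `2 ^ (γ + 4 + t)` collisions per string gains `e ≥ n / 4` bits. This exceeds the `n
2 ^ t` bits of a string by the factor `4 * 2 ^ γ`, enough for the union over strings, divisions and
levels. -/
theorem le_level_gain (h : P.Fits n κ) (t : ℕ) :
    4 * 2 ^ P.γ * (n * 2 ^ t) ≤ P.e * 2 ^ (P.γ + 4 + t) := by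
  have : n ≤ 4 * P.e := by rw [h.e_eq]; omega
  rw [pow_add, pow_add]
  calc 4 * 2 ^ P.γ * (n * 2 ^ t) ≤ 4 * 2 ^ P.γ * ((4 * P.e) * 2 ^ t) := by gcongr
    _ = _ := by ring

/-- The `(j + 2) e + 8` low bits are the budget for sets of size `2 ^ ((j + 1) e)`: `8` bits for the
positions and `e` bits of gain. -/
theorem card_not_low_le (h : P.Fits n κ) (S : TableSpace P l Ω) {t : ℕ} (ht : t ≤ l) {j : ℕ}
    (hj : j * P.e ≤ κ) :
    (count (fun ω : Ω =>
        UniqueOn (fun x : Fin (2 ^ t) → BitVec n => idx P (S.T ω) t (str x)) (2 ^ (P.δ + t)) (2 ^ κ) ∧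
        ¬ MostlyUnique (lowPart P n (S.T ω) t j) (2 ^ min ((j + 1) * P.e) κ)) : ℝ)
      ≤ Fintype.card Ω * (2 * (2 ^ (n * 2 ^ t) / 2 ^ (4 * 2 ^ P.γ * (n * 2 ^ t)))) := by
  have hM := h.M_eq
  have he := h.e_eq
  have hle : (j + 2) * P.e + 8 ≤ P.M := by
    have : (j + 2) * P.e = j * P.e + 2 * P.e := by ring
    omega
  have h1 := card_not_mostlyUnique_le S ht (κ := κ) (fun x : Fin (2 ^ t) → BitVec n => str x)
    (fun x i => str_lt (by omega) x i) (fun i : Fin (8 * 2 ^ (P.γ + 4 + t)) => i * 2 ^ P.γ + j)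
    (fun i i' hi => Fin.ext (Nat.eq_of_mul_eq_mul_right (Nat.two_pow_pos P.γ) (by simpa using hi)))
    (fun i => field_lt h (h.lt_of_mul_le hj) i.2)
    ((j + 2) * P.e + 8) (fun v => v % 2 ^ ((j + 2) * P.e + 8)) (fun y => y)
    (fun v _ => Nat.mod_lt _ (Nat.two_pow_pos _))
    (fun y hy => hy.trans_le (Nat.pow_le_pow_right (by omega) hle))
    (fun v y hy => by rw [Nat.xor_mod_two_pow, Nat.mod_eq_of_lt hy])
    (s := min ((j + 1) * P.e) κ) (g := P.e) (min_le_right _ _)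
    (by have : (j + 2) * P.e = (j + 1) * P.e + P.e := by ring
        have := min_le_left ((j + 1) * P.e) κ
        omega) (card_strings n t)
    (Nat.le_mul_of_pos_left _ (by positivity)) (le_level_gain h t)
  exact h1

/-- Sets of size `2 ^ (κ + 1 - j e)` need `κ + 1 - j e + 8 + e` bits. After the `(j + 2) e + 8` low
bits that many remain, because `3 e ≤ n + 3`; this fixes `M = n + κ + 20` and `e = n / 4 + 1`. -/
theorem card_not_high_le (h : P.Fits n κ) (S : TableSpace P l Ω) {t : ℕ} (ht : t ≤ l) {j : ℕ}
    (hj : j * P.e ≤ κ) :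
    (count (fun ω : Ω =>
        UniqueOn (fun x : Fin (2 ^ t) → BitVec n => idx P (S.T ω) t (str x)) (2 ^ (P.δ + t)) (2 ^ κ) ∧
        ¬ MostlyUnique (highPart P n (S.T ω) t j) (2 ^ min (κ + 1 - j * P.e) κ)) : ℝ)
      ≤ Fintype.card Ω * (2 * (2 ^ (n * 2 ^ t) / 2 ^ (4 * 2 ^ P.γ * (n * 2 ^ t)))) := by
  have hM := h.M_eq
  have he := h.e_eq
  obtain ⟨a, ha⟩ : ∃ a, a = (j + 2) * P.e + 8 := ⟨_, rfl⟩
  unfold highPart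
  rw [← ha]
  have ha' : a = j * P.e + 2 * P.e + 8 := by rw [ha]; ring
  have hle : a ≤ P.M := by omega
  have h1 := card_not_mostlyUnique_le S ht (κ := κ) (fun x : Fin (2 ^ t) → BitVec n => str x)
    (fun x i => str_lt (by omega) x i) (fun i : Fin (8 * 2 ^ (P.γ + 4 + t)) => i * 2 ^ P.γ + j)
    (fun i i' hi => Fin.ext (Nat.eq_of_mul_eq_mul_right (Nat.two_pow_pos P.γ) (by simpa using hi)))
    (fun i => field_lt h (h.lt_of_mul_le hj) i.2)
    (P.M - a) (fun v => v / 2 ^ a) (fun y => y <<< a)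
    (fun v hv => by
      rw [Nat.div_lt_iff_lt_mul (Nat.two_pow_pos _), ← pow_add, Nat.sub_add_cancel hle]
      exact hv)
    (fun y hy => by
      have e : 2 ^ P.M = 2 ^ (P.M - a) * 2 ^ a := by rw [← pow_add, Nat.sub_add_cancel hle]
      rw [Nat.shiftLeft_eq, e]
      exact Nat.mul_lt_mul_of_pos_right hy (Nat.two_pow_pos _))
    (fun v y hy => by
      rw [← Nat.shiftRight_eq_div_pow, ← Nat.shiftRight_eq_div_pow, Nat.shiftRight_xor_distrib,
        Nat.shiftLeft_shiftRight])
    (s := min (κ + 1 - j * P.e) κ) (g := P.e) (min_le_right _ _)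
    (by have := min_le_left (κ + 1 - j * P.e) κ
        omega) (card_strings n t)
    (Nat.le_mul_of_pos_left _ (by positivity)) (le_level_gain h t)
  exact h1

/-- The function represented by the tables has the majority-unique property. -/
def HasMajority (P : Params) (n κ l : ℕ) (T : ℕ → ℕ) : Prop :=
  ∀ A : Finset (Fin (2 ^ l) → BitVec n), A.Nonempty → A.card ≤ 2 ^ κ →
    ∃ a ∈ A, 2 * nonunique A (value P n κ l T) a < 2 ^ (l + 3)

/-- If no element of `A` has a majority of unique fields, then at least `2 z` fields are not unique,
where `z = 2 ^ (l + 1) |A|`. The positions cost `2 ^ (4 z)` and the earlier elements `2 ^ (κ z)`, so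
of the `n + κ + 4` bits per collision `n` remain, twice the `n 2 ^ l` bits needed per string. -/
theorem card_not_majority_le (h : P.Fits n κ) (S : TableSpace P l Ω) :
    (count (fun ω : Ω =>
        UniqueOn (fun x : Fin (2 ^ l) → BitVec n => idx P (S.T ω) l (str x)) (2 ^ (P.δ + l)) (2 ^ κ) ∧
        ¬ HasMajority P n κ l (S.T ω)) : ℝ)
      ≤ Fintype.card Ω * (2 * (2 ^ (n * 2 ^ l) / 2 ^ (2 * (n * 2 ^ l)))) := by
  have hM := h.M_eq
  refine card_union_bound (fun ω : Ω =>
        UniqueOn (fun x : Fin (2 ^ l) → BitVec n => idx P (S.T ω) l (str x)) (2 ^ (P.δ + l)) (2 ^ κ) ∧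
        ¬ HasMajority P n κ l (S.T ω)) (fun A ω => A.card ≤ 2 ^ κ ∧
    UniqueOn (fun x : Fin (2 ^ l) → BitVec n => idx P (S.T ω) l (str x)) (2 ^ (P.δ + l)) (2 ^ κ) ∧
        2 * (2 ^ (l + 1) * A.card) ≤ ∑ a ∈ A, nonunique A (value P n κ l (S.T ω)) a) ?_
        (card_strings n l) (show n * 2 ^ l ≤ 2 * (n * 2 ^ l) by omega) ?_
  · rintro ω ⟨h1, h2⟩
    unfold HasMajority at h2
    push Not at h2
    obtain ⟨A, hA, hAc, h3⟩ := h2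
    refine ⟨A, hA, hAc, h1, ?_⟩
    have h4 : ∑ _a ∈ A, 2 ^ (l + 3) ≤ ∑ a ∈ A, 2 * nonunique A (value P n κ l (S.T ω)) a :=
      sum_le_sum h3
    simp only [← mul_sum, sum_const, smul_eq_mul] at h4
    have : 2 ^ (l + 3) = 4 * 2 ^ (l + 1) := by ring
    nlinarith
  · intro A hA
    by_cases hAs : A.card ≤ 2 ^ κ
    swap
    · simp [hAs, count, outcomes]
    simp only [hAs, true_and]
    have h := card_many_collisions_le S le_rfl (k := 2 ^ κ)
      (fun x : Fin (2 ^ l) → BitVec n => str x) (fun x i => str_lt (by omega) x i) A hAs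
      (fun i : Fin (2 ^ (l + 3)) => i.val) Fin.val_injective
      (fun i => i.2.trans_le (Nat.pow_le_pow_right (by omega) (by rw [h.δ_eq]; omega)))
      (n + κ + 4) (fun v => v % 2 ^ (n + κ + 4)) (fun y => y)
      (fun v _ => Nat.mod_lt _ (Nat.two_pow_pos _))
      (fun y hy => hy.trans_le (Nat.pow_le_pow_right (by omega) (by omega)))
      (fun v y hy => by rw [Nat.xor_mod_two_pow, Nat.mod_eq_of_lt hy])
      (2 ^ (l + 1) * A.card)
    rw [Fintype.card_fin] at h
    set z := 2 ^ (l + 1) * A.card with hz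
    refine Nat.le_of_mul_le_mul_left (c := 2 ^ ((κ + 4) * z)) ?_ (by positivity)
    set E := count fun ω : Ω =>
      UniqueOn (fun x : Fin (2 ^ l) → BitVec n => idx P (S.T ω) l (str x)) (2 ^ (P.δ + l)) (2 ^ κ) ∧
        2 * z ≤ ∑ a ∈ A, nonunique A (value P n κ l (S.T ω)) a
    calc 2 ^ ((κ + 4) * z) * (E * (2 ^ (2 * (n * 2 ^ l))) ^ A.card)
        = E * (2 ^ (n + κ + 4)) ^ z := by
          rw [mul_left_comm, ← pow_mul, ← pow_mul, ← pow_add]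
          congr 2
          rw [hz]
          ring
      _ ≤ 2 ^ (A.card * 2 ^ (l + 3)) * A.card ^ z * Fintype.card Ω := h
      _ ≤ 2 ^ (A.card * 2 ^ (l + 3)) * (2 ^ κ) ^ z * Fintype.card Ω :=
        Nat.mul_le_mul_right _ (Nat.mul_le_mul_left _ (Nat.pow_le_pow_left hAs _))
      _ = 2 ^ ((κ + 4) * z) * Fintype.card Ω := by
        rw [← pow_mul, ← pow_add]
        congr 2
        rw [hz]
        ring

/-- The factors are the number of divisions, the two parts (low and high), and the union bound for
one part. -/
theorem level_term_le (h : P.Fits n κ) (t : ℕ) :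
    (2 ^ P.γ : ℝ) * (2 * (2 * (2 ^ (n * 2 ^ t) / 2 ^ (4 * 2 ^ P.γ * (n * 2 ^ t)))))
      ≤ 1 / 2 ^ (n + t + 1) := by
  have e : (2 ^ P.γ : ℝ) * (2 * (2 * (2 ^ (n * 2 ^ t) / 2 ^ (4 * 2 ^ P.γ * (n * 2 ^ t)))))
      = 2 ^ (P.γ + 2 + n * 2 ^ t) / 2 ^ (4 * 2 ^ P.γ * (n * 2 ^ t)) := by
    rw [pow_add, pow_add]; ring
  rw [e, div_le_div_iff₀ (by positivity) (by positivity), ← pow_add, one_mul]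
  refine pow_le_pow_right₀ (by norm_num) ?_
  have h1 : t + 1 ≤ 2 ^ t := Nat.lt_two_pow_self
  have h2 : P.γ + 1 ≤ 2 ^ P.γ := Nat.lt_two_pow_self
  have hn := h.n_pos
  have hγ := h.γ_pos
  set X := n * 2 ^ t with hX
  have h3 : n ≤ X := Nat.le_mul_of_pos_right _ (Nat.two_pow_pos _)
  have h4 : t + 1 ≤ X := h1.trans (Nat.le_mul_of_pos_left _ hn)
  have h5 : 4 * (P.γ + 1) * X ≤ 4 * 2 ^ P.γ * X := by gcongr
  have h6 : P.γ ≤ P.γ * X := Nat.le_mul_of_pos_right _ (by omega)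
  nlinarith

/-- The tables fail to represent a majority-unique function with probability at most
`2 ^ (- n + 1)`. -/
theorem card_not_hasMajority_le (h : P.Fits n κ) (hl : 0 < l) (S : TableSpace P l Ω) :
    (count (fun ω : Ω => ¬ HasMajority P n κ l (S.T ω)) : ℝ)
      ≤ Fintype.card Ω * (2 / 2 ^ n) := by
  let Un : ℕ → Ω → Prop := fun t ω =>
    UniqueOn (fun x : Fin (2 ^ t) → BitVec n => idx P (S.T ω) t (str x)) (2 ^ (P.δ + t)) (2 ^ κ)
  let js := range (κ / P.e + 1)
  have he : 0 < P.e := by rw [h.e_eq]; omega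
  have hjs : ∀ j, j ∈ js ↔ j * P.e ≤ κ := by
    intro j
    rw [← Nat.le_div_iff_mul_le he]
    simp [js]
  let L : ℕ → ℕ → Finset Ω := fun t j => outcomes fun ω => Un t ω ∧
    ¬ MostlyUnique (lowPart P n (S.T ω) t j) (2 ^ min ((j + 1) * P.e) κ)
  let H : ℕ → ℕ → Finset Ω := fun t j => outcomes fun ω => Un t ω ∧
    ¬ MostlyUnique (highPart P n (S.T ω) t j) (2 ^ min (κ + 1 - j * P.e) κ)
  let Z : Finset Ω := outcomes fun ω => Un l ω ∧ ¬ HasMajority P n κ l (S.T ω)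
  -- Outside the listed events unique neighbours propagate from level `0` to level `l`. Each event
  -- includes `Un t ω`, the condition under which the counting at level `t` is valid.
  have hsub : (outcomes fun ω : Ω => ¬ HasMajority P n κ l (S.T ω)) ⊆
      ((range l).biUnion fun t => js.biUnion fun j => L t j ∪ H t j) ∪ Z := by
    intro ω hω
    by_contra hn
    rw [mem_union, not_or] at hn
    have hU : ∀ t ≤ l, Un t ω := by
      intro t
      induction t with
      | zero => exact fun _ => uniqueOn_zero _ _
      | succ t ih =>
        intro htl
        have hUt := ih (by omega)
        have hnot : ∀ j, j * P.e ≤ κ → ω ∉ L t j ∪ H t j := fun j hj hm =>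
          hn.1 (mem_biUnion.2 ⟨t, mem_range.2 (by omega), mem_biUnion.2 ⟨j, (hjs j).2 hj, hm⟩⟩)
        refine uniqueOn_succ h _ t (fun j hj => ?_) fun j hj => ?_
        · by_contra hc
          exact hnot j hj (mem_union_left _ (mem_outcomes.2 ⟨hUt, hc⟩))
        · by_contra hc
          exact hnot j hj (mem_union_right _ (mem_outcomes.2 ⟨hUt, hc⟩))
    exact hn.2 (mem_outcomes.2 ⟨hU l le_rfl,
      (mem_outcomes (E := fun ω => ¬ HasMajority P n κ l (S.T ω))).1 hω⟩)
  unfold count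
  have hcard : (count (fun ω : Ω => ¬ HasMajority P n κ l (S.T ω)) : ℝ) ≤
      (∑ t ∈ range l, ∑ j ∈ js, (((L t j).card : ℝ) + (H t j).card)) + Z.card := by
    have h1 : (outcomes fun ω : Ω => ¬ HasMajority P n κ l (S.T ω)).card ≤
        (∑ t ∈ range l, ∑ j ∈ js, ((L t j).card + (H t j).card)) + Z.card := by
      refine (card_le_card hsub).trans ((card_union_le _ _).trans (Nat.add_le_add_right ?_ _))
      refine card_biUnion_le.trans (sum_le_sum fun t _ => ?_)
      exact card_biUnion_le.trans (sum_le_sum fun j _ => card_union_le _ _)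
    exact_mod_cast h1
  set W : ℝ := (Fintype.card Ω : ℝ)
  have hW0 : 0 ≤ W := by positivity
  have hlevel : ∀ t ∈ range l, ∑ j ∈ js, (((L t j).card : ℝ) + (H t j).card)
      ≤ W * (1 / 2 ^ (n + t + 1)) := by
    intro t ht
    have htl := (mem_range.1 ht).le
    set r : ℝ := 2 * (2 ^ (n * 2 ^ t) / 2 ^ (4 * 2 ^ P.γ * (n * 2 ^ t)))
    have hr : 0 ≤ r := by positivity
    have h1 : ∀ j ∈ js, (((L t j).card : ℝ) + (H t j).card) ≤ W * (2 * r) := by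
      intro j hj
      have := card_not_low_le h S htl ((hjs j).1 hj)
      have := card_not_high_le h S htl ((hjs j).1 hj)
      unfold count at *
      simp only [L, H, Un]
      linarith
    have h2 : (js.card : ℝ) ≤ 2 ^ P.γ := by
      have : js.card ≤ 2 ^ P.γ := by
        rw [card_range]
        exact h.div_lt
      exact_mod_cast this
    calc ∑ j ∈ js, (((L t j).card : ℝ) + (H t j).card) ≤ ∑ _j ∈ js, W * (2 * r) := sum_le_sum h1
      _ = W * (js.card * (2 * r)) := by rw [sum_const, nsmul_eq_mul]; ring
      _ ≤ W * (2 ^ P.γ * (2 * r)) := by gcongr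
      _ ≤ _ := mul_le_mul_of_nonneg_left (level_term_le h t) hW0
  have hgeo : ∀ l : ℕ, ∑ t ∈ range l, (1 : ℝ) / 2 ^ (n + t + 1) = (1 - 1 / 2 ^ l) / 2 ^ n := by
    intro l
    induction l with
    | zero => simp
    | succ l ih =>
      rw [sum_range_succ, ih]
      field_simp
      ring
  have hZ : (Z.card : ℝ) ≤ W * (1 / 2 ^ n) := by
    refine (card_not_majority_le h S).trans (mul_le_mul_of_nonneg_left ?_ hW0)
    have e : (2 : ℝ) * (2 ^ (n * 2 ^ l) / 2 ^ (2 * (n * 2 ^ l)))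
        = 2 ^ (1 + n * 2 ^ l) / 2 ^ (2 * (n * 2 ^ l)) := by rw [pow_add]; ring
    rw [e, div_le_div_iff₀ (by positivity) (by positivity), ← pow_add, one_mul]
    refine pow_le_pow_right₀ (by norm_num) ?_
    have h1 : 2 ≤ 2 ^ l := Nat.le_self_pow (by omega) 2
    have := h.n_pos
    nlinarith
  have hsum : ∑ t ∈ range l, ∑ j ∈ js, (((L t j).card : ℝ) + (H t j).card) ≤ W * (1 / 2 ^ n) := by
    refine (sum_le_sum hlevel).trans ?_
    rw [← mul_sum, hgeo]
    refine mul_le_mul_of_nonneg_left ?_ hW0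
    gcongr
    have : (0 : ℝ) ≤ 1 / 2 ^ l := by positivity
    linarith
  calc _ ≤ W * (1 / 2 ^ n) + W * (1 / 2 ^ n) := hcard.trans (add_le_add hsum hZ)
    _ = W * (2 / 2 ^ n) := by ring

end

end Tabulation

/-! ### Structured programs with natural number semantics -/

namespace WordRAM

/-- A machine state with natural numbers in place of words. -/
structure NatState where
  reg : ℕ → ℕ
  mem : ℕ → ℕ
  inp : ℕ → ℕ
  out : ℕ → ℕ

namespace NatState

def setReg (σ : NatState) (d v : ℕ) : NatState := { σ with reg := Function.update σ.reg d v }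

def setMem (σ : NatState) (a v : ℕ) : NatState := { σ with mem := Function.update σ.mem a v }

def setOut (σ : NatState) (a v : ℕ) : NatState := { σ with out := Function.update σ.out a v }

variable (σ : NatState) (d v r : ℕ)

@[simp] theorem reg_setReg : (σ.setReg d v).reg r = if r = d then v else σ.reg r := by
  simp [setReg, Function.update_apply]
@[simp] theorem mem_setReg : (σ.setReg d v).mem = σ.mem := rfl
@[simp] theorem inp_setReg : (σ.setReg d v).inp = σ.inp := rfl
@[simp] theorem out_setReg : (σ.setReg d v).out = σ.out := rfl
@[simp] theorem reg_setMem : (σ.setMem d v).reg = σ.reg := rfl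
@[simp] theorem mem_setMem : (σ.setMem d v).mem = Function.update σ.mem d v := rfl
@[simp] theorem inp_setMem : (σ.setMem d v).inp = σ.inp := rfl
@[simp] theorem out_setMem : (σ.setMem d v).out = σ.out := rfl
@[simp] theorem reg_setOut : (σ.setOut d v).reg = σ.reg := rfl
@[simp] theorem mem_setOut : (σ.setOut d v).mem = σ.mem := rfl
@[simp] theorem inp_setOut : (σ.setOut d v).inp = σ.inp := rfl
@[simp] theorem out_setOut : (σ.setOut d v).out = Function.update σ.out d v := rfl

end NatState

/-- The registers from `50` on are used for the values of expressions. -/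
structure State.Rep {w : ℕ} (s : State w) (σ : NatState) : Prop where
  reg : ∀ r < 50, (s.reg r).toNat = σ.reg r
  mem : ∀ a, (s.mem a).toNat = σ.mem a
  inp : ∀ a, (s.inp a).toNat = σ.inp a
  out : ∀ a, (s.out a).toNat = σ.out a

/-- The operations of `BinOp.eval` on the numerical values of words. The subtraction `2 ^ w - y`
does not truncate, as long as `y` is the value of a word. -/
def BinOp.natEval (w : ℕ) : BinOp → ℕ → ℕ → ℕ
  | add, x, y => (x + y) % 2 ^ w
  | sub, x, y => (2 ^ w - y + x) % 2 ^ w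
  | and, x, y => x &&& y
  | or, x, y => x ||| y
  | xor, x, y => x ^^^ y
  | shl, x, y => (x <<< y) % 2 ^ w
  | shr, x, y => x >>> y
  | lt, x, y => if x < y then 1 else 0

theorem BinOp.toNat_eval {w : ℕ} (hw : 0 < w) (o : BinOp) (x y : BitVec w) :
    (o.eval x y).toNat = o.natEval w x.toNat y.toNat := by
  cases o <;> simp [BinOp.eval, BinOp.natEval]
  split_ifs
  · simp only [BitVec.toNat_ofNat]
    exact Nat.mod_eq_of_lt (Nat.one_lt_two_pow hw.ne')
  · simp

/-- Expressions over the registers. -/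
inductive Expr where
  | var (r : ℕ)
  | lit (k : ℕ)
  | bin (o : BinOp) (a b : Expr)

namespace Expr

def eval (w : ℕ) (ρ : ℕ → ℕ) : Expr → ℕ
  | var r => ρ r
  | lit k => k % 2 ^ w
  | bin o a b => o.natEval w (a.eval w ρ) (b.eval w ρ)

/-- The number of steps for the evaluation. -/
def cost : Expr → ℕ
  | var _ => 1
  | lit _ => 1
  | bin _ a b => a.cost + b.cost + 3

/-- Only registers below `50` occur. -/
def ok : Expr → Bool
  | var r => r < 50
  | lit _ => true
  | bin _ a b => a.ok && b.ok

/-- The program that puts the value of an expression into register `k`. -/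
def comp : Expr → ℕ → Prog
  | var r, k => .op .or k r r
  | lit v, k => .const k v
  | bin o a b, k => .seq (a.comp k) (.seq (b.comp (k + 1)) (.op o k k (k + 1)))

end Expr

/-- `p` runs from `s` to `s'` in exactly `t` steps. -/
def Runs {w : ℕ} (S : ℕ) (p : Prog) (s : State w) (t : ℕ) (s' : State w) : Prop :=
  ∀ K T, exec S (T + t) (p :: K) s = exec S T K s'

theorem Runs.seq {w S t t' : ℕ} {p q : Prog} {s s' s'' : State w} (hp : Runs S p s t s')
    (hq : Runs S q s' t' s'') : Runs S (.seq p q) s (t + t' + 1) s'' := by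
  intro K T
  rw [show T + (t + t' + 1) = (T + t' + t) + 1 by ring]
  simp only [exec]
  rw [hp, hq]

theorem Runs.op {w S : ℕ} (o : BinOp) (d a b : ℕ) (s : State w) :
    Runs S (.op o d a b) s 1 (s.setReg d (o.eval (s.reg a) (s.reg b))) := fun _ _ => rfl

/-- The registers from `k` on form an evaluation stack. Registers below `k` are untouched, so the
left operand in register `k` survives the evaluation of the right one in register `k + 1`. -/
theorem Expr.runs_comp {w : ℕ} (hw : 0 < w) (S : ℕ) (e : Expr) (he : e.ok = true) {σ : NatState} (k : ℕ)
    (hk : 50 ≤ k) (s : State w) (hs : ∀ r < 50, (s.reg r).toNat = σ.reg r) :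
    ∃ s' : State w, Runs S (e.comp k) s e.cost s' ∧ (∀ r < k, s'.reg r = s.reg r) ∧
      s'.mem = s.mem ∧ s'.inp = s.inp ∧ s'.out = s.out ∧ (s'.reg k).toNat = e.eval w σ.reg := by
  induction e generalizing k s with
  | var r =>
    refine ⟨_, Runs.op .or k r r s, fun r' hr' => ?_, rfl, rfl, rfl, ?_⟩
    · simp [State.setReg, hr'.ne]
    · have hr : r < 50 := by simpa [Expr.ok] using he
      simp [State.setReg, BinOp.eval, Expr.eval, hs r hr]
  | lit v =>
    refine ⟨s.setReg k (BitVec.ofNat w v), fun _ _ => rfl, fun r' hr' => ?_, rfl, rfl, rfl, ?_⟩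
    · simp [State.setReg, hr'.ne]
    · simp [State.setReg, Expr.eval]
  | bin o a b iha ihb =>
    have hok : a.ok = true ∧ b.ok = true := by simpa [Expr.ok] using he
    obtain ⟨s1, h1, h2, h3, h4, h5, h6⟩ := iha hok.1 k hk s hs
    obtain ⟨s2, g1, g2, g3, g4, g5, g6⟩ := ihb hok.2 (k + 1) (by omega) s1
      fun r hr => by rw [h2 r (by omega)]; exact hs r hr
    refine ⟨s2.setReg k (o.eval (s2.reg k) (s2.reg (k + 1))), ?_, fun r' hr' => ?_, ?_, ?_, ?_, ?_⟩
    · have := h1.seq (g1.seq (Runs.op o k k (k + 1) s2))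
      rw [show (Expr.bin o a b).cost = a.cost + (b.cost + 1 + 1) + 1 by simp only [Expr.cost]; ring]
      exact this
    · simp only [State.setReg, Function.update_apply, hr'.ne, if_false]
      rw [g2 r' (by omega), h2 r' hr']
    · exact g3.trans h3
    · exact g4.trans h4
    · exact g5.trans h5
    · simp only [State.setReg, Function.update_self]
      rw [BinOp.toNat_eval hw, g6, g2 k (by omega), h6]
      rfl

/-- `d := e` -/
def assign (d : ℕ) (e : Expr) : Prog := .seq (e.comp 50) (.op .or d 50 50)

/-- `d := mem[e]` -/
def loadE (d : ℕ) (e : Expr) : Prog := .seq (e.comp 50) (.load d 50)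

/-- `mem[a] := e` -/
def storeE (a e : Expr) : Prog := .seq (a.comp 50) (.seq (e.comp 51) (.store 50 51))

/-- `d := inp[e]` -/
def inputE (d : ℕ) (e : Expr) : Prog := .seq (e.comp 50) (.input d 50)

/-- `out[a] := e` -/
def outputE (a e : Expr) : Prog := .seq (a.comp 50) (.seq (e.comp 51) (.output 50 51))

/-- `if e then p else q` -/
def ifE (e : Expr) (p q : Prog) : Prog := .seq (e.comp 50) (.cond 50 p q)

/-- `for i < reg[b] do p` -/
def forE (i b : ℕ) (p : Prog) : Prog :=
  .seq (assign i (.lit 0)) (.seq ((Expr.bin .lt (.var i) (.var b)).comp 50)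
    (.loop 50 (.seq p (.seq (assign i (.bin .add (.var i) (.lit 1)))
      ((Expr.bin .lt (.var i) (.var b)).comp 50)))))

/-- `p` takes every state represented by `σ` in `t` steps to a state represented by `σ'`. -/
def Exec (S w : ℕ) (p : Prog) (σ : NatState) (t : ℕ) (σ' : NatState) : Prop :=
  ∀ s : State w, s.Rep σ → ∃ s' : State w, s'.Rep σ' ∧ Runs S p s t s'

/-- In state `σ`, the program `p` reaches a state with property `Q` within `B` steps. -/
def WP (S w : ℕ) (p : Prog) (B : ℕ) (Q : NatState → Prop) (σ : NatState) : Prop :=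
  ∃ t ≤ B, ∃ σ', Exec S w p σ t σ' ∧ Q σ'

section Rules

variable {S w : ℕ} {σ : NatState} {Q : NatState → Prop} {B : ℕ}

theorem WP.mono {p : Prog} {Q' : NatState → Prop} {B' : ℕ} (h : WP S w p B Q σ) (hB : B ≤ B')
    (hQ : ∀ σ', Q σ' → Q' σ') : WP S w p B' Q' σ := by
  obtain ⟨t, ht, σ', h1, h2⟩ := h
  exact ⟨t, ht.trans hB, σ', h1, hQ _ h2⟩

theorem wp_seq {p q : Prog} (B₁ B₂ : ℕ) (h : WP S w p B₁ (fun σ' => WP S w q B₂ Q σ') σ)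
    (hB : B₁ + B₂ + 1 ≤ B) : WP S w (.seq p q) B Q σ := by
  obtain ⟨t, ht, σ', h1, t', ht', σ'', h2, h3⟩ := h
  refine ⟨t + t' + 1, by omega, σ'', fun s hs => ?_, h3⟩
  obtain ⟨s', hs', hr⟩ := h1 s hs
  obtain ⟨s'', hs'', hr'⟩ := h2 s' hs'
  exact ⟨s'', hs'', hr.seq hr'⟩

variable (hw : 0 < w)
include hw

theorem wp_assign {d : ℕ} {e : Expr} (v : ℕ) (hv : e.eval w σ.reg = v) (hQ : Q (σ.setReg d v))
    (he : e.ok = true := by rfl) (hB : e.cost + 2 ≤ B := by decide) :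
    WP S w (assign d e) B Q σ := by
  refine ⟨e.cost + 1 + 1, hB, _, fun s hs => ?_, hQ⟩
  obtain ⟨s1, h1, h2, h3, h4, h5, h6⟩ := e.runs_comp hw S he 50 le_rfl s hs.reg
  refine ⟨_, ⟨fun r hr => ?_, fun a => ?_, fun a => ?_, fun a => ?_⟩, h1.seq (Runs.op _ _ _ _ _)⟩
  · simp only [State.setReg, Function.update_apply, NatState.reg_setReg, BinOp.eval]
    split_ifs
    · rw [BitVec.or_self, h6, hv]
    · rw [h2 r hr, hs.reg r hr]
  · rw [NatState.mem_setReg, ← hs.mem a, ← h3]; rfl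
  · rw [NatState.inp_setReg, ← hs.inp a, ← h4]; rfl
  · rw [NatState.out_setReg, ← hs.out a, ← h5]; rfl

theorem wp_load {d : ℕ} {e : Expr} (a v : ℕ) (ha : e.eval w σ.reg = a) (haS : a < S)
    (hv : σ.mem a = v) (hQ : Q (σ.setReg d v))
    (he : e.ok = true := by rfl) (hB : e.cost + 2 ≤ B := by decide) :
    WP S w (loadE d e) B Q σ := by
  refine ⟨e.cost + 1 + 1, hB, _, fun s hs => ?_, hQ⟩
  obtain ⟨s1, h1, h2, h3, h4, h5, h6⟩ := e.runs_comp hw S he 50 le_rfl s hs.reg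
  rw [ha] at h6
  have hload : Runs S (.load d 50) s1 1 (s1.setReg d (s1.mem (s1.reg 50).toNat)) := by
    intro K T
    simp only [exec]
    rw [if_pos (by rw [h6]; exact haS)]
  refine ⟨_, ⟨fun r hr => ?_, fun a => ?_, fun a => ?_, fun a => ?_⟩, h1.seq hload⟩
  · simp only [State.setReg, Function.update_apply, NatState.reg_setReg]
    split_ifs
    · rw [h6, h3, hs.mem, hv]
    · rw [h2 r hr, hs.reg r hr]
  · rw [NatState.mem_setReg, ← hs.mem a, ← h3]; rfl
  · rw [NatState.inp_setReg, ← hs.inp a, ← h4]; rfl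
  · rw [NatState.out_setReg, ← hs.out a, ← h5]; rfl

theorem wp_input {d : ℕ} {e : Expr} (a v : ℕ) (ha : e.eval w σ.reg = a)
    (hv : σ.inp a = v) (hQ : Q (σ.setReg d v))
    (he : e.ok = true := by rfl) (hB : e.cost + 2 ≤ B := by decide) :
    WP S w (inputE d e) B Q σ := by
  refine ⟨e.cost + 1 + 1, hB, _, fun s hs => ?_, hQ⟩
  obtain ⟨s1, h1, h2, h3, h4, h5, h6⟩ := e.runs_comp hw S he 50 le_rfl s hs.reg
  rw [ha] at h6
  have hload : Runs S (.input d 50) s1 1 (s1.setReg d (s1.inp (s1.reg 50).toNat)) :=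
    fun K T => rfl
  refine ⟨_, ⟨fun r hr => ?_, fun a => ?_, fun a => ?_, fun a => ?_⟩, h1.seq hload⟩
  · simp only [State.setReg, Function.update_apply, NatState.reg_setReg]
    split_ifs
    · rw [h6, h4, hs.inp, hv]
    · rw [h2 r hr, hs.reg r hr]
  · rw [NatState.mem_setReg, ← hs.mem a, ← h3]; rfl
  · rw [NatState.inp_setReg, ← hs.inp a, ← h4]; rfl
  · rw [NatState.out_setReg, ← hs.out a, ← h5]; rfl

theorem runs_comp_pair {a e : Expr} (ha : a.ok = true) (he : e.ok = true) {s : State w}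
    (hs : s.Rep σ) : ∃ s' s'' : State w, Runs S (a.comp 50) s a.cost s' ∧
      Runs S (e.comp 51) s' e.cost s'' ∧ s''.Rep σ ∧
      (s''.reg 50).toNat = a.eval w σ.reg ∧ (s''.reg 51).toNat = e.eval w σ.reg := by
  obtain ⟨s1, h1, h2, h3, h4, h5, h6⟩ := a.runs_comp hw S ha 50 le_rfl s hs.reg
  have hs1 : ∀ r < 50, (s1.reg r).toNat = σ.reg r := fun r hr => by rw [h2 r hr, hs.reg r hr]
  obtain ⟨s2, g1, g2, g3, g4, g5, g6⟩ := e.runs_comp hw S he 51 (by omega) s1 hs1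
  refine ⟨s1, s2, h1, g1, ⟨fun r hr => ?_, fun a => ?_, fun a => ?_, fun a => ?_⟩, ?_, g6⟩
  · rw [g2 r (by omega), hs1 r hr]
  · rw [g3, h3, hs.mem]
  · rw [g4, h4, hs.inp]
  · rw [g5, h5, hs.out]
  · rw [g2 50 (by omega), h6]

theorem wp_store {ea e : Expr} (a v : ℕ) (ha : ea.eval w σ.reg = a) (haS : a < S)
    (hv : e.eval w σ.reg = v) (hQ : Q (σ.setMem a v))
    (hea : ea.ok = true := by rfl) (he : e.ok = true := by rfl)
    (hB : ea.cost + e.cost + 3 ≤ B := by decide) :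
    WP S w (storeE ea e) B Q σ := by
  refine ⟨ea.cost + (e.cost + 1 + 1) + 1, by omega, _, fun s hs => ?_, hQ⟩
  obtain ⟨s1, s2, h1, h2, h3, h4, h5⟩ := runs_comp_pair (S := S) hw hea he hs
  rw [ha] at h4
  rw [hv] at h5
  have hst : Runs S (.store 50 51) s2 1
      { s2 with mem := Function.update s2.mem (s2.reg 50).toNat (s2.reg 51) } := by
    intro K T
    simp only [exec]
    rw [if_pos (by rw [h4]; exact haS)]
  refine ⟨{ s2 with mem := Function.update s2.mem (s2.reg 50).toNat (s2.reg 51) },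
    ⟨fun r hr => h3.reg r hr, fun b => ?_, fun b => h3.inp b, fun b => h3.out b⟩,
    h1.seq (h2.seq hst)⟩
  simp only [NatState.mem_setMem, Function.update_apply, h4]
  split_ifs
  · exact h5
  · exact h3.mem b

theorem wp_output {ea e : Expr} (a v : ℕ) (ha : ea.eval w σ.reg = a)
    (hv : e.eval w σ.reg = v) (hQ : Q (σ.setOut a v))
    (hea : ea.ok = true := by rfl) (he : e.ok = true := by rfl)
    (hB : ea.cost + e.cost + 3 ≤ B := by decide) :
    WP S w (outputE ea e) B Q σ := by
  refine ⟨ea.cost + (e.cost + 1 + 1) + 1, by omega, _, fun s hs => ?_, hQ⟩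
  obtain ⟨s1, s2, h1, h2, h3, h4, h5⟩ := runs_comp_pair (S := S) hw hea he hs
  rw [ha] at h4
  rw [hv] at h5
  have hst : Runs S (.output 50 51) s2 1
      { s2 with out := Function.update s2.out (s2.reg 50).toNat (s2.reg 51) } := fun K T => rfl
  refine ⟨{ s2 with out := Function.update s2.out (s2.reg 50).toNat (s2.reg 51) },
    ⟨fun r hr => h3.reg r hr, fun b => h3.mem b, fun b => h3.inp b, fun b => ?_⟩,
    h1.seq (h2.seq hst)⟩
  simp only [NatState.out_setOut, Function.update_apply, h4]
  split_ifs
  · exact h5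
  · exact h3.out b

theorem exec_comp {e : Expr} (he : e.ok = true) {s : State w} (hs : s.Rep σ) :
    ∃ s' : State w, Runs S (e.comp 50) s e.cost s' ∧ s'.Rep σ ∧
      (s'.reg 50).toNat = e.eval w σ.reg := by
  obtain ⟨s1, h1, h2, h3, h4, h5, h6⟩ := e.runs_comp hw S he 50 le_rfl s hs.reg
  refine ⟨s1, h1, ⟨fun r hr => ?_, fun a => ?_, fun a => ?_, fun a => ?_⟩, h6⟩
  · rw [h2 r hr, hs.reg r hr]
  · rw [h3, hs.mem]
  · rw [h4, hs.inp]
  · rw [h5, hs.out]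

theorem wp_if {e : Expr} {p q : Prog} (v B' : ℕ) (hv : e.eval w σ.reg = v)
    (hp : v ≠ 0 → WP S w p B' Q σ) (hq : v = 0 → WP S w q B' Q σ)
    (hB : e.cost + B' + 2 ≤ B) (he : e.ok = true := by rfl) :
    WP S w (ifE e p q) B Q σ := by
  by_cases h : v = 0
  · obtain ⟨t, ht, σ', h1, h2⟩ := hq h
    refine ⟨e.cost + (t + 1) + 1, by omega, σ', fun s hs => ?_, h2⟩
    obtain ⟨s1, g1, g2, g3⟩ := exec_comp (S := S) hw he hs
    obtain ⟨s2, k1, k2⟩ := h1 s1 g2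
    refine ⟨s2, k1, g1.seq fun K T => ?_⟩
    have h0 : s1.reg 50 = 0 := BitVec.eq_of_toNat_eq (by rw [g3, hv, h]; simp)
    rw [← Nat.add_assoc]
    simp only [exec]
    rw [if_neg (by simp [h0])]
    exact k2 K T
  · obtain ⟨t, ht, σ', h1, h2⟩ := hp h
    refine ⟨e.cost + (t + 1) + 1, by omega, σ', fun s hs => ?_, h2⟩
    obtain ⟨s1, g1, g2, g3⟩ := exec_comp (S := S) hw he hs
    obtain ⟨s2, k1, k2⟩ := h1 s1 g2
    refine ⟨s2, k1, g1.seq fun K T => ?_⟩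
    have h0 : s1.reg 50 ≠ 0 := fun h0 => h (by rw [← hv, ← g3, h0]; simp)
    rw [← Nat.add_assoc]
    simp only [exec]
    rw [if_pos h0]
    exact k2 K T

/-- Induction on the number `m` of remaining rounds. On entry, register `50` must already hold the
result of the test. The invariant is required only after the increment of the counter; `15` steps
per round cover the increment, the test and the control structure. -/
theorem loop_rule {i b N : ℕ} {p : Prog} (hi : i < 50) (hb : b < 50) (hN : N < 2 ^ w)
    (Inv : ℕ → NatState → Prop)
    (hI : ∀ k σ, Inv k σ → σ.reg i = k ∧ σ.reg b = N) (C : ℕ → ℕ)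
    (hp : ∀ k < N, ∀ σ, Inv k σ →
      WP S w p (C k) (fun σ' => σ'.reg i = k ∧ Inv (k + 1) (σ'.setReg i (k + 1))) σ)
    (m k : ℕ) (hk : k + m = N) (σ : NatState) (hσ : Inv k σ) :
    ∃ t ≤ ∑ j ∈ Finset.range m, (C (k + j) + 15) + 1, ∃ σ', Inv N σ' ∧ ∀ s : State w, s.Rep σ →
      (s.reg 50).toNat = (if k < N then 1 else 0) → ∃ s' : State w, s'.Rep σ' ∧
        Runs S (.loop 50 (.seq p (.seq (assign i (.bin .add (.var i) (.lit 1)))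
          ((Expr.bin .lt (.var i) (.var b)).comp 50)))) s t s' := by
  induction m generalizing k σ with
  | zero =>
    obtain rfl : k = N := by omega
    refine ⟨1, by simp, σ, hσ, fun s hs h50 => ⟨s, hs, fun K T => ?_⟩⟩
    rw [if_neg (by omega)] at h50
    have h0 : s.reg 50 = 0 := BitVec.eq_of_toNat_eq (by rw [h50]; simp)
    simp only [exec]
    rw [if_neg (by simp [h0])]
  | succ m ih =>
    have hkN : k < N := by omega
    obtain ⟨t1, ht1, σ1, hx1, hi1, hinv1⟩ := hp k hkN σ hσ
    have hk1 : 1 < 2 ^ w := Nat.one_lt_two_pow hw.ne'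
    have hasg : WP S w (assign i (.bin .add (.var i) (.lit 1))) 7
        (fun σ' => σ' = σ1.setReg i (k + 1)) σ1 := by
      refine wp_assign hw (k + 1) ?_ rfl (by simp [Expr.ok, hi]) (by simp [Expr.cost])
      simp only [Expr.eval, BinOp.natEval, hi1]
      rw [Nat.mod_eq_of_lt hk1, Nat.mod_eq_of_lt (by omega)]
    obtain ⟨t2, ht2, σ2, hx2, rfl⟩ := hasg
    obtain ⟨t3, ht3, σ3, hinv3, hx3⟩ := ih (k + 1) (by omega) _ hinv1
    refine ⟨t1 + (t2 + 5 + 1) + 1 + t3 + 1, ?_, σ3, hinv3, fun s hs h50 => ?_⟩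
    · rw [Finset.sum_range_succ']
      have e : ∀ j, C (k + (j + 1)) = C (k + 1 + j) := fun j => by congr 1; ring
      simp only [e, Nat.add_zero]
      omega
    · obtain ⟨s1, hs1, hr1⟩ := hx1 s hs
      obtain ⟨s2, hs2, hr2⟩ := hx2 s1 hs1
      have hcok : (Expr.bin .lt (.var i) (.var b)).ok = true := by simp [Expr.ok, hi, hb]
      obtain ⟨s3, hr3, hs3, h3⟩ := exec_comp (S := S) hw hcok hs2
      have h3' : (s3.reg 50).toNat = if k + 1 < N then 1 else 0 := by
        rw [h3]
        obtain ⟨e1, e2⟩ := hI _ _ hinv1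
        simp only [Expr.eval, e1, e2, BinOp.natEval]
      obtain ⟨s4, hs4, hr4⟩ := hx3 s3 hs3 h3'
      refine ⟨s4, hs4, fun K T => ?_⟩
      rw [if_pos hkN] at h50
      have h0 : s.reg 50 ≠ 0 := fun h0 => by rw [h0] at h50; simp at h50
      rw [← Nat.add_assoc]
      conv_lhs => simp only [exec]
      rw [if_pos h0, show T + (t1 + (t2 + 5 + 1) + 1 + t3) = (T + t3) + (t1 + (t2 + 5 + 1) + 1) by ring]
      exact (hr1.seq (hr2.seq hr3) _ _).trans (hr4 K T)

/-- The rule for loops with a loop counter. -/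
theorem wp_for {i b N : ℕ} {p : Prog} (Inv : ℕ → NatState → Prop) (C : ℕ → ℕ)
    (hN : N < 2 ^ w) (hI : ∀ k σ, Inv k σ → σ.reg i = k ∧ σ.reg b = N)
    (h0 : Inv 0 (σ.setReg i 0))
    (hp : ∀ k < N, ∀ σ, Inv k σ →
      WP S w p (C k) (fun σ' => σ'.reg i = k ∧ Inv (k + 1) (σ'.setReg i (k + 1))) σ)
    (hQ : ∀ σ, Inv N σ → Q σ)
    (hB : ∑ k ∈ Finset.range N, (C k + 15) + 20 ≤ B)
    (hi : i < 50 := by decide) (hb : b < 50 := by decide) :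
    WP S w (forE i b p) B Q σ := by
  have hasg : WP S w (assign i (.lit 0)) 3 (fun σ' => σ' = σ.setReg i 0) σ :=
    wp_assign hw 0 (by simp [Expr.eval]) rfl (by simp [Expr.ok]) (by simp [Expr.cost])
  obtain ⟨t1, ht1, σ1, hx1, rfl⟩ := hasg
  obtain ⟨t3, ht3, σ3, hinv3, hx3⟩ := loop_rule hw hi hb hN Inv hI C hp N 0 (by omega) _ h0
  simp only [Nat.zero_add] at ht3
  refine ⟨t1 + (5 + t3 + 1) + 1, by omega, σ3, fun s hs => ?_, hQ _ hinv3⟩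
  obtain ⟨s1, hs1, hr1⟩ := hx1 s hs
  have hcok : (Expr.bin .lt (.var i) (.var b)).ok = true := by simp [Expr.ok, hi, hb]
  obtain ⟨s2, hr2, hs2, h2⟩ := exec_comp (S := S) hw hcok hs1
  have h2' : (s2.reg 50).toNat = if 0 < N then 1 else 0 := by
    rw [h2]
    obtain ⟨e1, e2⟩ := hI _ _ h0
    simp only [Expr.eval, e1, e2, BinOp.natEval]
  obtain ⟨s3, hs3, hr3⟩ := hx3 s2 hs2 h2'
  exact ⟨s3, hs3, hr1.seq (hr2.seq hr3)⟩

end Rules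

end WordRAM

/-! ### Fields packed into words -/

namespace Tabulation

/-- Field `a` of the array of fields of `M` bits at address `base`, where each word holds `2 ^ L`
fields at distance `2 ^ μ`. -/
def fieldAt (M μ L : ℕ) (mem : ℕ → ℕ) (base a : ℕ) : ℕ :=
  (mem (base + a / 2 ^ L) >>> (a % 2 ^ L * 2 ^ μ)) % 2 ^ M

theorem fieldAt_lt (M μ L : ℕ) (mem : ℕ → ℕ) (base a : ℕ) : fieldAt M μ L mem base a < 2 ^ M :=
  Nat.mod_lt _ (Nat.two_pow_pos _)

theorem fieldAt_congr {M μ L : ℕ} {mem mem' : ℕ → ℕ} {base a : ℕ}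
    (h : mem (base + a / 2 ^ L) = mem' (base + a / 2 ^ L)) :
    fieldAt M μ L mem base a = fieldAt M μ L mem' base a := by
  unfold fieldAt
  rw [h]

section Chunk

variable {M μ L c χ g : ℕ}

theorem chunk_div (hc : c ≤ L) (hg : g < 2 ^ c) : (χ * 2 ^ c + g) / 2 ^ L = χ / 2 ^ (L - c) := by
  rw [← Nat.sub_add_cancel hc, pow_add, mul_comm (2 ^ (L - c)), ← Nat.div_div_eq_div_mul,
    mul_comm χ, Nat.mul_add_div (Nat.two_pow_pos c), Nat.div_eq_of_lt hg]
  simp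

theorem chunk_mod (hc : c ≤ L) (hg : g < 2 ^ c) :
    (χ * 2 ^ c + g) % 2 ^ L = χ % 2 ^ (L - c) * 2 ^ c + g := by
  have h1 := Nat.div_add_mod (χ * 2 ^ c + g) (2 ^ L)
  rw [chunk_div hc hg] at h1
  have h2 := Nat.div_add_mod χ (2 ^ (L - c))
  have h3 : 2 ^ L = 2 ^ (L - c) * 2 ^ c := by rw [← pow_add, Nat.sub_add_cancel hc]
  have h4 : χ * 2 ^ c = 2 ^ L * (χ / 2 ^ (L - c)) + χ % 2 ^ (L - c) * 2 ^ c := by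
    conv_lhs => rw [← h2]
    rw [h3]
    ring
  omega

/-- As `c ≤ L`, an aligned block of `2 ^ c` fields never crosses a word boundary, so one load and
one shift bring the whole block to the bottom of a register. -/
theorem read_chunk (hc : c ≤ L) (hg : g < 2 ^ c) (mem : ℕ → ℕ) (base : ℕ) :
    ((mem (base + χ / 2 ^ (L - c)) >>> (χ % 2 ^ (L - c) * 2 ^ (c + μ))) >>> (g * 2 ^ μ)) % 2 ^ M
      = fieldAt M μ L mem base (χ * 2 ^ c + g) := by
  unfold fieldAt
  rw [chunk_div hc hg, chunk_mod hc hg, ← Nat.shiftRight_add]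
  congr 2
  rw [pow_add]
  ring

variable {w : ℕ}

theorem chunk_shift_le (hc : c ≤ L) (hL : 0 < L → 2 ^ (L + μ) ≤ w) (hw : 0 < w) :
    χ % 2 ^ (L - c) * 2 ^ (c + μ) < w := by
  rcases Nat.eq_zero_or_pos L with h | h
  · subst h
    simpa [Nat.mod_one] using hw
  · calc χ % 2 ^ (L - c) * 2 ^ (c + μ) < 2 ^ (L - c) * 2 ^ (c + μ) :=
        Nat.mul_lt_mul_of_pos_right (Nat.mod_lt _ (Nat.two_pow_pos _)) (Nat.two_pow_pos _)
      _ = 2 ^ (L + μ) := by rw [← pow_add]; congr 1; omega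
      _ ≤ w := hL h

/-- With one field per word, `L = 0`, the distance `2 ^ μ` may exceed `w`; the field then starts at
bit `0`, and `M ≤ w` suffices. Hence the condition `2 ^ (L + μ) ≤ w` is imposed only for positive
`L`. -/
theorem field_end_le (hMμ : M ≤ 2 ^ μ) (hMw : M ≤ w) (hL : 0 < L → 2 ^ (L + μ) ≤ w) (a : ℕ) :
    a % 2 ^ L * 2 ^ μ + M ≤ w := by
  rcases Nat.eq_zero_or_pos L with h | h
  · subst h
    simpa [Nat.mod_one] using hMw
  · have h1 : a % 2 ^ L + 1 ≤ 2 ^ L := Nat.mod_lt _ (Nat.two_pow_pos _)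
    calc a % 2 ^ L * 2 ^ μ + M ≤ (a % 2 ^ L + 1) * 2 ^ μ := by rw [add_mul]; omega
      _ ≤ 2 ^ L * 2 ^ μ := Nat.mul_le_mul_right _ h1
      _ = 2 ^ (L + μ) := (pow_add _ _ _).symm
      _ ≤ w := hL h

/-- The new value of a word when `acc` is written into it after the lowest `sh` bits. -/
def spliced (w old acc sh : ℕ) : ℕ := (old &&& (2 ^ sh - 1)) ||| (acc <<< sh) % 2 ^ w

theorem testBit_spliced (old acc sh p : ℕ) (hp : p < w) :
    (spliced w old acc sh).testBit p = if p < sh then old.testBit p else acc.testBit (p - sh) := by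
  unfold spliced
  rw [Nat.testBit_or, Nat.and_two_pow_sub_one_eq_mod, Nat.testBit_mod_two_pow,
    Nat.testBit_mod_two_pow, Nat.testBit_shiftLeft]
  by_cases h : p < sh
  · simp [h, hp]
  · simp [h, hp, not_lt.1 h]

theorem fieldAt_testBit (mem : ℕ → ℕ) (base a b : ℕ) : (fieldAt M μ L mem base a).testBit b =
    (decide (b < M) && (mem (base + a / 2 ^ L)).testBit (a % 2 ^ L * 2 ^ μ + b)) := by
  unfold fieldAt
  rw [Nat.testBit_mod_two_pow, Nat.testBit_shiftRight]

/-- A write keeps only the bits below the block and may leave garbage above it. This is harmless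
because arrays are written in increasing order, so only the lower fields have to survive. -/
theorem write_chunk_lower (hc : c ≤ L) (hMμ : M ≤ 2 ^ μ) (hMw : M ≤ w)
    (hL : 0 < L → 2 ^ (L + μ) ≤ w) (mem : ℕ → ℕ) (base acc : ℕ) {a : ℕ} (ha : a < χ * 2 ^ c) :
    fieldAt M μ L (Function.update mem (base + χ / 2 ^ (L - c))
      (spliced w (mem (base + χ / 2 ^ (L - c))) acc (χ % 2 ^ (L - c) * 2 ^ (c + μ)))) base a
      = fieldAt M μ L mem base a := by
  obtain ⟨χ', g, hg, rfl⟩ : ∃ χ' g, g < 2 ^ c ∧ a = χ' * 2 ^ c + g :=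
    ⟨a / 2 ^ c, a % 2 ^ c, Nat.mod_lt _ (Nat.two_pow_pos _), (Nat.div_add_mod' _ _).symm⟩
  have hχ : χ' < χ := by
    by_contra h
    have := Nat.mul_le_mul_right (2 ^ c) (not_lt.1 h)
    omega
  apply Nat.eq_of_testBit_eq
  intro b
  rw [fieldAt_testBit, fieldAt_testBit]
  by_cases hb : b < M
  swap
  · simp [hb]
  have hend := field_end_le hMμ hMw hL (χ' * 2 ^ c + g)
  rw [chunk_div hc hg]
  by_cases he : χ' / 2 ^ (L - c) = χ / 2 ^ (L - c)
  · rw [he, Function.update_self, testBit_spliced _ _ _ _ (by omega), if_pos]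
    rw [chunk_mod hc hg]
    have h1 := Nat.div_add_mod χ (2 ^ (L - c))
    have h2 := Nat.div_add_mod χ' (2 ^ (L - c))
    rw [he] at h2
    have h3 : χ' % 2 ^ (L - c) + 1 ≤ χ % 2 ^ (L - c) := by omega
    calc (χ' % 2 ^ (L - c) * 2 ^ c + g) * 2 ^ μ + b
        < (χ' % 2 ^ (L - c) * 2 ^ c + g) * 2 ^ μ + 2 ^ μ := by omega
      _ = (χ' % 2 ^ (L - c) * 2 ^ c + g + 1) * 2 ^ μ := by ring
      _ ≤ ((χ' % 2 ^ (L - c) + 1) * 2 ^ c) * 2 ^ μ := Nat.mul_le_mul_right _ (by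
        rw [add_mul]; omega)
      _ ≤ (χ % 2 ^ (L - c) * 2 ^ c) * 2 ^ μ := Nat.mul_le_mul_right _ (Nat.mul_le_mul_right _ h3)
      _ = _ := by rw [pow_add]; ring
  · rw [Function.update_of_ne (by omega)]

theorem write_chunk_new (hc : c ≤ L) (hMμ : M ≤ 2 ^ μ) (hMw : M ≤ w)
    (hL : 0 < L → 2 ^ (L + μ) ≤ w) (mem : ℕ → ℕ) (base acc : ℕ) (hg : g < 2 ^ c) :
    fieldAt M μ L (Function.update mem (base + χ / 2 ^ (L - c))
      (spliced w (mem (base + χ / 2 ^ (L - c))) acc (χ % 2 ^ (L - c) * 2 ^ (c + μ)))) base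
        (χ * 2 ^ c + g) = (acc >>> (g * 2 ^ μ)) % 2 ^ M := by
  apply Nat.eq_of_testBit_eq
  intro b
  rw [fieldAt_testBit, Nat.testBit_mod_two_pow, Nat.testBit_shiftRight]
  by_cases hb : b < M
  swap
  · simp [hb]
  have hend := field_end_le hMμ hMw hL (χ * 2 ^ c + g)
  have e : (χ % 2 ^ (L - c) * 2 ^ c + g) * 2 ^ μ
      = χ % 2 ^ (L - c) * 2 ^ (c + μ) + g * 2 ^ μ := by rw [pow_add]; ring
  rw [chunk_div hc hg, Function.update_self, testBit_spliced _ _ _ _ (by omega), chunk_mod hc hg, e,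
    if_neg (by omega)]
  congr 2
  omega

/-- Extracting a field is linear over XOR. Hence the XOR of whole words tabulates all fields of a
block at once, regardless of the bits between and above the fields. -/
theorem xsum_shiftRight_mod (F s : ℕ) (φ : ℕ → ℕ) :
    (xsum F φ >>> s) % 2 ^ M = xsum F fun f => (φ f >>> s) % 2 ^ M := by
  induction F with
  | zero => simp [xsum]
  | succ F ih => rw [xsum, xsum, Nat.shiftRight_xor_distrib, Nat.xor_mod_two_pow, ih]

end Chunk

end Tabulation

/-! ### Reasoning rules for sequences of statements -/

namespace WordRAM

instance : Add Expr := ⟨.bin .add⟩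
instance : Sub Expr := ⟨.bin .sub⟩
instance : AndOp Expr := ⟨.bin .and⟩
instance : OrOp Expr := ⟨.bin .or⟩
instance : XorOp Expr := ⟨.bin .xor⟩
instance : ShiftLeft Expr := ⟨.bin .shl⟩
instance : ShiftRight Expr := ⟨.bin .shr⟩
instance (k : ℕ) : OfNat Expr k := ⟨.lit k⟩

/-- The value of a register. -/
abbrev R (r : ℕ) : Expr := .var r

/-- The comparison of two values. -/
def Expr.less (a b : Expr) : Expr := .bin .lt a b

/-- The lowest `y` bits of `e`. -/
def Expr.low (e y : Expr) : Expr := e &&& ((1 : Expr) <<< y) - 1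

/-- In registers `ρ`, the expression `e` has the value `v`. -/
def Ev (w : ℕ) (ρ : ℕ → ℕ) (e : Expr) (v : ℕ) : Prop := e.eval w ρ = v

section

variable (a b : Expr)

@[simp] theorem Expr.ok_add : (a + b).ok = (a.ok && b.ok) := rfl
@[simp] theorem Expr.ok_and : (a &&& b).ok = (a.ok && b.ok) := rfl
@[simp] theorem Expr.ok_or : (a ||| b).ok = (a.ok && b.ok) := rfl
@[simp] theorem Expr.ok_shl : (a <<< b).ok = (a.ok && b.ok) := rfl
@[simp] theorem Expr.ok_shr : (a >>> b).ok = (a.ok && b.ok) := rfl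

end

namespace Ev

variable {w : ℕ} {ρ : ℕ → ℕ} {a b : Expr} {x y : ℕ}

theorem var {r v : ℕ} (h : ρ r = v) : Ev w ρ (.var r) v := h

theorem lit {k : ℕ} (h : k < 2 ^ w) : Ev w ρ (.lit k) k := Nat.mod_eq_of_lt h

theorem num {k : ℕ} (h : k < 2 ^ w) : Ev w ρ (OfNat.ofNat k) k := Nat.mod_eq_of_lt h

theorem add (ha : Ev w ρ a x) (hb : Ev w ρ b y) (h : x + y < 2 ^ w) : Ev w ρ (a + b) (x + y) := by
  unfold Ev at *
  change (a.eval w ρ + b.eval w ρ) % 2 ^ w = _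
  rw [ha, hb, Nat.mod_eq_of_lt h]

theorem sub (ha : Ev w ρ a x) (hb : Ev w ρ b y) (h : y ≤ x) (h' : x < 2 ^ w) :
    Ev w ρ (a - b) (x - y) := by
  unfold Ev at *
  change (2 ^ w - b.eval w ρ + a.eval w ρ) % 2 ^ w = _
  rw [ha, hb, show 2 ^ w - y + x = (x - y) + 2 ^ w by omega, Nat.add_mod_right,
    Nat.mod_eq_of_lt (by omega)]

theorem and (ha : Ev w ρ a x) (hb : Ev w ρ b y) : Ev w ρ (a &&& b) (x &&& y) := by
  unfold Ev at *
  rw [← ha, ← hb]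
  rfl

theorem mod (ha : Ev w ρ a x) (hb : Ev w ρ b (2 ^ y - 1)) : Ev w ρ (a &&& b) (x % 2 ^ y) := by
  rw [← Nat.and_two_pow_sub_one_eq_mod]
  exact ha.and hb

theorem or (ha : Ev w ρ a x) (hb : Ev w ρ b y) : Ev w ρ (a ||| b) (x ||| y) := by
  unfold Ev at *
  rw [← ha, ← hb]
  rfl

theorem xor (ha : Ev w ρ a x) (hb : Ev w ρ b y) : Ev w ρ (a ^^^ b) (x ^^^ y) := by
  unfold Ev at *
  rw [← ha, ← hb]
  rfl

theorem shr (ha : Ev w ρ a x) (hb : Ev w ρ b y) : Ev w ρ (a >>> b) (x >>> y) := by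
  unfold Ev at *
  rw [← ha, ← hb]
  rfl

theorem div (ha : Ev w ρ a x) (hb : Ev w ρ b y) : Ev w ρ (a >>> b) (x / 2 ^ y) := by
  rw [← Nat.shiftRight_eq_div_pow]
  exact ha.shr hb

theorem shl (ha : Ev w ρ a x) (hb : Ev w ρ b y) : Ev w ρ (a <<< b) ((x <<< y) % 2 ^ w) := by
  unfold Ev at *
  rw [← ha, ← hb]
  rfl

theorem mul (ha : Ev w ρ a x) (hb : Ev w ρ b y) (h : x * 2 ^ y < 2 ^ w) :
    Ev w ρ (a <<< b) (x * 2 ^ y) := by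
  have := ha.shl hb
  rwa [Nat.shiftLeft_eq, Nat.mod_eq_of_lt h] at this

theorem pow (hw : 0 < w) (hb : Ev w ρ b y) (h : y < w) : Ev w ρ ((1 : Expr) <<< b) (2 ^ y) := by
  have h1 : Ev w ρ (1 : Expr) 1 := num (Nat.one_lt_two_pow hw.ne')
  simpa using h1.mul hb (by rw [one_mul]; exact Nat.pow_lt_pow_right (by omega) h)

theorem mask (hw : 0 < w) (hb : Ev w ρ b y) (h : y < w) :
    Ev w ρ (((1 : Expr) <<< b) - 1) (2 ^ y - 1) :=
  (pow hw hb h).sub (num (Nat.one_lt_two_pow hw.ne')) (Nat.two_pow_pos y)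
    (Nat.pow_lt_pow_right (by omega) h)

theorem low (hw : 0 < w) (ha : Ev w ρ a x) (hb : Ev w ρ b y) (hx : x < 2 ^ w) :
    Ev w ρ (a.low b) (x % 2 ^ y) := by
  by_cases h : y < w
  · rw [← Nat.and_two_pow_sub_one_eq_mod]
    exact ha.and (mask hw hb h)
  -- For `y ≥ w` the shift gives `0`, and subtracting `1` wraps around to the mask of all ones,
  -- which is still the right mask.
  · have hwy : 2 ^ w ≤ 2 ^ y := Nat.pow_le_pow_right (by omega) (by omega)
    rw [Nat.mod_eq_of_lt (hx.trans_le hwy)]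
    have h1 := ((num (Nat.one_lt_two_pow hw.ne')).shl hb : Ev w ρ ((1 : Expr) <<< b) _)
    have h2 : Ev w ρ (1 : Expr) 1 := num (Nat.one_lt_two_pow hw.ne')
    have h0 : (1 <<< y) % 2 ^ w = 0 := by
      rw [Nat.shiftLeft_eq, one_mul]
      exact Nat.mod_eq_zero_of_dvd (pow_dvd_pow 2 (by omega))
    rw [h0] at h1
    unfold Ev at *
    change (a.eval w ρ &&& ((2 ^ w - (1 : Expr).eval w ρ + ((1 : Expr) <<< b).eval w ρ) % 2 ^ w)) = x
    rw [ha, h1, h2, add_zero, Nat.mod_eq_of_lt (by have := Nat.two_pow_pos w; omega),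
      Nat.and_two_pow_sub_one_eq_mod, Nat.mod_eq_of_lt hx]

theorem less (ha : Ev w ρ a x) (hb : Ev w ρ b y) : Ev w ρ (a.less b) (if x < y then 1 else 0) := by
  unfold Ev at *
  rw [← ha, ← hb]
  rfl

theorem cast {v v' : ℕ} (h : Ev w ρ a v) (e : v = v') : Ev w ρ a v' := e ▸ h

end Ev

/-- Execute the programs of a list one after the other. -/
def block : List Prog → Prog
  | [] => .const 50 0
  | p :: ps => .seq p (block ps)

section Rules

variable {S w : ℕ} {σ : NatState} {Q : NatState → Prop} {B : ℕ} {ps : List Prog}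

theorem wp_nil (hQ : Q σ) (hB : 1 ≤ B := by omega) : WP S w (block []) B Q σ := by
  refine ⟨1, hB, σ, fun s hs => ⟨s.setReg 50 (BitVec.ofNat w 0), ⟨fun r hr => ?_, hs.mem, hs.inp,
    hs.out⟩, fun _ _ => rfl⟩, hQ⟩
  simp [State.setReg, hr.ne, hs.reg r hr]

theorem wp_cons {p : Prog} {B' : ℕ} (h : WP S w p B' (fun σ' => WP S w (block ps) (B - (B' + 1)) Q σ') σ)
    (hB : B' + 1 ≤ B := by omega) : WP S w (block (p :: ps)) B Q σ :=
  wp_seq _ _ h (by omega)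

theorem wp_cons_of {p : Prog} {B' : ℕ} {I : NatState → Prop} (h : WP S w p B' I σ)
    (hI : ∀ σ', I σ' → WP S w (block ps) (B - (B' + 1)) Q σ')
    (hB : B' + 1 ≤ B := by omega) : WP S w (block (p :: ps)) B Q σ :=
  wp_cons (h.mono le_rfl hI) hB

variable (hw : 0 < w)
include hw

/-- Every simple statement is charged a flat `60` steps, so time bounds of blocks reduce to counting
statements. -/
theorem wp_let {d : ℕ} {e : Expr} {v : ℕ} (hv : Ev w σ.reg e v)
    (hq : WP S w (block ps) (B - 60) Q (σ.setReg d v))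
    (he : e.ok = true := by rfl) (hc : e.cost ≤ 57 := by exact Nat.le_of_ble_eq_true rfl) (hB : 60 ≤ B := by omega) :
    WP S w (block (assign d e :: ps)) B Q σ :=
  wp_seq 59 (B - 60) (wp_assign hw v hv hq he (by omega)) (by omega)

theorem wp_read {d : ℕ} {e : Expr} {a : ℕ} (ha : Ev w σ.reg e a) (haS : a < S)
    (hq : WP S w (block ps) (B - 60) Q (σ.setReg d (σ.mem a)))
    (he : e.ok = true := by rfl) (hc : e.cost ≤ 57 := by exact Nat.le_of_ble_eq_true rfl) (hB : 60 ≤ B := by omega) :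
    WP S w (block (loadE d e :: ps)) B Q σ :=
  wp_seq 59 (B - 60) (wp_load hw a _ ha haS rfl hq he (by omega)) (by omega)

theorem wp_get {d : ℕ} {e : Expr} {a : ℕ} (ha : Ev w σ.reg e a)
    (hq : WP S w (block ps) (B - 60) Q (σ.setReg d (σ.inp a)))
    (he : e.ok = true := by rfl) (hc : e.cost ≤ 57 := by exact Nat.le_of_ble_eq_true rfl) (hB : 60 ≤ B := by omega) :
    WP S w (block (inputE d e :: ps)) B Q σ :=
  wp_seq 59 (B - 60) (wp_input hw a _ ha rfl hq he (by omega)) (by omega)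

theorem wp_write {ea e : Expr} {a v : ℕ} (ha : Ev w σ.reg ea a) (haS : a < S)
    (hv : Ev w σ.reg e v) (hq : WP S w (block ps) (B - 60) Q (σ.setMem a v))
    (hea : ea.ok = true := by rfl) (he : e.ok = true := by rfl)
    (hc : ea.cost + e.cost ≤ 56 := by exact Nat.le_of_ble_eq_true rfl) (hB : 60 ≤ B := by omega) :
    WP S w (block (storeE ea e :: ps)) B Q σ :=
  wp_seq 59 (B - 60) (wp_store hw a v ha haS hv hq hea he (by omega)) (by omega)

theorem wp_put {ea e : Expr} {a v : ℕ} (ha : Ev w σ.reg ea a)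
    (hv : Ev w σ.reg e v) (hq : WP S w (block ps) (B - 60) Q (σ.setOut a v))
    (hea : ea.ok = true := by rfl) (he : e.ok = true := by rfl)
    (hc : ea.cost + e.cost ≤ 56 := by exact Nat.le_of_ble_eq_true rfl) (hB : 60 ≤ B := by omega) :
    WP S w (block (outputE ea e :: ps)) B Q σ :=
  wp_seq 59 (B - 60) (wp_output hw a v ha hv hq hea he (by omega)) (by omega)

theorem wp_cond {e : Expr} {p q : Prog} {v B' : ℕ} (hv : Ev w σ.reg e v)
    (hp : v ≠ 0 → WP S w p B' Q σ) (hq : v = 0 → WP S w q B' Q σ)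
    (he : e.ok = true := by rfl) (hc : e.cost ≤ 57 := by exact Nat.le_of_ble_eq_true rfl) :
    WP S w (ifE e p q) (B' + 60) Q σ :=
  wp_if hw v B' hv hp hq (by omega) he

end Rules

end WordRAM

/-! ### The programs -/

namespace Tabulation

open WordRAM

/-- `d :=` field `a` of the array with base `b` -/
def readField (d b a : ℕ) : Prog := block [
  loadE d (R b + (R a >>> R 5)),
  assign d ((R d >>> ((R a &&& R 10) <<< R 4)) &&& R 9)]

/-- Write register `y` into block `x` of `2 ^ reg 18` fields of the array with base `b`. -/
def writeChunk (b x y : ℕ) : Prog := block [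
  assign 40 (R b + (R x >>> R 20)),
  assign 41 ((R x).low (R 20) <<< (R 18 + R 4)),
  loadE 42 (R 40),
  storeE (R 40) ((R 42).low (R 41) ||| (R y <<< R 41))]

variable (γ δ : ℕ)

/-- Only memory persists between queries, so each query recomputes its constants. Cells `0` and `1`
hold `μ` and `L`; register `36` receives the number of words of a buffer, and registers `14`, `15`,
`8` the bases of the two buffers and of the tables. -/
def setupProg : Prog := block [
  loadE 4 0, loadE 5 1,
  assign 6 (R 1 + R 2 + 20),
  assign 7 ((R 1 >>> 2) + 1),
  assign 36 ((1 : Expr) <<< (R 6 + .lit (2 * δ + 2) + R 0 + R 0 - R 5)),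
  assign 14 2, assign 15 (R 36 + 2),
  assign 8 (R 36 + R 36 + 2),
  assign 9 (((1 : Expr) <<< R 6) - 1),
  assign 10 (((1 : Expr) <<< R 5) - 1),
  assign 11 (R 1 + R 2 + 4),
  assign 12 ((1 : Expr) <<< R 0),
  assign 13 (R 0 + 1)]

/-- Registers `16` and `17` track the word index and the bit offset of the current character, which
avoids multiplication and division by `w`. A character may straddle two input words. It is written
`2 ^ (δ + 1)` times, so that level `0` finds two equal blocks and needs no special treatment. -/
def fillProg : Prog := block [
  assign 16 0, assign 17 0, assign 18 0, assign 19 0, assign 20 (R 5),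
  assign 21 (.lit (2 ^ (δ + 1))),
  forE 22 12 (block [
    inputE 23 (R 16), inputE 24 (R 16 + 1),
    assign 23 (((R 23 >>> R 17) ||| (R 24 <<< (R 3 - R 17))).low (R 1)),
    forE 25 21 (block [
      writeChunk 14 19 23,
      assign 19 (R 19 + 1)]),
    assign 17 (R 17 + R 1),
    ifE ((R 17).less (R 3)) (block []) (block [
      assign 17 (R 17 - R 3),
      assign 16 (R 16 + 1)])])]

/-- Add the block of table `reg 26` into the accumulator. -/
def lookupProg : Prog := block [
  assign 29 (((R 24 + R 24) <<< R 17) + R 26),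
  readField 30 14 29,
  assign 31 (R 29 + R 21),
  readField 32 14 31,
  assign 33 ((R 30).low (R 28) + ((R 32 >>> R 28) <<< R 28)),
  assign 34 ((((R 21 + R 26) <<< R 6) + R 33) <<< R 19),
  assign 34 (R 34 + R 25),
  loadE 35 (R 8 + (R 34 >>> R 20)),
  assign 27 (R 27 ^^^ (R 35 >>> ((R 34).low (R 20) <<< (R 18 + R 4)))),
  ifE ((R 26 + 1).low (.lit γ)) (block [assign 28 (R 28 + R 7)])
    (block [assign 28 (R 7 + R 7 + 8)])]

/-- Register `23` counts blocks over all strings of the level; its high part selects the string and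
its low part the block inside an entry. Register `28` starts with the cut of field `0`. -/
def chunkProg : Prog := block [
  assign 24 (R 23 >>> R 19),
  assign 25 ((R 23).low (R 19)),
  assign 27 0,
  assign 28 (R 7 + R 7 + 8),
  forE 26 21 (lookupProg γ),
  writeChunk 15 23 27]

/-- A block has `2 ^ c` fields with `c = min L (δ + t + 1)`, the most that fits both into a word and
into an entry. At the end the two buffers change roles. -/
def levelProg : Prog := block [
  assign 17 (R 16 + .lit δ),
  ifE ((R 17 + 1).less (R 5)) (block [assign 18 (R 17 + 1)]) (block [assign 18 (R 5)]),
  assign 19 (R 17 + 1 - R 18),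
  assign 20 (R 5 - R 18),
  assign 21 ((1 : Expr) <<< R 17),
  assign 22 (((1 : Expr) <<< (R 0 - R 16)) <<< R 19),
  forE 23 22 (chunkProg γ),
  assign 36 (R 14), assign 14 (R 15), assign 15 (R 36)]

/-- Since the output is write-only, register `18` keeps the unfinished word, which is output again
after each field. When a field crosses a word boundary, its upper bits start the next word. -/
def outputProg : Prog := block [
  assign 16 0, assign 17 0, assign 18 0,
  assign 19 (R 12 <<< 3),
  forE 20 19 (block [
    readField 21 14 20,
    assign 21 ((R 21).low (R 11)),
    assign 18 (R 18 ||| (R 21 <<< R 17)),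
    outputE (R 16) (R 18),
    assign 17 (R 17 + R 11),
    ifE ((R 17).less (R 3)) (block []) (block [
      assign 17 (R 17 - R 3),
      assign 16 (R 16 + 1),
      assign 18 (R 21 >>> (R 11 - R 17)),
      outputE (R 16) (R 18)])])]

def evalProg : Prog := block [
  setupProg δ, fillProg δ, forE 16 13 (levelProg γ δ), outputProg]

end Tabulation

/-! ### Tabulating a block of fields -/

namespace Tabulation

open WordRAM

/-- The number of words for the tables and for each of two buffers. -/
def words (P : Params) (l L : ℕ) : ℕ := 2 ^ (P.M + 2 * P.δ + 2 * l + 2 - L)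

/-- The conditions under which the evaluation program works. -/
structure Layout (P : Params) (n κ l w μ L S : ℕ) : Prop where
  M_eq : P.M = n + κ + 20
  e_eq : P.e = n / 4 + 1
  δ_eq : P.δ = 2 * P.γ + 6
  M_le : P.M ≤ 2 ^ μ
  μ_le : μ ≤ P.M
  width : P.M + P.δ + l + 2 ≤ w
  pack : 0 < L → 2 ^ (L + μ) ≤ w
  L_le : L ≤ P.M + 2 * P.δ + 2 * l + 2
  S_eq : S = 3 * words P l L + 3
  S_le : S ≤ 2 ^ w

/-- The registers after the setup. -/
structure Ready (P : Params) (n κ l w μ L : ℕ) (σ : NatState) : Prop where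
  r0 : σ.reg 0 = l
  r1 : σ.reg 1 = n
  r2 : σ.reg 2 = κ
  r3 : σ.reg 3 = w
  r4 : σ.reg 4 = μ
  r5 : σ.reg 5 = L
  r6 : σ.reg 6 = P.M
  r7 : σ.reg 7 = P.e
  r8 : σ.reg 8 = 2 * words P l L + 2
  r9 : σ.reg 9 = 2 ^ P.M - 1
  r10 : σ.reg 10 = 2 ^ L - 1
  r11 : σ.reg 11 = n + κ + 4
  r12 : σ.reg 12 = 2 ^ l
  r13 : σ.reg 13 = l + 1

section

variable {P : Params} {n κ l w μ L S : ℕ}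

theorem Ready.congr {σ σ' : NatState} (h : Ready P n κ l w μ L σ) {k : ℕ}
    (hk : ∀ r < k, σ'.reg r = σ.reg r) (hk' : 14 ≤ k := by decide) : Ready P n κ l w μ L σ' where
  r0 := (hk 0 (by omega)).trans h.r0
  r1 := (hk 1 (by omega)).trans h.r1
  r2 := (hk 2 (by omega)).trans h.r2
  r3 := (hk 3 (by omega)).trans h.r3
  r4 := (hk 4 (by omega)).trans h.r4
  r5 := (hk 5 (by omega)).trans h.r5
  r6 := (hk 6 (by omega)).trans h.r6
  r7 := (hk 7 (by omega)).trans h.r7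
  r8 := (hk 8 (by omega)).trans h.r8
  r9 := (hk 9 (by omega)).trans h.r9
  r10 := (hk 10 (by omega)).trans h.r10
  r11 := (hk 11 (by omega)).trans h.r11
  r12 := (hk 12 (by omega)).trans h.r12
  r13 := (hk 13 (by omega)).trans h.r13

theorem Ready.setReg {σ : NatState} (h : Ready P n κ l w μ L σ) {d v : ℕ}
    (hd : 14 ≤ d := by decide) : Ready P n κ l w μ L (σ.setReg d v) :=
  h.congr (k := 14) fun r hr => by rw [NatState.reg_setReg, if_neg (by omega)]

theorem small_lt {k : ℕ} (h : k ≤ w) : k < 2 ^ w := h.trans_lt Nat.lt_two_pow_self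

theorem words_pos : 0 < words P l L := Nat.two_pow_pos _

namespace Layout

variable (ly : Layout P n κ l w μ L S)
include ly

theorem w_pos : 0 < w := by have := ly.width; omega

theorem lt_pow {k : ℕ} (h : k < 2 ^ (P.M + P.δ + l + 2)) : k < 2 ^ w :=
  h.trans_le (Nat.pow_le_pow_right (by omega) ly.width)

theorem pow_lt {k : ℕ} (h : k < P.M + P.δ + l + 2) : 2 ^ k < 2 ^ w :=
  Nat.pow_lt_pow_right (by omega) (h.trans_le ly.width)

theorem words_le : 3 * words P l L + 3 ≤ 2 ^ w := ly.S_eq ▸ ly.S_le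

theorem shift_le : L + μ ≤ w := by
  rcases Nat.eq_zero_or_pos L with h | h
  · have := ly.μ_le
    have := ly.width
    omega
  · exact Nat.lt_two_pow_self.le.trans (ly.pack h)

theorem M_le_w : P.M ≤ w := by have := ly.width; omega

theorem cut_lt (f : ℕ) : P.cut f < 2 ^ w := by
  refine ly.lt_pow ?_
  have h1 : f % 2 ^ P.γ < 2 ^ P.γ := Nat.mod_lt _ (Nat.two_pow_pos _)
  have h2 : P.e ≤ P.M := by have := ly.e_eq; have := ly.M_eq; omega
  have h3 : P.M < 2 ^ P.M := Nat.lt_two_pow_self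
  have h0 := Nat.two_pow_pos P.γ
  have h4 : (f % 2 ^ P.γ + 2) * P.e ≤ (2 * 2 ^ P.γ) * 2 ^ P.M :=
    Nat.mul_le_mul (by omega) (by omega)
  have h5 : 2 * 2 ^ P.γ * 2 ^ P.M + 8 ≤ 2 ^ (P.M + P.δ + l + 1) := by
    have : 2 ^ (P.γ + P.M + 2) ≤ 2 ^ (P.M + P.δ + l + 1) :=
      Nat.pow_le_pow_right (by omega) (by have := ly.δ_eq; omega)
    have h8 : 2 ^ 3 ≤ 2 ^ P.M := Nat.pow_le_pow_right (by omega) (by have := ly.M_eq; omega)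
    rw [pow_add, pow_add] at this
    nlinarith
  have h6 : 2 ^ (P.M + P.δ + l + 1) < 2 ^ (P.M + P.δ + l + 2) :=
    Nat.pow_lt_pow_right (by omega) (by omega)
  unfold Params.cut
  omega

theorem div_lt_words {a : ℕ} (h : a < 2 ^ (P.M + 2 * P.δ + 2 * l + 2)) :
    a / 2 ^ L < words P l L := by
  rw [Nat.div_lt_iff_lt_mul (Nat.two_pow_pos L), words, ← pow_add, Nat.sub_add_cancel ly.L_le]
  exact h

end Layout

theorem wp_readField (ly : Layout P n κ l w μ L S) {σ : NatState}
    (hr : Ready P n κ l w μ L σ) {d b a base v : ℕ} (hb : σ.reg b = base) (ha : σ.reg a = v)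
    (hbase : base ≤ 2 * words P l L + 2) (hv : v < 2 ^ (P.M + 2 * P.δ + 2 * l + 2))
    (hd : 14 ≤ d) (hda : a ≠ d) (hb' : b < 50) (ha' : a < 50) (hd' : d < 50) :
    WP S w (readField d b a) 130
      (fun σ' => σ' = σ.setReg d (fieldAt P.M μ L σ.mem base v)) σ := by
  have hw := ly.w_pos
  have h1 := ly.div_lt_words hv
  have h2 := ly.words_le
  have hS := ly.S_eq
  refine wp_read hw ((Ev.var hb).add ((Ev.var ha).div (Ev.var hr.r5)) (by omega)) (by omega) ?_
    (by simp [Expr.ok, hb', ha'])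
  have hr' := hr.setReg (d := d) (v := σ.mem (base + v / 2 ^ L)) hd
  have ha2 : (σ.setReg d (σ.mem (base + v / 2 ^ L))).reg a = v := by
    rw [NatState.reg_setReg, if_neg hda, ha]
  have hd2 : (σ.setReg d (σ.mem (base + v / 2 ^ L))).reg d = σ.mem (base + v / 2 ^ L) := by simp
  have hsh : v % 2 ^ L * 2 ^ μ < 2 ^ w := by
    have := field_end_le ly.M_le ly.M_le_w ly.pack v
    exact small_lt (by omega)
  refine wp_let hw (((Ev.var hd2).shr (((Ev.var ha2).mod (Ev.var hr'.r10)).mul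
    (Ev.var hr'.r4) hsh)).mod (Ev.var hr'.r9)) ?_ (by simp [Expr.ok, hd', ha'])
  refine wp_nil ?_
  simp [NatState.setReg, fieldAt]

end

end Tabulation

/-! ### Lookup of one block in one table -/

namespace Tabulation

open WordRAM

variable {P : Params} {n κ l w μ L S : ℕ}

theorem wp_writeChunk (ly : Layout P n κ l w μ L S) {σ : NatState} (hr : Ready P n κ l w μ L σ)
    {b x y base χ acc c : ℕ} (h18 : σ.reg 18 = c) (h20 : σ.reg 20 = L - c) (hb : σ.reg b = base)
    (hx : σ.reg x = χ) (hy : σ.reg y = acc) (hc : c ≤ L) (hbase : base ≤ 2 * words P l L + 2)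
    (hχ : χ / 2 ^ (L - c) < words P l L) (hχw : χ < 2 ^ w) (hb' : b < 40) (hx' : x < 40)
    (hy' : y < 40) :
    WP S w (writeChunk b x y) 250 (fun σ' => (∀ r < 40, σ'.reg r = σ.reg r) ∧
      σ'.mem = Function.update σ.mem (base + χ / 2 ^ (L - c))
        (spliced w (σ.mem (base + χ / 2 ^ (L - c))) acc (χ % 2 ^ (L - c) * 2 ^ (c + μ))) ∧
      σ'.inp = σ.inp ∧ σ'.out = σ.out) σ := by
  have hw := ly.w_pos
  have h2 := ly.words_le
  have hS := ly.S_eq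
  have hsw := chunk_shift_le (χ := χ) hc ly.pack hw
  have hsh := ly.shift_le
  refine wp_let hw ((Ev.var hb).add ((Ev.var hx).div (Ev.var h20)) (by omega)) ?_
    (by simp [Expr.ok]; omega)
  refine wp_let hw (Ev.mul (Ev.low hw (Ev.var (v := χ) ?_) (Ev.var h20) hχw)
    (Ev.add (Ev.var h18) (Ev.var hr.r4) (small_lt (by omega))) (small_lt hsw.le)) ?_
    (by simp [Expr.ok, Expr.low]; constructor; omega; rfl)
  · rw [NatState.reg_setReg, if_neg (by omega), hx]
  refine wp_read hw (Ev.var rfl) (by simp; omega) ?_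
  refine wp_write (v := spliced w (σ.mem (base + χ / 2 ^ (L - c))) acc
    (χ % 2 ^ (L - c) * 2 ^ (c + μ))) hw (Ev.var rfl) (by simp; omega) ?_ ?_ rfl
    (by simp [Expr.ok, Expr.low]; constructor; rfl; omega)
  · unfold spliced
    refine Ev.or (Ev.and (Ev.var (by simp)) (Ev.mask hw (Ev.var ?_) hsw))
      (Ev.shl (Ev.var ?_) (Ev.var ?_))
    · simp
    · simp only [NatState.reg_setReg]
      rw [if_neg (by omega), if_neg (by omega), if_neg (by omega), hy]
    · simp
  refine wp_nil ⟨fun r hr => ?_, ?_, rfl, rfl⟩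
  · simp only [NatState.reg_setReg, NatState.reg_setMem]
    rw [if_neg (by omega), if_neg (by omega), if_neg (by omega)]
  · simp

/-- The registers during the work on level `t`, with blocks of `2 ^ c` fields, reading from the
buffer at `X` and writing to the buffer at `Y`. -/
structure AtLevel (P : Params) (n κ l w μ L t c X Y : ℕ) (σ : NatState) : Prop
    extends Ready P n κ l w μ L σ where
  r14 : σ.reg 14 = X
  r15 : σ.reg 15 = Y
  r16 : σ.reg 16 = t
  r17 : σ.reg 17 = P.δ + t
  r18 : σ.reg 18 = c
  r19 : σ.reg 19 = P.δ + t + 1 - c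
  r20 : σ.reg 20 = L - c
  r21 : σ.reg 21 = 2 ^ (P.δ + t)
  r22 : σ.reg 22 = 2 ^ (l - t) * 2 ^ (P.δ + t + 1 - c)

theorem AtLevel.congr {t c X Y : ℕ} {σ σ' : NatState} (h : AtLevel P n κ l w μ L t c X Y σ) {k : ℕ}
    (hk : ∀ r < k, σ'.reg r = σ.reg r) (hk' : 23 ≤ k := by decide) :
    AtLevel P n κ l w μ L t c X Y σ' where
  toReady := h.toReady.congr hk (by omega)
  r14 := (hk 14 (by omega)).trans h.r14
  r15 := (hk 15 (by omega)).trans h.r15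
  r16 := (hk 16 (by omega)).trans h.r16
  r17 := (hk 17 (by omega)).trans h.r17
  r18 := (hk 18 (by omega)).trans h.r18
  r19 := (hk 19 (by omega)).trans h.r19
  r20 := (hk 20 (by omega)).trans h.r20
  r21 := (hk 21 (by omega)).trans h.r21
  r22 := (hk 22 (by omega)).trans h.r22

theorem AtLevel.setReg {t c X Y : ℕ} {σ : NatState} (h : AtLevel P n κ l w μ L t c X Y σ) {d v : ℕ}
    (hd : 23 ≤ d := by decide) : AtLevel P n κ l w μ L t c X Y (σ.setReg d v) :=
  h.congr (k := 23) fun r hr => by rw [NatState.reg_setReg, if_neg (by omega)]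

/-- The character by which block `v` of the buffer at `X` accesses table `f` of level `t`. -/
def key (P : Params) (μ L t X : ℕ) (mem : ℕ → ℕ) (v f : ℕ) : ℕ :=
  comb (P.cut f) (fieldAt P.M μ L mem X (2 * v * 2 ^ (P.δ + t) + f))
    (fieldAt P.M μ L mem X ((2 * v + 1) * 2 ^ (P.δ + t) + f))

theorem key_lt (t X : ℕ) (mem : ℕ → ℕ) (v f : ℕ) : key P μ L t X mem v f < 2 ^ P.M :=
  comb_lt (fieldAt_lt _ _ _ _ _ _) (fieldAt_lt _ _ _ _ _ _)

/-- The index of block `u` of entry `key` of table `f`. -/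
def place (P : Params) (μ L t c X : ℕ) (mem : ℕ → ℕ) (v u f : ℕ) : ℕ :=
  ((2 ^ (P.δ + t) + f) * 2 ^ P.M + key P μ L t X mem v f) * 2 ^ (P.δ + t + 1 - c) + u

/-- Lets the loop over the tables follow the cut by one addition per table, in place of a
multiplication by `e`. -/
theorem cut_succ (f : ℕ) : P.cut (f + 1) =
    if (f + 1) % 2 ^ P.γ = 0 then P.e + P.e + 8 else P.cut f + P.e := by
  have h0 := Nat.two_pow_pos P.γ
  unfold Params.cut
  split_ifs with h
  · rw [h]
    ring
  · have h1 : (f % 2 ^ P.γ + 1) % 2 ^ P.γ = (f + 1) % 2 ^ P.γ := Nat.mod_add_mod f _ 1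
    have h2 := Nat.mod_lt f h0
    have h3 : f % 2 ^ P.γ + 1 < 2 ^ P.γ := by
      by_contra h4
      rw [show f % 2 ^ P.γ + 1 = 2 ^ P.γ by omega, Nat.mod_self] at h1
      exact h h1.symm
    rw [← h1, Nat.mod_eq_of_lt h3]
    ring

theorem place_lt {t c X v u f : ℕ} {mem : ℕ → ℕ} (hcd : c ≤ P.δ + t + 1) (hu : u < 2 ^ (P.δ + t + 1 - c))
    (hf : f < 2 ^ (P.δ + t)) :
    place P μ L t c X mem v u f < 2 ^ (P.M + 2 * P.δ + 2 * t + 2 - c) := by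
  have h := entry_lt (t := t) hf (key_lt (P := P) (μ := μ) (L := L) t X mem v f)
  rw [show P.M + 2 * P.δ + 2 * t + 2 - c = (P.δ + t + 1 + P.M) + (P.δ + t + 1 - c) by omega, pow_add]
  unfold place
  nlinarith

/-- Field addresses themselves may exceed a word, but indices of blocks do not: for `c = L` they are
indices of memory words, and for `c = δ + t + 1` they are numbers of entries, which `width` bounds.
-/
theorem Layout.place_lt_pow (ly : Layout P n κ l w μ L S) {t c z : ℕ} (ht : t ≤ l) (hcL : c ≤ L)
    (hcd : c ≤ P.δ + t + 1) (hc : c = L ∨ c = P.δ + t + 1)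
    (hz : z < 2 ^ (P.M + 2 * P.δ + 2 * t + 2 - c)) : z < 2 ^ w ∧ z / 2 ^ (L - c) < words P l L := by
  have hle : 2 ^ (P.M + 2 * P.δ + 2 * t + 2 - c) ≤ 2 ^ (P.M + 2 * P.δ + 2 * l + 2 - c) :=
    Nat.pow_le_pow_right (by omega) (by omega)
  have hL := ly.L_le
  constructor
  · rcases hc with h | h
    · subst h
      have := ly.words_le
      unfold words at this
      omega
    · exact hz.trans_le (Nat.pow_le_pow_right (by omega) (by have := ly.width; omega))
  · rw [Nat.div_lt_iff_lt_mul (Nat.two_pow_pos _), words, ← pow_add]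
    refine (hz.trans_le hle).trans_le (Nat.pow_le_pow_right (by omega) (by omega))

theorem wp_lookup (ly : Layout P n κ l w μ L S) {t c X Y : ℕ} (ht : t ≤ l) (hcL : c ≤ L)
    (hcd : c ≤ P.δ + t + 1) (hc : c = L ∨ c = P.δ + t + 1) (hX : X ≤ 2 * words P l L + 2)
    {σ : NatState} (hr : AtLevel P n κ l w μ L t c X Y σ) {v u f acc : ℕ} (hv : v < 2 ^ (l - t))
    (hu : u < 2 ^ (P.δ + t + 1 - c)) (hf : f < 2 ^ (P.δ + t)) (h24 : σ.reg 24 = v)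
    (h25 : σ.reg 25 = u) (h26 : σ.reg 26 = f) (h27 : σ.reg 27 = acc) (h28 : σ.reg 28 = P.cut f) :
    WP S w (lookupProg P.γ) 1000 (fun σ' => (∀ r < 27, σ'.reg r = σ.reg r) ∧
      σ'.reg 27 = acc ^^^ (σ.mem (2 * words P l L + 2 + place P μ L t c X σ.mem v u f / 2 ^ (L - c)) >>>
        (place P μ L t c X σ.mem v u f % 2 ^ (L - c) * 2 ^ (c + μ))) ∧
      σ'.reg 28 = P.cut (f + 1) ∧ σ'.mem = σ.mem ∧ σ'.inp = σ.inp ∧ σ'.out = σ.out) σ := by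
  have hw := ly.w_pos
  have h2 := ly.words_le
  have hS := ly.S_eq
  have hwd := ly.width
  have hδ := ly.δ_eq
  have hd0 := Nat.two_pow_pos (P.δ + t)
  have hvf : (v + v) * 2 ^ (P.δ + t) + f + 2 ^ (P.δ + t) < 2 ^ (P.δ + l + 1) := by
    have e : 2 ^ (P.δ + l + 1) = 2 ^ (l - t) * 2 ^ (P.δ + t) * 2 := by
      rw [← pow_add, ← pow_succ]; congr 1; omega
    have h1 : (v + 1) * 2 ^ (P.δ + t) ≤ 2 ^ (l - t) * 2 ^ (P.δ + t) := Nat.mul_le_mul_right _ hv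
    rw [e]
    nlinarith
  have hw1 : 2 ^ (P.δ + l + 1) < 2 ^ w := ly.pow_lt (by omega)
  have hQ1 : 2 ^ (P.δ + l + 1) ≤ 2 ^ (P.M + 2 * P.δ + 2 * l + 2) :=
    Nat.pow_le_pow_right (by omega) (by omega)
  have hvv : v + v ≤ (v + v) * 2 ^ (P.δ + t) := Nat.le_mul_of_pos_right _ hd0
  have hfM : 2 ^ P.M < 2 ^ w := ly.pow_lt (by omega)
  refine wp_let hw ((((Ev.var h24).add (Ev.var h24) (by omega)).mul (Ev.var hr.r17) (by omega)).add
    (Ev.var h26) (by omega)) ?_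
  have hr1 := hr.setReg (d := 29) (v := (v + v) * 2 ^ (P.δ + t) + f)
  refine wp_cons_of (wp_readField ly hr1.toReady hr1.r14 (NatState.reg_setReg _ _ _ _) hX
    (by simp; omega) (by decide) (by decide) (by decide) (by decide) (by decide)) ?_
  rintro _ rfl
  refine wp_let hw (Ev.add (Ev.var rfl) (Ev.var hr.r21) ?_) ?_
  · simp; omega
  simp only [NatState.mem_setReg, NatState.reg_setReg, reduceIte, Nat.reduceEqDiff]
  set U := fieldAt P.M μ L σ.mem X ((v + v) * 2 ^ (P.δ + t) + f) with hU
  have hr2 := (hr1.setReg (d := 30) (v := U)).setReg (d := 31)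
    (v := (v + v) * 2 ^ (P.δ + t) + f + 2 ^ (P.δ + t))
  refine wp_cons_of (wp_readField ly hr2.toReady hr2.r14 (NatState.reg_setReg _ _ _ _) hX
    (by simp; omega) (by decide) (by decide) (by decide) (by decide) (by decide)) ?_
  rintro _ rfl
  simp only [NatState.mem_setReg, NatState.reg_setReg, reduceIte]
  set V := fieldAt P.M μ L σ.mem X ((v + v) * 2 ^ (P.δ + t) + f + 2 ^ (P.δ + t)) with hV
  have hUlt : U < 2 ^ P.M := fieldAt_lt _ _ _ _ _ _
  have hVlt : V < 2 ^ P.M := fieldAt_lt _ _ _ _ _ _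
  have hkey : comb (P.cut f) U V = key P μ L t X σ.mem v f := by
    unfold key
    rw [hU, hV]
    congr 2 <;> ring
  have hcomb := comb_lt (a := P.cut f) hUlt hVlt
  have hVmul : V / 2 ^ P.cut f * 2 ^ P.cut f ≤ V := Nat.div_mul_le_self _ _
  refine wp_let (v := key P μ L t X σ.mem v f) hw (Ev.cast (Ev.add (Ev.low hw (Ev.var (v := U) rfl) (Ev.var h28)
    (hUlt.trans hfM)) (Ev.mul (Ev.div (Ev.var (v := V) rfl) (Ev.var h28)) (Ev.var h28)
      ((hVmul.trans_lt hVlt).trans hfM)) (hcomb.trans hfM)) hkey) ?_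
  have hk := key_lt (P := P) (μ := μ) (L := L) t X σ.mem v f
  set I := key P μ L t X σ.mem v f with hI
  have hz : place P μ L t c X σ.mem v u f < 2 ^ (P.M + 2 * P.δ + 2 * t + 2 - c) :=
    place_lt hcd hu hf
  obtain ⟨hz1, hz2⟩ := ly.place_lt_pow ht hcL hcd hc hz
  have hplace : place P μ L t c X σ.mem v u f =
    ((2 ^ (P.δ + t) + f) * 2 ^ P.M + I) * 2 ^ (P.δ + t + 1 - c) + u := rfl
  set z := place P μ L t c X σ.mem v u f with hzdef
  have hb2 : ((2 ^ (P.δ + t) + f) * 2 ^ P.M + I) ≤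
      ((2 ^ (P.δ + t) + f) * 2 ^ P.M + I) * 2 ^ (P.δ + t + 1 - c) :=
    Nat.le_mul_of_pos_right _ (Nat.two_pow_pos _)
  have hb3 : 2 ^ (P.δ + t) + f ≤ (2 ^ (P.δ + t) + f) * 2 ^ P.M :=
    Nat.le_mul_of_pos_right _ (Nat.two_pow_pos _)
  refine wp_let hw (Ev.mul (Ev.add (Ev.mul (Ev.add (Ev.var hr.r21) (Ev.var h26) (by omega)) (Ev.var hr.r6)
    (by omega)) (Ev.var (v := I) rfl) (by omega)) (Ev.var hr.r19) (by omega)) ?_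
  refine wp_let (v := z) hw (Ev.add (Ev.var rfl) (Ev.var h25) hz1) ?_
  have hsw := chunk_shift_le (χ := z) hcL ly.pack hw
  have hsh := ly.shift_le
  refine wp_read hw (Ev.add (Ev.var hr.r8) (Ev.div (Ev.var (v := z) rfl) (Ev.var hr.r20)) (by omega))
    (by omega) ?_
  simp only [NatState.mem_setReg]
  refine wp_let hw (Ev.xor (Ev.var h27) (Ev.shr (Ev.var rfl) (Ev.mul (Ev.low hw (Ev.var (v := z) rfl)
    (Ev.var hr.r20) hz1) (Ev.add (Ev.var hr.r18) (Ev.var hr.r4) (small_lt (by omega)))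
    (small_lt hsw.le)))) ?_
  simp only [NatState.reg_setReg, reduceIte]
  have hγ : (2 : ℕ) ^ P.γ < 2 ^ w := ly.pow_lt (by omega)
  have hγw : P.γ < 2 ^ w := small_lt (by omega)
  have hf1 : f + 1 < 2 ^ w := by omega
  have hcut := ly.cut_lt (f + 1)
  have hcs := cut_succ (P := P) f
  refine wp_cons_of (wp_cond (B' := 100) (Q := fun σ' => (∀ r < 27, σ'.reg r = σ.reg r) ∧
      σ'.reg 27 = acc ^^^ (σ.mem (2 * words P l L + 2 + z / 2 ^ (L - c)) >>>
        (z % 2 ^ (L - c) * 2 ^ (c + μ))) ∧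
      σ'.reg 28 = P.cut (f + 1) ∧ σ'.mem = σ.mem ∧ σ'.inp = σ.inp ∧ σ'.out = σ.out)
    hw (Ev.low hw (Ev.add (Ev.var h26) (Ev.num (k := 1) (by omega)) hf1) (Ev.lit hγw) hf1) ?_ ?_)
    fun σ' h => wp_nil h
  · intro hne
    rw [if_neg hne] at hcs
    refine wp_let hw (Ev.add (Ev.var h28) (Ev.var hr.r7) (by omega)) (wp_nil ⟨fun r hr => ?_, rfl, ?_, rfl, rfl, rfl⟩)
    · simp only [NatState.reg_setReg]
      repeat rw [if_neg (by omega)]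
    · exact hcs.symm
  · intro h0
    rw [if_pos h0] at hcs
    refine wp_let hw (Ev.add (Ev.add (Ev.var hr.r7) (Ev.var hr.r7) (by omega)) (Ev.num (k := 8) (by omega)) (by omega))
      (wp_nil ⟨fun r hr => ?_, rfl, ?_, rfl, rfl, rfl⟩)
    · simp only [NatState.reg_setReg]
      repeat rw [if_neg (by omega)]
    · exact hcs.symm

end Tabulation

/-! ### One level of the recursion -/

namespace Tabulation

open WordRAM

variable {P : Params} {n κ l w μ L S : ℕ}

/-- The part of a table word from which block `u` of the entry in table `f` starts. -/
def lookupWord (P : Params) (l μ L t c X : ℕ) (mem : ℕ → ℕ) (v u f : ℕ) : ℕ :=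
  mem (2 * words P l L + 2 + place P μ L t c X mem v u f / 2 ^ (L - c)) >>>
    (place P μ L t c X mem v u f % 2 ^ (L - c) * 2 ^ (c + μ))

theorem wp_lookups (ly : Layout P n κ l w μ L S) {t c X Y : ℕ} (ht : t ≤ l) (hcL : c ≤ L)
    (hcd : c ≤ P.δ + t + 1) (hc : c = L ∨ c = P.δ + t + 1) (hX : X ≤ 2 * words P l L + 2)
    {σ : NatState} (hr : AtLevel P n κ l w μ L t c X Y σ) {v u : ℕ} (hv : v < 2 ^ (l - t))
    (hu : u < 2 ^ (P.δ + t + 1 - c)) (h24 : σ.reg 24 = v)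
    (h25 : σ.reg 25 = u) (h27 : σ.reg 27 = 0) (h28 : σ.reg 28 = P.cut 0) :
    WP S w (forE 26 21 (lookupProg P.γ)) (2 ^ (P.δ + t) * 1015 + 20)
      (fun σ' => (∀ r < 26, σ'.reg r = σ.reg r) ∧
      σ'.reg 27 = xsum (2 ^ (P.δ + t)) (lookupWord P l μ L t c X σ.mem v u) ∧
      σ'.mem = σ.mem ∧ σ'.inp = σ.inp ∧ σ'.out = σ.out) σ := by
  have hd : 2 ^ (P.δ + t) < 2 ^ w := ly.pow_lt (by omega)
  refine wp_for ly.w_pos (fun f σ' => (∀ r < 26, σ'.reg r = σ.reg r) ∧ σ'.reg 26 = f ∧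
    σ'.reg 27 = xsum f (lookupWord P l μ L t c X σ.mem v u) ∧ σ'.reg 28 = P.cut f ∧
    σ'.mem = σ.mem ∧ σ'.inp = σ.inp ∧ σ'.out = σ.out) (fun _ => 1000) hd ?_ ?_ ?_ ?_ (by simp)
  · rintro f σ' ⟨h1, h2, -⟩
    exact ⟨h2, (h1 21 (by omega)).trans hr.r21⟩
  · refine ⟨fun r hr => ?_, rfl, h27, h28, rfl, rfl, rfl⟩
    rw [NatState.reg_setReg, if_neg (by omega)]
  · rintro f hf σ' ⟨h1, h2, h3, h4, h5, h6, h7⟩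
    refine (wp_lookup ly ht hcL hcd hc hX (hr.congr h1) hv hu hf ((h1 24 (by omega)).trans h24)
      ((h1 25 (by omega)).trans h25) h2 h3 h4).mono le_rfl ?_
    rintro σ'' ⟨g1, g2, g3, g4, g5, g6⟩
    refine ⟨(g1 26 (by omega)).trans h2, fun r hr => ?_, rfl, ?_, g3, g4.trans h5, g5.trans h6,
      g6.trans h7⟩
    · rw [NatState.reg_setReg, if_neg (by omega), g1 r (by omega), h1 r hr]
    · rw [NatState.reg_setReg, if_neg (by omega), g2, h5]
      rfl
  · rintro σ' ⟨h1, h2, h3, h4, h5⟩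
    exact ⟨h1, h3, h5⟩

theorem Layout.block_lt (ly : Layout P n κ l w μ L S) {t c χ : ℕ} (ht : t ≤ l) (hcL : c ≤ L)
    (hcd : c ≤ P.δ + t + 1) (hχ : χ < 2 ^ (l - t) * 2 ^ (P.δ + t + 1 - c)) :
    χ < 2 ^ w ∧ χ / 2 ^ (L - c) < words P l L := by
  rw [← pow_add] at hχ
  constructor
  · exact hχ.trans (ly.pow_lt (by omega))
  · have := ly.L_le
    rw [Nat.div_lt_iff_lt_mul (Nat.two_pow_pos _), words, ← pow_add]
    exact hχ.trans_le (Nat.pow_le_pow_right (by omega) (by omega))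

theorem wp_chunk (ly : Layout P n κ l w μ L S) {t c X Y : ℕ} (ht : t ≤ l) (hcL : c ≤ L)
    (hcd : c ≤ P.δ + t + 1) (hc : c = L ∨ c = P.δ + t + 1) (hX : X ≤ 2 * words P l L + 2)
    (hY : Y ≤ 2 * words P l L + 2) {σ : NatState} (hr : AtLevel P n κ l w μ L t c X Y σ) {χ : ℕ}
    (hχ : χ < 2 ^ (l - t) * 2 ^ (P.δ + t + 1 - c)) (h23 : σ.reg 23 = χ) :
    WP S w (chunkProg P.γ) (2 ^ (P.δ + t) * 1015 + 600)
      (fun σ' => (∀ r < 24, σ'.reg r = σ.reg r) ∧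
      σ'.mem = Function.update σ.mem (Y + χ / 2 ^ (L - c)) (spliced w (σ.mem (Y + χ / 2 ^ (L - c)))
        (xsum (2 ^ (P.δ + t)) (lookupWord P l μ L t c X σ.mem (χ / 2 ^ (P.δ + t + 1 - c))
          (χ % 2 ^ (P.δ + t + 1 - c)))) (χ % 2 ^ (L - c) * 2 ^ (c + μ))) ∧
      σ'.inp = σ.inp ∧ σ'.out = σ.out) σ := by
  have hw := ly.w_pos
  have hχv : χ / 2 ^ (P.δ + t + 1 - c) < 2 ^ (l - t) := by
    rwa [Nat.div_lt_iff_lt_mul (Nat.two_pow_pos _)]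
  have hχu : χ % 2 ^ (P.δ + t + 1 - c) < 2 ^ (P.δ + t + 1 - c) := Nat.mod_lt _ (Nat.two_pow_pos _)
  obtain ⟨hχw, hχN⟩ := ly.block_lt ht hcL hcd hχ
  have hcut : P.e + P.e + 8 = P.cut 0 := by unfold Params.cut; rw [Nat.zero_mod]; ring
  have hcw := ly.cut_lt 0
  refine wp_let hw (Ev.div (Ev.var h23) (Ev.var hr.r19)) ?_
  refine wp_let hw (Ev.low hw (Ev.var h23) (Ev.var hr.r19) hχw) ?_
  refine wp_let hw (Ev.num (k := 0) (Nat.two_pow_pos w)) ?_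
  refine wp_let hw (Ev.add (Ev.add (Ev.var hr.r7) (Ev.var hr.r7) (by omega))
    (Ev.num (k := 8) (by omega)) (by omega)) ?_
  rw [hcut]
  have hr' := (((hr.setReg (d := 24) (v := χ / 2 ^ (P.δ + t + 1 - c))).setReg (d := 25)
    (v := χ % 2 ^ (P.δ + t + 1 - c))).setReg (d := 27) (v := 0)).setReg (d := 28) (v := P.cut 0)
  refine wp_cons_of (wp_lookups ly ht hcL hcd hc hX hr' hχv hχu rfl rfl rfl rfl) ?_
  rintro σ' ⟨h1, h2, h3, h4, h5⟩
  simp only [NatState.mem_setReg, NatState.inp_setReg, NatState.out_setReg] at h2 h3 h4 h5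
  have hr2 := hr'.congr h1
  have h23' : σ'.reg 23 = χ := (h1 23 (by omega)).trans h23
  refine wp_cons_of (wp_writeChunk ly hr2.toReady hr2.r18 hr2.r20 hr2.r15 h23' h2 hcL hY hχN hχw
    (by decide) (by decide) (by decide)) ?_
  rintro σ'' ⟨g1, g2, g3, g4⟩
  refine wp_nil ⟨fun r hr => ?_, ?_, g3.trans h4, g4.trans h5⟩
  · rw [g1 r (by omega), h1 r (by omega)]
    simp only [NatState.reg_setReg]
    repeat rw [if_neg (by omega)]
  · rw [g2, h3]

/-- Field `a` of the buffer after level `t`. -/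
def levelField (P : Params) (l μ L t X : ℕ) (mem : ℕ → ℕ) (a : ℕ) : ℕ :=
  out P (fieldAt P.M μ L mem (2 * words P l L + 2)) t (key P μ L t X mem (a / 2 ^ (P.δ + t + 1)))
    (a % 2 ^ (P.δ + t + 1))

/-- Connects the word operations with the abstract hash function: fields of the XOR of the shifted
table words are fields of `out`. -/
theorem lookupWord_field {t c X : ℕ} (hcL : c ≤ L)
    (hcd : c ≤ P.δ + t + 1) (mem : ℕ → ℕ) (χ : ℕ) {g : ℕ} (hg : g < 2 ^ c) :
    (xsum (2 ^ (P.δ + t)) (lookupWord P l μ L t c X mem (χ / 2 ^ (P.δ + t + 1 - c))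
      (χ % 2 ^ (P.δ + t + 1 - c))) >>> (g * 2 ^ μ)) % 2 ^ P.M
      = levelField P l μ L t X mem (χ * 2 ^ c + g) := by
  rw [xsum_shiftRight_mod]
  unfold levelField out
  rw [chunk_div hcd hg, chunk_mod hcd hg]
  refine xsum_congr fun f _ => ?_
  unfold lookupWord
  rw [read_chunk hcL hg]
  congr 1
  unfold place cell
  rw [show 2 ^ (P.δ + t + 1) = 2 ^ (P.δ + t + 1 - c) * 2 ^ c by rw [← pow_add]; congr 1; omega]
  ring

theorem key_congr (ly : Layout P n κ l w μ L S) {t X v f : ℕ} {mem mem' : ℕ → ℕ} (ht : t ≤ l)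
    (h : ∀ a, X ≤ a → a < X + words P l L → mem a = mem' a) (hv : v < 2 ^ (l - t))
    (hf : f < 2 ^ (P.δ + t)) : key P μ L t X mem v f = key P μ L t X mem' v f := by
  have key : ∀ b < 2, fieldAt P.M μ L mem X ((2 * v + b) * 2 ^ (P.δ + t) + f) =
      fieldAt P.M μ L mem' X ((2 * v + b) * 2 ^ (P.δ + t) + f) := by
    intro b hb
    refine fieldAt_congr (h _ (Nat.le_add_right _ _) (Nat.add_lt_add_left (ly.div_lt_words ?_) _))
    have e : 2 ^ (P.δ + l + 1) = 2 ^ (l - t) * 2 ^ (P.δ + t) * 2 := by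
      rw [← pow_add, ← pow_succ]; congr 1; omega
    have h1 : (v + 1) * 2 ^ (P.δ + t) ≤ 2 ^ (l - t) * 2 ^ (P.δ + t) := Nat.mul_le_mul_right _ hv
    have h2 : b * 2 ^ (P.δ + t) ≤ 1 * 2 ^ (P.δ + t) := Nat.mul_le_mul_right _ (by omega)
    have hQ1 : 2 ^ (P.δ + l + 1) ≤ 2 ^ (P.M + 2 * P.δ + 2 * l + 2) :=
      Nat.pow_le_pow_right (by omega) (by omega)
    nlinarith
  have h0 := key 0 (by omega)
  rw [add_zero] at h0
  unfold Tabulation.key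
  rw [h0, key 1 (by omega)]

/-- A level reads only the buffer at `X` and the tables. Writes into the other buffer therefore
leave the target values fixed, and the loop invariant can refer to the memory at the start of the
level. -/
theorem levelField_congr (ly : Layout P n κ l w μ L S) {t X a : ℕ} {mem mem' : ℕ → ℕ} (ht : t ≤ l)
    (h : ∀ a, X ≤ a → a < X + words P l L → mem a = mem' a)
    (hT : ∀ a, 2 * words P l L + 2 ≤ a → mem a = mem' a)
    (ha : a < 2 ^ (l - t) * 2 ^ (P.δ + t + 1)) :
    levelField P l μ L t X mem a = levelField P l μ L t X mem' a := by
  have hv : a / 2 ^ (P.δ + t + 1) < 2 ^ (l - t) := by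
    rwa [Nat.div_lt_iff_lt_mul (Nat.two_pow_pos _)]
  unfold levelField
  rw [show fieldAt P.M μ L mem (2 * words P l L + 2) = fieldAt P.M μ L mem' (2 * words P l L + 2)
    from funext fun b => fieldAt_congr (hT _ (Nat.le_add_right _ _))]
  exact out_congr_index (fun f hf => key_congr ly ht h hv hf) _

/-- What has to hold for the two buffers at `X` and `Y`. -/
structure Buffers (P : Params) (l L X Y : ℕ) : Prop where
  le_X : 2 ≤ X
  le_Y : 2 ≤ Y
  X_le : X + words P l L ≤ 2 * words P l L + 2
  Y_le : Y + words P l L ≤ 2 * words P l L + 2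
  disj : X + words P l L ≤ Y ∨ Y + words P l L ≤ X

theorem wp_chunks (ly : Layout P n κ l w μ L S) {t c X Y : ℕ} (ht : t ≤ l) (hcL : c ≤ L)
    (hcd : c ≤ P.δ + t + 1) (hc : c = L ∨ c = P.δ + t + 1) (hXY : Buffers P l L X Y)
    {σ : NatState} (hr : AtLevel P n κ l w μ L t c X Y σ) :
    WP S w (forE 23 22 (chunkProg P.γ))
      (2 ^ (l - t) * 2 ^ (P.δ + t + 1 - c) * (2 ^ (P.δ + t) * 1015 + 615) + 20)
      (fun σ' => (∀ r < 23, σ'.reg r = σ.reg r) ∧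
        (∀ a, ¬ (Y ≤ a ∧ a < Y + words P l L) → σ'.mem a = σ.mem a) ∧
        (∀ a < 2 ^ (l - t) * 2 ^ (P.δ + t + 1),
          fieldAt P.M μ L σ'.mem Y a = levelField P l μ L t X σ.mem a) ∧
        σ'.inp = σ.inp ∧ σ'.out = σ.out) σ := by
  have hqw : 2 ^ (l - t) * 2 ^ (P.δ + t + 1 - c) < 2 ^ w := by
    rw [← pow_add]
    exact ly.pow_lt (by omega)
  have hcount : 2 ^ (l - t) * 2 ^ (P.δ + t + 1 - c) * 2 ^ c = 2 ^ (l - t) * 2 ^ (P.δ + t + 1) := by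
    rw [mul_assoc, ← pow_add, Nat.sub_add_cancel hcd]
  have hX := hXY.X_le
  have hY := hXY.Y_le
  have hdisj := hXY.disj
  refine wp_for ly.w_pos (fun χ σ' => (∀ r < 23, σ'.reg r = σ.reg r) ∧ σ'.reg 23 = χ ∧
    (∀ a, ¬ (Y ≤ a ∧ a < Y + words P l L) → σ'.mem a = σ.mem a) ∧
    (∀ a < χ * 2 ^ c, fieldAt P.M μ L σ'.mem Y a = levelField P l μ L t X σ.mem a) ∧
    σ'.inp = σ.inp ∧ σ'.out = σ.out) (fun _ => 2 ^ (P.δ + t) * 1015 + 600) hqw ?_ ?_ ?_ ?_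
    (by simp)
  · rintro χ σ' ⟨h1, h2, -⟩
    exact ⟨h2, (h1 22 (by omega)).trans hr.r22⟩
  · refine ⟨fun r hr => ?_, rfl, fun _ _ => rfl, by simp, rfl, rfl⟩
    rw [NatState.reg_setReg, if_neg (by omega)]
  · rintro χ hχ σ' ⟨h1, h2, h3, h4, h5, h6⟩
    refine (wp_chunk ly ht hcL hcd hc (by omega) (by omega) (hr.congr h1) hχ h2).mono le_rfl ?_
    rintro σ'' ⟨g1, g2, g3, g4⟩
    obtain ⟨hχw, hχN⟩ := ly.block_lt ht hcL hcd hχ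
    refine ⟨(g1 23 (by omega)).trans h2, fun r hr => ?_, rfl, fun a ha => ?_, fun a ha => ?_,
      g3.trans h5, g4.trans h6⟩
    · rw [NatState.reg_setReg, if_neg (by omega), g1 r (by omega), h1 r hr]
    · rw [NatState.mem_setReg, g2, Function.update_of_ne, h3 a ha]
      rintro rfl
      exact ha ⟨Nat.le_add_right _ _, Nat.add_lt_add_left hχN _⟩
    · rw [NatState.mem_setReg, g2]
      by_cases hlow : a < χ * 2 ^ c
      · rw [write_chunk_lower hcL ly.M_le ly.M_le_w ly.pack _ _ _ hlow, h4 a hlow]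
      · obtain ⟨g, rfl⟩ := Nat.exists_eq_add_of_le (not_lt.1 hlow)
        rw [add_mul, one_mul] at ha
        have hg : g < 2 ^ c := by omega
        rw [write_chunk_new hcL ly.M_le ly.M_le_w ly.pack _ _ _ hg, lookupWord_field hcL hcd _ _ hg]
        refine levelField_congr ly ht (fun a _ _ => h3 a (by omega)) (fun a _ => h3 a (by omega)) ?_
        rw [← hcount]
        have := Nat.mul_le_mul_right (2 ^ c) hχ
        rw [Nat.succ_mul] at this
        omega
  · rintro σ' ⟨h1, h2, h3, h4, h5⟩
    rw [hcount] at h4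
    exact ⟨h1, h3, h4, h5⟩

theorem wp_level (ly : Layout P n κ l w μ L S) {t X Y : ℕ} (ht : t ≤ l) (hXY : Buffers P l L X Y)
    {σ : NatState} (hr : Ready P n κ l w μ L σ) (h14 : σ.reg 14 = X) (h15 : σ.reg 15 = Y)
    (h16 : σ.reg 16 = t) :
    WP S w (levelProg P.γ P.δ)
      (2 ^ (l - t) * 2 ^ (P.δ + t + 1 - min L (P.δ + t + 1)) * (2 ^ (P.δ + t) * 1015 + 615) + 900)
      (fun σ' => Ready P n κ l w μ L σ' ∧ σ'.reg 14 = Y ∧ σ'.reg 15 = X ∧ σ'.reg 16 = t ∧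
        (∀ a, ¬ (Y ≤ a ∧ a < Y + words P l L) → σ'.mem a = σ.mem a) ∧
        (∀ a < 2 ^ (l - t) * 2 ^ (P.δ + t + 1),
          fieldAt P.M μ L σ'.mem Y a = levelField P l μ L t X σ.mem a) ∧
        σ'.inp = σ.inp ∧ σ'.out = σ.out) σ := by
  have hw := ly.w_pos
  have hwd := ly.width
  have hsh := ly.shift_le
  have hww : w < 2 ^ w := Nat.lt_two_pow_self
  have hP : P.δ < 2 ^ w := by omega
  set c := min L (P.δ + t + 1) with hc
  have hqw : 2 ^ (l - t) * 2 ^ (P.δ + t + 1 - c) < 2 ^ w := by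
    rw [← pow_add]
    exact ly.pow_lt (by omega)
  refine wp_let hw (Ev.cast (Ev.add (Ev.var h16) (Ev.lit hP) (by omega)) (add_comm _ _)) ?_
  have hr1 := hr.setReg (d := 17) (v := P.δ + t)
  refine wp_cons_of (wp_cond (B' := 100)
    (Q := fun σ' => σ' = (σ.setReg 17 (P.δ + t)).setReg 18 c) hw
    (Ev.less (Ev.add (Ev.var (v := P.δ + t) rfl) (Ev.num (k := 1) (by omega)) (by omega))
      (Ev.var hr.r5)) ?_ ?_) ?_
  · intro h
    have : P.δ + t + 1 < L := by by_contra h'; exact h (if_neg h')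
    refine wp_let hw (Ev.cast (v' := c) (Ev.add (Ev.var (v := P.δ + t) rfl)
      (Ev.num (k := 1) (by omega)) (by omega)) (by omega)) (wp_nil rfl)
  · intro h
    have : ¬ P.δ + t + 1 < L := fun h' => by rw [if_pos h'] at h; omega
    exact wp_let hw (Ev.cast (v' := c) (Ev.var hr.r5) (by omega)) (wp_nil rfl)
  rintro _ rfl
  refine wp_let hw (Ev.sub (Ev.add (Ev.var (v := P.δ + t) rfl) (Ev.num (k := 1) (by omega))
    (by omega)) (Ev.var (v := c) rfl) (by omega) (by omega)) ?_
  refine wp_let hw (Ev.sub (Ev.var hr.r5) (Ev.var (v := c) rfl) (by omega) (by omega)) ?_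
  refine wp_let hw (Ev.pow hw (Ev.var (v := P.δ + t) rfl) (by omega)) ?_
  refine wp_let hw (Ev.mul (Ev.pow hw (Ev.sub (Ev.var hr.r0) (Ev.var h16) (by omega) (by omega))
    (by omega)) (Ev.var (v := P.δ + t + 1 - c) rfl) hqw) ?_
  set σ1 := (((((σ.setReg 17 (P.δ + t)).setReg 18 c).setReg 19 (P.δ + t + 1 - c)).setReg 20
    (L - c)).setReg 21 (2 ^ (P.δ + t))).setReg 22 (2 ^ (l - t) * 2 ^ (P.δ + t + 1 - c)) with hσ1
  have hA : AtLevel P n κ l w μ L t c X Y σ1 :=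
    { toReady := (((((hr.setReg (d := 17)).setReg (d := 18)).setReg (d := 19)).setReg
        (d := 20)).setReg (d := 21)).setReg (d := 22)
      r14 := h14, r15 := h15, r16 := h16, r17 := rfl, r18 := rfl, r19 := rfl, r20 := rfl
      r21 := rfl, r22 := rfl }
  refine wp_cons_of (wp_chunks ly ht (by omega) (by omega) (by omega) hXY hA) ?_
  rintro σ' ⟨h1, h2, h3, h4, h5⟩
  have hA' := hA.congr h1
  refine wp_let hw (Ev.var hA'.r14) ?_
  refine wp_let hw (Ev.var hA'.r15) ?_
  refine wp_let hw (Ev.var rfl) ?_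
  exact wp_nil ⟨((hA'.toReady.setReg (d := 36)).setReg (d := 14)).setReg (d := 15), rfl, rfl,
    hA'.r16, h2, h3, h4, h5⟩

end Tabulation

/-! ### Setup of a query and loading of its input -/

namespace Tabulation

open WordRAM

variable {P : Params} {n κ l w μ L S : ℕ}

theorem Layout.two_mul_le (ly : Layout P n κ l w μ L S) : 2 * w ≤ 2 ^ w := by
  have hw := ly.w_pos
  obtain ⟨k, rfl⟩ : ∃ k, w = k + 1 := ⟨w - 1, by omega⟩
  have := Nat.lt_two_pow_self (n := k)
  rw [pow_succ]
  omega

theorem wp_setup (ly : Layout P n κ l w μ L S) {σ : NatState} (h0 : σ.reg 0 = l) (h1 : σ.reg 1 = n)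
    (h2 : σ.reg 2 = κ) (h3 : σ.reg 3 = w) (hμ : σ.mem 0 = μ) (hL : σ.mem 1 = L) :
    WP S w (setupProg P.δ) 1000 (fun σ' => Ready P n κ l w μ L σ' ∧ σ'.reg 14 = 2 ∧
      σ'.reg 15 = words P l L + 2 ∧ σ'.mem = σ.mem ∧ σ'.inp = σ.inp ∧ σ'.out = σ.out) σ := by
  have hw := ly.w_pos
  have hwd := ly.width
  have hsh := ly.shift_le
  have hww := ly.two_mul_le
  have hM := ly.M_eq
  have hS := ly.S_eq
  have hN := ly.words_le
  have hLle := ly.L_le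
  have hδ : 2 * P.δ + 2 < 2 ^ w := by
    have h := ly.pow_lt (k := P.δ + 2) (by omega)
    have := Nat.lt_two_pow_self (n := P.δ + 1)
    rw [pow_succ] at h
    rw [pow_succ] at h
    rw [pow_succ] at this
    omega
  -- The shift that produces `words` must not overflow; this follows from the space being
  -- addressable.
  have hQ : P.M + (2 * P.δ + 2) + l + l - L < w := by
    by_contra h
    have : 2 ^ w ≤ words P l L := Nat.pow_le_pow_right (by omega) (by omega)
    omega
  have hw1 : 1 < 2 ^ w := by omega
  have hMw : 2 ^ P.M < 2 ^ w := ly.pow_lt (by omega)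
  have hQ' : P.M + (2 * P.δ + 2) + l + l < 2 ^ w := by omega
  refine wp_read hw (Ev.num (k := 0) (by omega)) (by omega) ?_
  refine wp_read hw (Ev.num (k := 1) (by omega)) (by omega) ?_
  rw [NatState.mem_setReg, hμ, hL]
  refine wp_let (v := P.M) hw (Ev.cast (Ev.add (Ev.add (Ev.var h1) (Ev.var h2) (by omega))
    (Ev.num (k := 20) (by omega)) (by omega)) hM.symm) ?_
  refine wp_let (v := P.e) hw (Ev.cast (Ev.add (Ev.div (Ev.var h1) (Ev.num (k := 2) (by omega)))
    (Ev.num (k := 1) (by omega)) (by omega)) (by rw [ly.e_eq]; rfl)) ?_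
  refine wp_let (v := words P l L) hw (Ev.cast (Ev.pow hw (Ev.sub (Ev.add (Ev.add (Ev.add
    (Ev.var rfl) (Ev.lit hδ) (by simp; omega)) (Ev.var h0) (by simp; omega)) (Ev.var h0)
    (by simp; omega)) (Ev.var rfl) (by simp; omega) (by simp; omega)) (by simp; omega))
    (by simp only [NatState.reg_setReg, reduceIte]; unfold words; congr 1; simp; omega)) ?_
  refine wp_let hw (Ev.num (k := 2) (by omega)) ?_
  refine wp_let hw (Ev.add (Ev.var (v := words P l L) rfl) (Ev.num (k := 2) (by omega)) (by omega)) ?_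
  refine wp_let (v := 2 * words P l L + 2) hw (Ev.cast (Ev.add (Ev.add
    (Ev.var (v := words P l L) rfl) (Ev.var (v := words P l L) rfl) (by omega))
    (Ev.num (k := 2) (by omega)) (by omega)) (by omega)) ?_
  refine wp_let hw (Ev.mask hw (Ev.var (v := P.M) rfl) (by omega)) ?_
  refine wp_let hw (Ev.mask hw (Ev.var (v := L) rfl) (by
    by_contra h
    have h0 : L = w := by have := ly.M_eq; omega
    have hp : 0 < L := by omega
    have h1 := ly.pack hp
    have h2 : w < 2 ^ (L + μ) := h0 ▸ Nat.lt_two_pow_self.trans_le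
      (Nat.pow_le_pow_right (by omega) (by omega))
    omega)) ?_
  refine wp_let hw (Ev.add (Ev.add (Ev.var h1) (Ev.var h2) (by omega)) (Ev.num (k := 4) (by omega))
    (by omega)) ?_
  refine wp_let hw (Ev.pow hw (Ev.var h0) (by omega)) ?_
  refine wp_let hw (Ev.add (Ev.var h0) (Ev.num (k := 1) (by omega)) (by omega)) ?_
  exact wp_nil ⟨⟨h0, h1, h2, h3, rfl, rfl, rfl, rfl, rfl, rfl, rfl, rfl, rfl, rfl⟩, rfl, rfl, rfl,
    rfl, rfl⟩

/-- Characters of `n` bits, packed into words of `w` bits. -/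
def PackedNat (w n c : ℕ) (x buf : ℕ → ℕ) : Prop :=
  ∀ i < c, ∀ b < n, (buf ((i * n + b) / w)).testBit ((i * n + b) % w) = (x i).testBit b

theorem div_mod_of_eq {p i r w : ℕ} (h : p = i * w + r) (hr : r < w) : p / w = i ∧ p % w = r := by
  subst h
  rw [mul_comm]
  exact ⟨by rw [Nat.mul_add_div (by omega), Nat.div_eq_of_lt hr, add_zero],
    by rw [Nat.mul_add_mod, Nat.mod_eq_of_lt hr]⟩

/-- As `n ≤ w`, a character lies in at most two consecutive words. For `off = 0` the second word is
shifted by `w` positions and vanishes modulo `2 ^ w`, so no case distinction is needed. -/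
theorem unpack {c : ℕ} {x buf : ℕ → ℕ} (hx : ∀ i, x i < 2 ^ n) (hbuf : ∀ a, buf a < 2 ^ w)
    (h : PackedNat w n c x buf) (hn : n ≤ w) {v i off : ℕ} (hv : v < c)
    (hi : v * n = i * w + off) (hoff : off < w) :
    ((buf i >>> off) ||| (buf (i + 1) <<< (w - off)) % 2 ^ w) % 2 ^ n = x v := by
  apply Nat.eq_of_testBit_eq
  intro b
  rw [Nat.testBit_mod_two_pow]
  by_cases hb : b < n
  · rw [← h v hv b hb, Nat.testBit_or, Nat.testBit_shiftRight, Nat.testBit_mod_two_pow,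
      Nat.testBit_shiftLeft]
    by_cases hlow : off + b < w
    · obtain ⟨e1, e2⟩ := div_mod_of_eq (show v * n + b = i * w + (off + b) by omega) hlow
      rw [e1, e2]
      simp [hb, show ¬ w - off ≤ b by omega]
    · obtain ⟨e1, e2⟩ := div_mod_of_eq
        (show v * n + b = (i + 1) * w + (off + b - w) by rw [add_mul]; omega) (by omega)
      have hz : (buf i).testBit (off + b) = false :=
        Nat.testBit_lt_two_pow ((hbuf i).trans_le (Nat.pow_le_pow_right (by omega) (by omega)))
      rw [e1, e2, hz]
      simp [hb, show w - off ≤ b by omega, show b < w by omega]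
      congr 1
      omega
  · have hz : (x v).testBit b = false :=
      Nat.testBit_lt_two_pow ((hx v).trans_le (Nat.pow_le_pow_right (by omega) (by omega)))
    simp [hb, hz]

theorem word_index_le {v n i w off : ℕ} (h : v * n = i * w + off) (hn : n ≤ w) (hw : 0 < w) :
    i ≤ v := by
  by_contra hc
  have h1 : (v + 1) * w ≤ i * w := Nat.mul_le_mul_right _ (by omega)
  have h2 : v * n ≤ v * w := Nat.mul_le_mul_left _ hn
  rw [add_mul] at h1
  omega

theorem fill_field_lt (ly : Layout P n κ l w μ L S) {a : ℕ} (ha : a < 2 ^ l * 2 ^ (P.δ + 1)) :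
    a < 2 ^ w ∧ a / 2 ^ L < words P l L := by
  rw [← pow_add] at ha
  exact ⟨ha.trans (ly.pow_lt (by omega)),
    ly.div_lt_words (ha.trans_le (Nat.pow_le_pow_right (by omega) (by omega)))⟩

theorem wp_copies (ly : Layout P n κ l w μ L S) {x : ℕ → ℕ} (hx : ∀ i, x i < 2 ^ n) {σ : NatState}
    (hr : Ready P n κ l w μ L σ) {v : ℕ} (hv : v < 2 ^ l) (h14 : σ.reg 14 = 2)
    (h18 : σ.reg 18 = 0) (h19 : σ.reg 19 = v * 2 ^ (P.δ + 1)) (h20 : σ.reg 20 = L)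
    (h21 : σ.reg 21 = 2 ^ (P.δ + 1)) (h23 : σ.reg 23 = x v)
    (hf : ∀ a < v * 2 ^ (P.δ + 1), fieldAt P.M μ L σ.mem 2 a = x (a / 2 ^ (P.δ + 1))) :
    WP S w (forE 25 21 (block [writeChunk 14 19 23, assign 19 (R 19 + 1)]))
      (2 ^ (P.δ + 1) * 415 + 20) (fun σ' => (∀ r < 25, r ≠ 19 → σ'.reg r = σ.reg r) ∧
        σ'.reg 19 = (v + 1) * 2 ^ (P.δ + 1) ∧
        (∀ a, ¬ (2 ≤ a ∧ a < 2 + words P l L) → σ'.mem a = σ.mem a) ∧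
        (∀ a < (v + 1) * 2 ^ (P.δ + 1), fieldAt P.M μ L σ'.mem 2 a = x (a / 2 ^ (P.δ + 1))) ∧
        σ'.inp = σ.inp ∧ σ'.out = σ.out) σ := by
  have hw := ly.w_pos
  have hD : 2 ^ (P.δ + 1) < 2 ^ w := ly.pow_lt (by omega)
  have hwd := ly.width
  refine wp_for hw (fun k σ' => (∀ r < 25, r ≠ 19 → σ'.reg r = σ.reg r) ∧ σ'.reg 25 = k ∧
      σ'.reg 19 = v * 2 ^ (P.δ + 1) + k ∧
      (∀ a, ¬ (2 ≤ a ∧ a < 2 + words P l L) → σ'.mem a = σ.mem a) ∧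
      (∀ a < v * 2 ^ (P.δ + 1) + k, fieldAt P.M μ L σ'.mem 2 a = x (a / 2 ^ (P.δ + 1))) ∧
      σ'.inp = σ.inp ∧ σ'.out = σ.out) (fun _ => 400) hD ?_ ?_ ?_ ?_ (by simp)
  · rintro k σ' ⟨h1, h2, -⟩
    exact ⟨h2, (h1 21 (by omega) (by omega)).trans h21⟩
  · refine ⟨fun r hr _ => ?_, rfl, h19, fun _ _ => rfl, hf, rfl, rfl⟩
    rw [NatState.reg_setReg, if_neg (by omega)]
  · rintro k hk σ' ⟨g1, g2, g3, g4, g5, g6, g7⟩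
    have hr' := hr.congr (k := 14) fun r hr => g1 r (by omega) (by omega)
    have ha : v * 2 ^ (P.δ + 1) + k < 2 ^ l * 2 ^ (P.δ + 1) := by
      have := Nat.mul_le_mul_right (2 ^ (P.δ + 1)) hv
      rw [Nat.succ_mul] at this
      omega
    obtain ⟨ha1, ha2⟩ := fill_field_lt ly ha
    refine wp_cons_of (wp_writeChunk ly hr' (c := 0) ((g1 18 (by omega) (by omega)).trans h18)
      ((g1 20 (by omega) (by omega)).trans h20) ((g1 14 (by omega) (by omega)).trans h14) g3
      ((g1 23 (by omega) (by omega)).trans h23) (by omega) (by omega) ha2 ha1 (by decide)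
      (by decide) (by decide)) ?_
    rintro σ'' ⟨e1, e2, e3, e4⟩
    have h19' : v * 2 ^ (P.δ + 1) + k + 1 < 2 ^ w := by
      rw [← pow_add] at ha
      have := ly.pow_lt (k := l + (P.δ + 1)) (by omega)
      omega
    refine wp_let hw (Ev.add (Ev.var ((e1 19 (by omega)).trans g3)) (Ev.num (k := 1) (by omega))
      h19') (wp_nil ?_)
    refine ⟨(e1 25 (by omega)).trans g2, fun r hr h => ?_, rfl, rfl, fun a ha => ?_,
      fun a ha => ?_, e3.trans g6, e4.trans g7⟩
    · rw [NatState.reg_setReg, if_neg (by omega), NatState.reg_setReg, if_neg h, e1 r (by omega),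
        g1 r hr h]
    · rw [NatState.mem_setReg, NatState.mem_setReg, e2, Function.update_of_ne, g4 a ha]
      rintro rfl
      exact ha ⟨Nat.le_add_right _ _, Nat.add_lt_add_left ha2 _⟩
    · rw [NatState.mem_setReg, NatState.mem_setReg, e2]
      by_cases hlow : a < v * 2 ^ (P.δ + 1) + k
      · rw [write_chunk_lower (c := 0) (by omega) ly.M_le ly.M_le_w ly.pack _ _ _ (by simpa using hlow),
          g5 a hlow]
      · obtain rfl : a = v * 2 ^ (P.δ + 1) + k := by omega
        have h := write_chunk_new (χ := v * 2 ^ (P.δ + 1) + k) (c := 0) (g := 0) (L := L) (by omega)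
          ly.M_le ly.M_le_w ly.pack σ'.mem 2 (x v) (by simp)
        rw [pow_zero, mul_one, add_zero, zero_mul, Nat.shiftRight_zero,
          Nat.mod_eq_of_lt ((hx v).trans_le (Nat.pow_le_pow_right (by omega)
            (by have := ly.M_eq; omega)))] at h
        rw [(div_mod_of_eq rfl hk).1]
        exact h
  · rintro σ' ⟨h1, h2, h3, h4, h5, h6⟩
    have e : (v + 1) * 2 ^ (P.δ + 1) = v * 2 ^ (P.δ + 1) + 2 ^ (P.δ + 1) := by ring
    rw [e]
    exact ⟨h1, h3, h4, h5, h6⟩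

theorem wp_fill (ly : Layout P n κ l w μ L S) {x : ℕ → ℕ} (hx : ∀ i, x i < 2 ^ n) {σ : NatState}
    (hinp : ∀ a, σ.inp a < 2 ^ w) (hpk : PackedNat w n (2 ^ l) x σ.inp)
    (hr : Ready P n κ l w μ L σ) (h14 : σ.reg 14 = 2) (h15 : σ.reg 15 = words P l L + 2) :
    WP S w (fillProg P.δ) (2 ^ l * (2 ^ (P.δ + 1) * 415 + 600) + 450) (fun σ' =>
        Ready P n κ l w μ L σ' ∧ σ'.reg 14 = 2 ∧ σ'.reg 15 = words P l L + 2 ∧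
        (∀ a, ¬ (2 ≤ a ∧ a < 2 + words P l L) → σ'.mem a = σ.mem a) ∧
        (∀ a < 2 ^ l * 2 ^ (P.δ + 1), fieldAt P.M μ L σ'.mem 2 a = x (a / 2 ^ (P.δ + 1))) ∧
        σ'.inp = σ.inp ∧ σ'.out = σ.out) σ := by
  have hw := ly.w_pos
  have hwd := ly.width
  have hww := ly.two_mul_le
  have hn : n ≤ w := by have := ly.M_eq; omega
  have h0w := Nat.two_pow_pos w
  have hD : 2 ^ (P.δ + 1) < 2 ^ w := ly.pow_lt (by omega)
  have hl : 2 ^ l < 2 ^ w := ly.pow_lt (by omega)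
  refine wp_let hw (Ev.num (k := 0) h0w) ?_
  refine wp_let hw (Ev.num (k := 0) h0w) ?_
  refine wp_let hw (Ev.num (k := 0) h0w) ?_
  refine wp_let hw (Ev.num (k := 0) h0w) ?_
  refine wp_let hw (Ev.var hr.r5) ?_
  refine wp_let hw (Ev.lit hD) ?_
  refine wp_cons (B' := 2 ^ l * (2 ^ (P.δ + 1) * 415 + 600) + 20) ?_
  refine wp_for hw (fun v σ' => (∀ r < 16, σ'.reg r = σ.reg r) ∧ σ'.reg 22 = v ∧
      (∃ i off, σ'.reg 16 = i ∧ σ'.reg 17 = off ∧ v * n = i * w + off ∧ off < w) ∧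
      σ'.reg 18 = 0 ∧ σ'.reg 19 = v * 2 ^ (P.δ + 1) ∧ σ'.reg 20 = L ∧ σ'.reg 21 = 2 ^ (P.δ + 1) ∧
      (∀ a, ¬ (2 ≤ a ∧ a < 2 + words P l L) → σ'.mem a = σ.mem a) ∧
      (∀ a < v * 2 ^ (P.δ + 1), fieldAt P.M μ L σ'.mem 2 a = x (a / 2 ^ (P.δ + 1))) ∧
      σ'.inp = σ.inp ∧ σ'.out = σ.out) (fun _ => 2 ^ (P.δ + 1) * 415 + 585) hl ?_ ?_ ?_ ?_ (by simp)
  · rintro k σ' ⟨h1, h2, -⟩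
    exact ⟨h2, (h1 12 (by omega)).trans hr.r12⟩
  · refine ⟨fun r hr => ?_, rfl, ⟨0, 0, rfl, rfl, by simp, hw⟩, rfl, by simp, rfl, rfl,
      fun _ _ => rfl, by simp, rfl, rfl⟩
    simp only [NatState.reg_setReg]
    repeat rw [if_neg (by omega)]
  · rintro v hv σ' ⟨g1, g2, ⟨i, off, g3, g4, hpos, hoff⟩, g5, g6, g7, g8, g9, g10, g11, g12⟩
    have hr' := hr.congr (k := 16) g1
    have hi := word_index_le hpos hn hw
    refine wp_get hw (Ev.var g3) ?_
    refine wp_get hw (Ev.add (Ev.var g3) (Ev.num (k := 1) (by omega)) (by omega)) ?_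
    have hval := unpack hx hinp hpk hn hv hpos hoff
    rw [← g11] at hval
    refine wp_let (v := x v) hw (Ev.cast (Ev.low hw (Ev.or (Ev.shr (Ev.var (v := σ'.inp i) rfl) (Ev.var g4))
      (Ev.shl (Ev.var (v := σ'.inp (i + 1)) rfl) (Ev.sub (Ev.var hr'.r3) (Ev.var g4) hoff.le
        (by omega)))) (Ev.var hr'.r1) ?_) hval) ?_
    · refine Nat.or_lt_two_pow ?_ (Nat.mod_lt _ h0w)
      rw [Nat.shiftRight_eq_div_pow, g11]
      exact (Nat.div_le_self _ _).trans_lt (hinp i)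
    have hr2 := ((hr'.setReg (d := 23) (v := σ'.inp i)).setReg (d := 24) (v := σ'.inp (i + 1))).setReg
      (d := 23) (v := x v)
    refine wp_cons_of (wp_copies ly hx hr2 hv ((g1 14 (by omega)).trans h14) g5 g6 g7 g8 rfl g10) ?_
    rintro σ2 ⟨e1, e2, e3, e4, e5, e6⟩
    have f17 : σ2.reg 17 = off := (e1 17 (by omega) (by omega)).trans g4
    have f1 : σ2.reg 1 = n := (e1 1 (by omega) (by omega)).trans hr'.r1
    have f3 : σ2.reg 3 = w := (e1 3 (by omega) (by omega)).trans hr'.r3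
    have f16 : σ2.reg 16 = i := (e1 16 (by omega) (by omega)).trans g3
    have hlow : ∀ r < 23, r ≠ 19 → σ2.reg r = σ'.reg r := by
      intro r hr h
      rw [e1 r (by omega) h]
      simp only [NatState.reg_setReg]
      repeat rw [if_neg (by omega)]
    -- Both branches only update the position in the input; the invariant for the next character is
    -- derived once for both.
    have hfin : ∀ σ3 : NatState, (∀ r < 23, r ≠ 16 → r ≠ 17 → σ3.reg r = σ2.reg r) →
        (∃ i off, σ3.reg 16 = i ∧ σ3.reg 17 = off ∧ (v + 1) * n = i * w + off ∧ off < w) →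
        σ3.mem = σ2.mem → σ3.inp = σ2.inp → σ3.out = σ2.out →
        (σ3.reg 22 = v ∧ (∀ r < 16, (σ3.setReg 22 (v + 1)).reg r = σ.reg r) ∧
        (σ3.setReg 22 (v + 1)).reg 22 = v + 1 ∧
        (∃ i off, (σ3.setReg 22 (v + 1)).reg 16 = i ∧ (σ3.setReg 22 (v + 1)).reg 17 = off ∧
          (v + 1) * n = i * w + off ∧ off < w) ∧
        (σ3.setReg 22 (v + 1)).reg 18 = 0 ∧
        (σ3.setReg 22 (v + 1)).reg 19 = (v + 1) * 2 ^ (P.δ + 1) ∧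
        (σ3.setReg 22 (v + 1)).reg 20 = L ∧ (σ3.setReg 22 (v + 1)).reg 21 = 2 ^ (P.δ + 1) ∧
        (∀ a, ¬ (2 ≤ a ∧ a < 2 + words P l L) → (σ3.setReg 22 (v + 1)).mem a = σ.mem a) ∧
        (∀ a < (v + 1) * 2 ^ (P.δ + 1),
          fieldAt P.M μ L (σ3.setReg 22 (v + 1)).mem 2 a = x (a / 2 ^ (P.δ + 1))) ∧
        (σ3.setReg 22 (v + 1)).inp = σ.inp ∧ (σ3.setReg 22 (v + 1)).out = σ.out) := by
      intro σ3 k1 k2 k3 k4 k5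
      refine ⟨?_, fun r hr => ?_, rfl, k2, ?_, ?_, ?_, ?_, fun a ha => ?_, fun a ha => ?_, ?_, ?_⟩
      · rw [k1 22 (by omega) (by omega) (by omega), hlow 22 (by omega) (by omega), g2]
      · rw [NatState.reg_setReg, if_neg (by omega), k1 r (by omega) (by omega) (by omega),
          hlow r (by omega) (by omega), g1 r hr]
      · exact ((k1 18 (by omega) (by omega) (by omega)).trans (hlow 18 (by omega) (by omega))).trans g5
      · exact (k1 19 (by omega) (by omega) (by omega)).trans e2
      · exact ((k1 20 (by omega) (by omega) (by omega)).trans (hlow 20 (by omega) (by omega))).trans g7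
      · exact ((k1 21 (by omega) (by omega) (by omega)).trans (hlow 21 (by omega) (by omega))).trans g8
      · exact (congrFun k3 a).trans ((e3 a ha).trans (g9 a ha))
      · exact (congrArg (fun m => fieldAt P.M μ L m 2 a) k3).trans (e4 a ha)
      · exact k4.trans (e5.trans g11)
      · exact k5.trans (e6.trans g12)
    refine wp_let hw (Ev.add (Ev.var f17) (Ev.var f1) (by omega)) ?_
    refine wp_cons_of (wp_cond (B' := 130) hw (Ev.less (Ev.var (v := off + n) rfl) (Ev.var f3)) ?_ ?_)
      fun σ3 h => wp_nil h
    · intro h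
      have hlt : off + n < w := by by_contra h'; exact h (if_neg h')
      refine wp_nil (hfin _ (fun r hr h h' => ?_) ⟨i, off + n, f16, rfl, by rw [add_mul]; omega, hlt⟩
        rfl rfl rfl)
      rw [NatState.reg_setReg, if_neg h']
    · intro h
      have hlt : ¬ off + n < w := fun h' => by rw [if_pos h'] at h; omega
      refine wp_let hw (Ev.sub (Ev.var (v := off + n) rfl) (Ev.var f3) (by omega) (by omega)) ?_
      refine wp_let hw (Ev.add (Ev.var f16) (Ev.num (k := 1) (by omega)) (by omega)) ?_
      refine wp_nil (hfin _ (fun r hr h h' => ?_) ⟨i + 1, off + n - w, rfl, rfl, by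
        rw [add_mul, add_mul]; omega, by omega⟩ rfl rfl rfl)
      simp only [NatState.reg_setReg]
      rw [if_neg h, if_neg h', if_neg h']
  · rintro σ' ⟨h1, h2, h3, h4, h5, h6, h7, h8, h9, h10, h11⟩
    exact wp_nil ⟨hr.congr (k := 16) h1, (h1 14 (by omega)).trans h14, (h1 15 (by omega)).trans h15,
      h8, h9, h10, h11⟩

end Tabulation

/-! ### All levels, output and the whole evaluation -/

namespace Tabulation

open WordRAM

variable {P : Params} {n κ l w μ L S : ℕ}

/-- Field `g` of block `v` of the buffer at the beginning of level `t`. -/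
def contents (P : Params) (T x : ℕ → ℕ) : ℕ → ℕ → ℕ → ℕ
  | 0, v, _ => x (v / 2)
  | t + 1, v, g => out P T t (idx P T t fun i => x (v * 2 ^ t + i)) g

/-- Blocks `2 v` and `2 v + 1` hold the outputs of the two halves of string `v`. At level `0` both
hold the same character, which `comb` reproduces. -/
theorem comb_contents (T x : ℕ → ℕ) (t v f : ℕ) :
    comb (P.cut f) (contents P T x t (2 * v) f) (contents P T x t (2 * v + 1) f)
      = idx P T t (fun i => x (v * 2 ^ t + i)) f := by
  cases t with
  | zero =>
    simp only [contents, idx]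
    rw [show 2 * v / 2 = v by omega, show (2 * v + 1) / 2 = v by omega, comb_self]
    simp
  | succ t =>
    simp only [contents, idx]
    rw [show 2 * v * 2 ^ t = v * 2 ^ (t + 1) by ring,
      show (2 * v + 1) * 2 ^ t = v * 2 ^ (t + 1) + 2 ^ t by ring]
    simp only [add_assoc]

theorem levelField_eq {t X : ℕ} {mem : ℕ → ℕ} {T x : ℕ → ℕ} (ht : t ≤ l)
    (hT : fieldAt P.M μ L mem (2 * words P l L + 2) = T)
    (h : ∀ a < 2 ^ (l + 1 - t) * 2 ^ (P.δ + t),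
      fieldAt P.M μ L mem X a = contents P T x t (a / 2 ^ (P.δ + t)) (a % 2 ^ (P.δ + t)))
    {a : ℕ} (ha : a < 2 ^ (l - t) * 2 ^ (P.δ + t + 1)) :
    levelField P l μ L t X mem a =
      contents P T x (t + 1) (a / 2 ^ (P.δ + t + 1)) (a % 2 ^ (P.δ + t + 1)) := by
  have hv : a / 2 ^ (P.δ + t + 1) < 2 ^ (l - t) := by
    rwa [Nat.div_lt_iff_lt_mul (Nat.two_pow_pos _)]
  unfold levelField
  simp only [contents]
  rw [hT]
  refine out_congr_index (fun f hf => ?_) _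
  rw [← comb_contents]
  set v := a / 2 ^ (P.δ + t + 1)
  have key : ∀ b < 2, fieldAt P.M μ L mem X ((2 * v + b) * 2 ^ (P.δ + t) + f) =
      contents P T x t (2 * v + b) f := by
    intro b hb
    obtain ⟨e1, e2⟩ := div_mod_of_eq (show (2 * v + b) * 2 ^ (P.δ + t) + f = _ from rfl) hf
    rw [h, e1, e2]
    have e : 2 ^ (l + 1 - t) = 2 ^ (l - t) * 2 := by rw [← pow_succ]; congr 1; omega
    have h1 : (2 * v + b + 1) * 2 ^ (P.δ + t) ≤ 2 ^ (l - t) * 2 * 2 ^ (P.δ + t) :=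
      Nat.mul_le_mul_right _ (by omega)
    rw [e]
    rw [add_mul (2 * v + b), one_mul] at h1
    omega
  have h0 := key 0 (by omega)
  rw [add_zero] at h0
  unfold Tabulation.key
  rw [h0, key 1 (by omega)]

/-- A bound for the time for level `t`. -/
def levelTime (P : Params) (l L t : ℕ) : ℕ :=
  2 ^ (l - t) * 2 ^ (P.δ + t + 1 - min L (P.δ + t + 1)) * (2 ^ (P.δ + t) * 1015 + 615) + 900

theorem wp_levels (ly : Layout P n κ l w μ L S) {x T : ℕ → ℕ} {σ : NatState}
    (hr : Ready P n κ l w μ L σ) (h14 : σ.reg 14 = 2) (h15 : σ.reg 15 = words P l L + 2)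
    (hT : fieldAt P.M μ L σ.mem (2 * words P l L + 2) = T)
    (hf : ∀ a < 2 ^ l * 2 ^ (P.δ + 1), fieldAt P.M μ L σ.mem 2 a = x (a / 2 ^ (P.δ + 1))) :
    WP S w (forE 16 13 (levelProg P.γ P.δ))
      (∑ t ∈ Finset.range (l + 1), (levelTime P l L t + 15) + 20)
      (fun σ' => Ready P n κ l w μ L σ' ∧ (∃ X, σ'.reg 14 = X ∧ X ≤ 2 * words P l L + 2 ∧
        ∀ g < 2 ^ (P.δ + l + 1), fieldAt P.M μ L σ'.mem X g = out P T l (idx P T l x) g) ∧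
        (∀ a, ¬ (2 ≤ a ∧ a < 2 * words P l L + 2) → σ'.mem a = σ.mem a) ∧
        σ'.inp = σ.inp ∧ σ'.out = σ.out) σ := by
  have hlw : l + 1 < 2 ^ w := small_lt (by have := ly.width; omega)
  refine wp_for ly.w_pos (fun t σ' => Ready P n κ l w μ L σ' ∧ σ'.reg 16 = t ∧
    (∃ X Y, Buffers P l L X Y ∧ σ'.reg 14 = X ∧ σ'.reg 15 = Y ∧
      ∀ a < 2 ^ (l + 1 - t) * 2 ^ (P.δ + t), fieldAt P.M μ L σ'.mem X a =
        contents P T x t (a / 2 ^ (P.δ + t)) (a % 2 ^ (P.δ + t))) ∧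
    (∀ a, ¬ (2 ≤ a ∧ a < 2 * words P l L + 2) → σ'.mem a = σ.mem a) ∧
    σ'.inp = σ.inp ∧ σ'.out = σ.out) (levelTime P l L) hlw ?_ ?_ ?_ ?_ le_rfl
  · rintro k σ' ⟨h1, h2, -⟩
    exact ⟨h2, h1.r13⟩
  · refine ⟨hr.setReg, rfl, ⟨2, words P l L + 2, ⟨by omega, by omega, by omega, by omega, by omega⟩,
      h14, h15, fun a ha => ?_⟩, fun _ _ => rfl, rfl, rfl⟩
    rw [NatState.mem_setReg, hf a (by
      rw [show 2 ^ l * 2 ^ (P.δ + 1) = 2 ^ (l + 1 - 0) * 2 ^ (P.δ + 0) by rw [Nat.sub_zero]; ring]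
      exact ha)]
    simp only [contents]
    rw [Nat.div_div_eq_div_mul, add_zero, pow_succ]
  · rintro t ht σ' ⟨g1, g2, ⟨X, Y, g3, g4, g5, g6⟩, g7, g8, g9⟩
    refine (wp_level ly (by omega) g3 g1 g4 g5 g2).mono le_rfl ?_
    rintro σ'' ⟨e1, e2, e3, e4, e5, e6, e7, e8⟩
    have hX := g3.X_le
    have hY := g3.Y_le
    refine ⟨e4, e1.setReg, rfl, ⟨Y, X, ⟨g3.le_Y, g3.le_X, hY, hX, g3.disj.symm⟩, e2, e3,
      fun a ha => ?_⟩, fun a ha => ?_, e7.trans g8, e8.trans g9⟩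
    · rw [show l + 1 - (t + 1) = l - t by omega, show P.δ + (t + 1) = P.δ + t + 1 by omega] at *
      rw [NatState.mem_setReg, e6 a ha, levelField_eq (by omega) ?_ g6 ha]
      rw [← hT]
      funext b
      refine fieldAt_congr (g7 _ fun h => ?_)
      have := Nat.le_add_right (2 * words P l L + 2) (b / 2 ^ L)
      omega
    · rw [NatState.mem_setReg, e5 a, g7 a ha]
      have := g3.le_Y
      omega
  · rintro σ' ⟨h1, h2, ⟨X, Y, h3, h4, h5, h6⟩, h7, h8⟩
    have hX := h3.X_le
    refine ⟨h1, ⟨X, h4, by omega, fun g hg => ?_⟩, h7, h8⟩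
    rw [h6 g (by simpa [add_assoc] using hg)]
    rw [show P.δ + (l + 1) = P.δ + l + 1 by omega, Nat.div_eq_of_lt hg, Nat.mod_eq_of_lt hg]
    simp [contents]

/-- The state of the output after the bits before position `p = i * w + off` of the sequence `B`
of bits. -/
structure Written (w : ℕ) (B : ℕ → Bool) (p i off acc : ℕ) (o : ℕ → ℕ) : Prop where
  pos : p = i * w + off
  off_lt : off < w
  acc_lt : acc < 2 ^ off
  acc_eq : ∀ q < off, acc.testBit q = B (i * w + q)
  out_eq : ∀ r < p, (o (r / w)).testBit (r % w) = B r

section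

variable {B : ℕ → Bool} {p i off acc v m : ℕ} {o : ℕ → ℕ}

theorem Written.testBit_join (h : Written w B p i off acc o)
    (hB : ∀ b < m, B (p + b) = v.testBit b) {r : ℕ} (hr : r < p + m) (hi : r / w = i) :
    (acc ||| (v <<< off) % 2 ^ w).testBit (r % w) = B r := by
  have hw : 0 < w := by have := h.off_lt; omega
  have hpos := h.pos
  have hrw := Nat.div_add_mod' r w
  rw [hi] at hrw
  have hlt : r % w < w := Nat.mod_lt _ hw
  rw [Nat.testBit_or, Nat.testBit_mod_two_pow, Nat.testBit_shiftLeft]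
  by_cases hq : r % w < off
  · rw [h.acc_eq _ hq, hrw]
    simp [not_le.2 hq]
  · have hz : acc.testBit (r % w) = false :=
      Nat.testBit_lt_two_pow (h.acc_lt.trans_le (Nat.pow_le_pow_right (by omega) (by omega)))
    have := hB (r - p) (by omega)
    rw [show p + (r - p) = r by omega] at this
    rw [hz, this, show r % w - off = r - p by omega]
    simp [hlt, not_lt.1 hq]

theorem Written.extend (h : Written w B p i off acc o) (hv : v < 2 ^ m)
    (hB : ∀ b < m, B (p + b) = v.testBit b) (hm : off + m < w) :
    Written w B (p + m) i (off + m) (acc ||| (v <<< off) % 2 ^ w)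
      (Function.update o i (acc ||| (v <<< off) % 2 ^ w)) := by
  have hw : 0 < w := by omega
  have hpos := h.pos
  refine ⟨by omega, hm, ?_, fun q hq => ?_, fun r hr => ?_⟩
  · refine Nat.or_lt_two_pow
      (h.acc_lt.trans_le (Nat.pow_le_pow_right (by omega) (by omega))) ?_
    refine (Nat.mod_le _ _).trans_lt ?_
    rw [Nat.shiftLeft_eq, add_comm off, pow_add]
    exact Nat.mul_lt_mul_of_pos_right hv (Nat.two_pow_pos _)
  · obtain ⟨e1, e2⟩ := div_mod_of_eq (show i * w + q = _ from rfl) (show q < w by omega)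
    have := h.testBit_join hB (r := i * w + q) (by omega) e1
    rwa [e2] at this
  · by_cases hi : r / w = i
    · rw [hi, Function.update_self]
      exact h.testBit_join hB hr hi
    · rw [Function.update_of_ne hi]
      refine h.out_eq r ?_
      by_contra hc
      exact hi (div_mod_of_eq (show r = i * w + (r - i * w) by omega) (by omega)).1

/-- The field completes word `i`, and its topmost `off + m - w` bits become the new unfinished word.
If the field ends exactly at the boundary, this new word is `0`. -/
theorem Written.carry (h : Written w B p i off acc o) (hv : v < 2 ^ m)
    (hB : ∀ b < m, B (p + b) = v.testBit b) (hm : w ≤ off + m) (hmw : m ≤ w) :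
    Written w B (p + m) (i + 1) (off + m - w) (v >>> (m - (off + m - w)))
      (Function.update (Function.update o i (acc ||| (v <<< off) % 2 ^ w)) (i + 1)
        (v >>> (m - (off + m - w)))) := by
  have hoff := h.off_lt
  have hw : 0 < w := by omega
  have hpos := h.pos
  have hiw : (i + 1) * w = i * w + w := by ring
  have hbit : ∀ q < off + m - w, (v >>> (m - (off + m - w))).testBit q = B ((i + 1) * w + q) := by
    intro q hq
    rw [Nat.testBit_shiftRight, ← hB _ (by omega)]
    congr 1
    omega
  refine ⟨by omega, by omega, ?_, hbit, fun r hr => ?_⟩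
  · rw [Nat.shiftRight_eq_div_pow, Nat.div_lt_iff_lt_mul (Nat.two_pow_pos _), ← pow_add]
    exact hv.trans_le (Nat.pow_le_pow_right (by omega) (by omega))
  · by_cases hi : r / w = i + 1
    · rw [hi, Function.update_self]
      have := Nat.div_add_mod' r w
      rw [hi] at this
      rw [hbit _ (by omega), this]
    · rw [Function.update_of_ne hi]
      by_cases hi' : r / w = i
      · rw [hi', Function.update_self]
        exact h.testBit_join hB hr hi'
      · rw [Function.update_of_ne hi']
        refine h.out_eq r ?_
        by_contra hc
        by_cases hc' : r < (i + 1) * w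
        · exact hi' (div_mod_of_eq (show r = i * w + (r - i * w) by omega) (by omega)).1
        · exact hi (div_mod_of_eq (show r = (i + 1) * w + (r - (i + 1) * w) by omega) (by omega)).1

end

theorem wp_output_fields (ly : Layout P n κ l w μ L S) {σ : NatState} {X : ℕ} {V : ℕ → ℕ}
    (hr : Ready P n κ l w μ L σ) (h14 : σ.reg 14 = X) (hX : X ≤ 2 * words P l L + 2)
    (hV : ∀ i < 2 ^ (l + 3), fieldAt P.M μ L σ.mem X i % 2 ^ (n + κ + 4) = V i) :
    WP S w outputProg (2 ^ (l + 3) * 1000 + 400) (fun σ' => σ'.mem = σ.mem ∧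
      PackedNat w (n + κ + 4) (2 ^ (l + 3)) V σ'.out) σ := by
  have hw := ly.w_pos
  have hwd := ly.width
  have hww := ly.two_mul_le
  have hM := ly.M_eq
  have hδ := ly.δ_eq
  have h0w := Nat.two_pow_pos w
  have hN : 2 ^ (l + 3) < 2 ^ w := ly.pow_lt (by omega)
  set m := n + κ + 4 with hm
  have hmw : m < w := by omega
  refine wp_let hw (Ev.num (k := 0) h0w) ?_
  refine wp_let hw (Ev.num (k := 0) h0w) ?_
  refine wp_let hw (Ev.num (k := 0) h0w) ?_
  refine wp_let (v := 2 ^ (l + 3)) hw (Ev.cast (Ev.mul (Ev.var hr.r12) (Ev.num (k := 3) (by omega)) (by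
    rw [← pow_add]; exact hN)) (pow_add _ _ _).symm) ?_
  let B : ℕ → Bool := fun p => (V (p / m)).testBit (p % m)
  refine wp_cons (B' := 2 ^ (l + 3) * 1000 + 20) ?_
  refine wp_for hw (fun k σ' => (∀ r < 16, σ'.reg r = σ.reg r) ∧ σ'.reg 20 = k ∧
      (∃ i off acc, σ'.reg 16 = i ∧ σ'.reg 17 = off ∧ σ'.reg 18 = acc ∧
        Written w B (k * m) i off acc σ'.out) ∧ σ'.reg 19 = 2 ^ (l + 3) ∧ σ'.mem = σ.mem)
    (fun _ => 900) hN ?_ ?_ ?_ ?_ (by simp)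
  · rintro k σ' ⟨h1, h2, -, h3, -⟩
    exact ⟨h2, h3⟩
  · refine ⟨fun r hr => ?_, rfl, ⟨0, 0, 0, rfl, rfl, rfl, by simp, hw, by simp, by simp, by simp⟩,
      rfl, rfl⟩
    simp only [NatState.reg_setReg]
    repeat rw [if_neg (by omega)]
  · rintro k hk σ' ⟨g1, g2, ⟨i, off, acc, g3, g4, g5, g6⟩, g7, g8⟩
    have hr' := hr.congr (k := 16) g1
    have hi := word_index_le g6.pos hmw.le hw
    have hoff := g6.off_lt
    have hkQ : k < 2 ^ (P.M + 2 * P.δ + 2 * l + 2) :=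
      hk.trans_le (Nat.pow_le_pow_right (by omega) (by omega))
    refine wp_cons_of (wp_readField ly hr' ((g1 14 (by omega)).trans h14) g2 hX hkQ (by decide)
      (by decide) (by decide) (by decide) (by decide)) ?_
    rintro _ rfl
    rw [g8]
    have hVlt : V k < 2 ^ m := by rw [← hV k hk]; exact Nat.mod_lt _ (Nat.two_pow_pos _)
    have hVw : V k < 2 ^ w := hVlt.trans (Nat.pow_lt_pow_right (by omega) hmw)
    refine wp_let (v := V k) hw (Ev.cast (Ev.low hw (Ev.var (NatState.reg_setReg _ _ _ _))
      (Ev.var hr'.r11) ?_) (hV k hk)) ?_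
    · simp only [reduceIte]
      exact (fieldAt_lt _ _ _ _ _ _).trans (ly.pow_lt (by omega))
    refine wp_let hw (Ev.or (Ev.var g5) (Ev.shl (Ev.var (v := V k) rfl) (Ev.var g4))) ?_
    refine wp_put hw (Ev.var g3) (Ev.var rfl) ?_
    simp only [NatState.reg_setReg, reduceIte]
    refine wp_let hw (Ev.add (Ev.var g4) (Ev.var hr'.r11) (by omega)) ?_
    have hB : ∀ b < m, B (k * m + b) = (V k).testBit b := by
      intro b hb
      obtain ⟨e1, e2⟩ := div_mod_of_eq (show k * m + b = _ from rfl) hb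
      simp only [B, e1, e2]
    refine wp_cons_of (wp_cond (B' := 300) hw (Ev.less (Ev.var (v := off + m) rfl) (Ev.var hr'.r3))
      ?_ ?_) fun σ3 h => wp_nil h
    · intro h
      have hlt : off + m < w := by by_contra h'; exact h (if_neg h')
      refine wp_nil ⟨g2, fun r hr => ?_, trivial, ⟨i, off + m, _, g3, rfl, rfl, ?_⟩, g7, g8⟩
      · rw [← g1 r hr]
        simp only [NatState.reg_setReg, NatState.reg_setOut]
        repeat rw [if_neg (by omega)]
      · rw [add_mul, one_mul]
        exact g6.extend hVlt hB hlt
    · intro h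
      have hlt : ¬ off + m < w := fun h' => by rw [if_pos h'] at h; omega
      refine wp_let hw (Ev.sub (Ev.var (v := off + m) rfl) (Ev.var hr'.r3) (by omega) (by omega)) ?_
      refine wp_let hw (Ev.add (Ev.var g3) (Ev.num (k := 1) (by omega)) (by omega)) ?_
      refine wp_let hw (Ev.shr (Ev.var (v := V k) rfl) (Ev.sub (Ev.var hr'.r11)
        (Ev.var (v := off + m - w) rfl) (by omega) (by omega))) ?_
      refine wp_put hw (Ev.var (v := i + 1) rfl) (Ev.var rfl) ?_
      refine wp_nil ⟨g2, fun r hr => ?_, trivial, ⟨i + 1, off + m - w, _, rfl, rfl, rfl, ?_⟩, g7, g8⟩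
      · rw [← g1 r hr]
        simp only [NatState.reg_setReg, NatState.reg_setOut]
        repeat rw [if_neg (by omega)]
      · rw [add_mul, one_mul]
        exact g6.carry hVlt hB (by omega) hmw.le
  · rintro σ' ⟨h1, h2, ⟨i, off, acc, -, -, -, h6⟩, h7, h8⟩
    refine wp_nil ⟨h8, fun i hi b hb => ?_⟩
    have hlt : i * m + b < 2 ^ (l + 3) * m := by
      have := Nat.mul_le_mul_right m hi
      rw [Nat.succ_mul] at this
      omega
    obtain ⟨e1, e2⟩ := div_mod_of_eq (show i * m + b = _ from rfl) hb
    rw [h6.out_eq _ hlt]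
    simp only [B, e1, e2]

/-- A bound for the time for the evaluation. -/
def evalTime (P : Params) (l L : ℕ) : ℕ :=
  2 ^ l * (2 ^ (P.δ + 1) * 415 + 600) + ∑ t ∈ Finset.range (l + 1), (levelTime P l L t + 15) +
    2 ^ (l + 3) * 1000 + 2000

theorem wp_eval (ly : Layout P n κ l w μ L S) {x T : ℕ → ℕ} (hx : ∀ i, x i < 2 ^ n) {σ : NatState}
    (h0 : σ.reg 0 = l) (h1 : σ.reg 1 = n)
    (h2 : σ.reg 2 = κ) (h3 : σ.reg 3 = w) (hμ : σ.mem 0 = μ) (hL : σ.mem 1 = L)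
    (hinp : ∀ a, σ.inp a < 2 ^ w) (hpk : PackedNat w n (2 ^ l) x σ.inp)
    (hT : fieldAt P.M μ L σ.mem (2 * words P l L + 2) = T) :
    WP S w (evalProg P.γ P.δ) (evalTime P l L) (fun σ' =>
      (∀ a, ¬ (2 ≤ a ∧ a < 2 * words P l L + 2) → σ'.mem a = σ.mem a) ∧
      PackedNat w (n + κ + 4) (2 ^ (l + 3))
        (fun i => out P T l (idx P T l x) i % 2 ^ (n + κ + 4)) σ'.out) σ := by
  unfold evalTime
  refine wp_cons_of (wp_setup ly h0 h1 h2 h3 hμ hL) ?_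
  rintro σ1 ⟨hr1, a1, a2, a3, a4, a5⟩
  refine wp_cons_of (wp_fill ly hx (by rwa [a4]) (by rwa [a4]) hr1 a1 a2) ?_
  rintro σ2 ⟨hr2, b1, b2, b3, b4, b5, b6⟩
  have hT2 : fieldAt P.M μ L σ2.mem (2 * words P l L + 2) = T := by
    rw [← hT]
    funext b
    refine fieldAt_congr ?_
    rw [b3 _ fun h => ?_, a3]
    have := Nat.le_add_right (2 * words P l L + 2) (b / 2 ^ L)
    have := words_pos (P := P) (l := l) (L := L)
    omega
  refine wp_cons_of (wp_levels ly hr2 b1 b2 hT2 b4) ?_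
  rintro σ3 ⟨hr3, ⟨X, c1, c2, c3⟩, c4, c5, c6⟩
  refine wp_cons_of (wp_output_fields ly hr3 c1 c2 (V := fun i => out P T l (idx P T l x) i %
    2 ^ (n + κ + 4)) (fun i hi => ?_)) ?_
  · rw [c3 i (hi.trans_le (Nat.pow_le_pow_right (by omega) (by have := ly.δ_eq; omega)))]
  rintro σ4 ⟨d1, d2⟩
  refine wp_nil ⟨fun a ha => ?_, d2⟩
  rw [d1, c4 a ha, b3 a (fun h => ha ⟨h.1, by omega⟩), a3]

end Tabulation

namespace Tabulation

open WordRAM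

/-! ### The initialization -/

/-- Double register `16` and count in register `4` until register `6` is reached. -/
def fieldLogProg : Prog := forE 17 6 (block [
    ifE ((R 16).less (R 6)) (block [assign 16 (R 16 <<< 1), assign 4 (R 4 + 1)]) (block [])])

/-- Double register `16` and count in register `5` as long as register `3` is not exceeded. -/
def packLogProg : Prog := forE 17 18 (block [
    assign 19 (R 16 <<< 1),
    ifE ((R 3).less (R 19)) (block []) (block [assign 16 (R 19), assign 5 (R 5 + 1)])])

def layoutProg (δ : ℕ) : Prog := block [
  assign 6 (R 1 + R 2 + 20),
  assign 4 0, assign 16 1,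
  fieldLogProg,
  assign 18 (R 6 + .lit (2 * δ + 2) + R 0 + R 0),
  assign 5 0,
  packLogProg,
  storeE 0 (R 4), storeE 1 (R 5),
  assign 20 ((1 : Expr) <<< (R 18 - R 5)),
  assign 21 (R 20 + R 20 + 2),
  assign 22 (R 21 + R 20),
  assign 24 1, assign 25 1]

/-- Fill the memory between the addresses in registers `21` and `22` with random words. -/
def randomFill : Prog := .loop 25 (.seq (.rand 23 26) (.seq (.store 21 23)
  (.seq (.op .add 21 21 24) (.op .lt 25 21 22))))

def initProg (δ : ℕ) : Prog := .seq (layoutProg δ) randomFill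

/-- The logarithm of the distance of fields. -/
def fieldLog (n κ : ℕ) : ℕ := Nat.clog 2 (n + κ + 20)

/-- The logarithm of the number of fields in a word. -/
def packLog (δ l n κ w : ℕ) : ℕ :=
  min (n + κ + 20 + (2 * δ + 2) + l + l) (Nat.log 2 w - fieldLog n κ)

section

variable {P : Params} {n κ l w : ℕ}

/-- The only hypothesis on the word size beyond positivity is addressability. It gives `M + 2 δ + 2
l + 4 - L ≤ w`. If `width` failed, then `L ≥ δ + l + 3`, and packing `2 ^ L` fields of `M` bits into
a word would force `w ≥ (δ + l + 4) M`, which is too large. -/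
theorem layout_of_le (hM : P.M = n + κ + 20) (he : P.e = n / 4 + 1)
    (hδ : P.δ = 2 * P.γ + 6) (hw : 0 < w)
    (hS : 3 * words P l (packLog P.δ l n κ w) + 3 ≤ 2 ^ w) :
    Layout P n κ l w (fieldLog n κ) (packLog P.δ l n κ w)
      (3 * words P l (packLog P.δ l n κ w) + 3) := by
  have hMμ : P.M ≤ 2 ^ fieldLog n κ := hM ▸ Nat.le_pow_clog (by omega) _
  have hμM : fieldLog n κ ≤ P.M :=
    hM ▸ Nat.clog_le_of_le_pow Nat.lt_two_pow_self.le
  have hL : packLog P.δ l n κ w ≤ P.M + 2 * P.δ + 2 * l + 2 := by unfold packLog; omega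
  have hpack : 0 < packLog P.δ l n κ w → 2 ^ (packLog P.δ l n κ w + fieldLog n κ) ≤ w := by
    intro h
    refine (Nat.pow_le_pow_right (by omega) ?_).trans (Nat.pow_log_le_self 2 hw.ne')
    unfold packLog at h ⊢
    omega
  refine ⟨hM, he, hδ, hMμ, hμM, ?_, hpack, hL, rfl, hS⟩
  set L := packLog P.δ l n κ w
  have h1 : P.M + 2 * P.δ + 2 * l + 2 - L + 2 ≤ w := by
    by_contra h
    have h2 : 2 ^ w ≤ 2 ^ (P.M + 2 * P.δ + 2 * l + 2 - L + 1) :=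
      Nat.pow_le_pow_right (by omega) (by omega)
    rw [pow_succ] at h2
    unfold words at hS
    have := Nat.two_pow_pos (P.M + 2 * P.δ + 2 * l + 2 - L)
    omega
  by_contra hlt
  have hLD : P.δ + l + 3 ≤ L := by omega
  have h3 := hpack (by omega)
  have h4 : (P.δ + l + 4) * P.M ≤ 2 ^ (L + fieldLog n κ) := by
    rw [pow_add]
    refine Nat.mul_le_mul ?_ hMμ
    exact Nat.lt_two_pow_self.trans_le (Nat.pow_le_pow_right (by omega) hLD)
  have : P.δ + l + 3 ≤ (P.δ + l + 3) * P.M := Nat.le_mul_of_pos_right _ (by omega)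
  rw [show P.δ + l + 4 = (P.δ + l + 3) + 1 by ring, add_mul, one_mul] at h4
  omega

theorem wp_fieldLog {S M μ : ℕ} (hw : 0 < w) (hMw : 4 * M < 2 ^ w) (hM : 1 < M)
    (hpow_lt : ∀ k, 2 ^ k < M ↔ k < μ) (hμM : μ ≤ M) {σ1 : NatState} (k6 : σ1.reg 6 = M)
    (k4 : σ1.reg 4 = 0) (k16 : σ1.reg 16 = 1) :
    WP S w fieldLogProg (M * 215 + 20) (fun σ' =>
      (∀ r < 27, r ≠ 4 → r ≠ 16 → r ≠ 17 → σ'.reg r = σ1.reg r) ∧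
        σ'.reg 4 = μ ∧ σ'.reg 16 = 2 ^ μ ∧ σ'.mem = σ1.mem) σ1 := by
  refine wp_for hw (fun k σ' => (∀ r < 27, r ≠ 4 → r ≠ 16 → r ≠ 17 → σ'.reg r = σ1.reg r) ∧
    σ'.reg 17 = k ∧ σ'.reg 4 = min k μ ∧ σ'.reg 16 = 2 ^ (min k μ) ∧ σ'.mem = σ1.mem)
    (fun _ => 200) (N := M) (by omega) ?_ ?_ ?_ ?_ (by simp)
  · rintro k σ' ⟨g1, g2, -⟩
    exact ⟨g2, (g1 6 (by omega) (by omega) (by omega) (by omega)).trans k6⟩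
  · refine ⟨fun r _ _ _ h => ?_, rfl, by simpa using k4, by simpa using k16, rfl⟩
    rw [NatState.reg_setReg, if_neg h]
  · rintro k hk σ' ⟨g1, g2, g3, g4, g5⟩
    have g6 := (g1 6 (by omega) (by omega) (by omega) (by omega)).trans k6
    refine wp_cons_of (wp_cond (B' := 130) hw (Ev.less (Ev.var g4) (Ev.var g6)) ?_ ?_)
      fun σ3 h => wp_nil h
    · intro h
      have hlt : 2 ^ min k μ < M := by by_contra h'; exact h (if_neg h')
      have hlt' := (hpow_lt _).1 hlt
      refine wp_let (v := 2 ^ (min k μ + 1)) hw (Ev.cast (Ev.mul (Ev.var g4)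
        (Ev.num (k := 1) (by omega)) (by omega)) (by rw [pow_one, pow_succ])) ?_
      refine wp_let hw (Ev.add (Ev.var g3) (Ev.num (k := 1) (by omega)) (by omega)) ?_
      refine wp_nil ⟨g2, fun r hr r4 r16 r17 => ?_, rfl, ?_, ?_, g5⟩
      · simp only [NatState.reg_setReg]
        rw [if_neg r17, if_neg r4, if_neg r16, g1 r hr r4 r16 r17]
      · change min k μ + 1 = min (k + 1) μ
        omega
      · change 2 ^ (min k μ + 1) = 2 ^ min (k + 1) μ
        congr 1
        omega
    · intro h
      have hlt : ¬ 2 ^ min k μ < M := fun h' => by rw [if_pos h'] at h; omega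
      have hlt' : ¬ min k μ < μ := fun h' => hlt ((hpow_lt _).2 h')
      refine wp_nil ⟨g2, fun r hr r4 r16 r17 => ?_, rfl, ?_, ?_, g5⟩
      · rw [NatState.reg_setReg, if_neg r17, g1 r hr r4 r16 r17]
      · rw [NatState.reg_setReg, if_neg (by omega), g3]
        omega
      · rw [NatState.reg_setReg, if_neg (by omega), g4]
        congr 1
        omega
  · rintro σ' ⟨g1, g2, g3, g4, g5⟩
    rw [min_eq_right (by omega)] at g3 g4
    exact ⟨g1, g3, g4, g5⟩

/-- The loop always runs `Q` rounds and counts a doubling as long as the result is at most `w`; this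
yields the minimum of `Q` and `D`. If already `2 ^ μ > w`, then `D = 0` and the count stays `0`. -/
theorem wp_packLog {S Q μ D : ℕ} (hw : 0 < w) (hw4 : 4 * w < 2 ^ w) (hQ : Q < 2 ^ w)
    (hμw : 2 ^ μ ≤ 2 * w) (hD : D = Nat.log 2 w - μ) {σ2 : NatState} (k18 : σ2.reg 18 = Q)
    (k3 : σ2.reg 3 = w) (k5 : σ2.reg 5 = 0) (k16 : σ2.reg 16 = 2 ^ μ) :
    WP S w packLogProg (Q * 315 + 20) (fun σ' => (∀ r < 27, r ≠ 5 → r ≠ 16 → r ≠ 17 → r ≠ 19 →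
          σ'.reg r = σ2.reg r) ∧ σ'.reg 5 = min Q D ∧ σ'.mem = σ2.mem) σ2 := by
  have hle_log : ∀ k, 2 ^ k ≤ w ↔ k ≤ Nat.log 2 w := fun k =>
    (Nat.le_log_iff_pow_le (by omega) hw.ne').symm
  refine wp_for hw (fun k σ' => (∀ r < 27, r ≠ 5 → r ≠ 16 → r ≠ 17 → r ≠ 19 →
      σ'.reg r = σ2.reg r) ∧ σ'.reg 17 = k ∧ σ'.reg 5 = min k D ∧ σ'.reg 16 = 2 ^ (μ + min k D) ∧
      σ'.mem = σ2.mem) (fun _ => 300) (N := Q) (by omega) ?_ ?_ ?_ ?_ (by simp)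
  · rintro k σ' ⟨g1, g2, -⟩
    exact ⟨g2, (g1 18 (by omega) (by omega) (by omega) (by omega) (by omega)).trans k18⟩
  · refine ⟨fun r _ _ _ h _ => ?_, rfl, by simpa using k5, by simpa using k16, rfl⟩
    rw [NatState.reg_setReg, if_neg h]
  · rintro k hk σ' ⟨g1, g2, g3, g4, g5⟩
    have g6 := (g1 3 (by omega) (by omega) (by omega) (by omega) (by omega)).trans k3
    have hsmall : 2 ^ (μ + min k D) ≤ 2 * w := by
      rcases Nat.eq_zero_or_pos (min k D) with h | h
      · rw [h, add_zero]
        omega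
      · have := (hle_log (μ + min k D)).2 (by omega)
        omega
    refine wp_let (v := 2 ^ (μ + min k D + 1)) hw (Ev.cast (Ev.mul (Ev.var g4)
        (Ev.num (k := 1) (by omega)) (by omega)) (by rw [pow_one, pow_succ])) ?_
    refine wp_cons_of (wp_cond (B' := 130) hw (Ev.less (Ev.var g6) (Ev.var rfl)) ?_ ?_)
      fun σ3 h => wp_nil h
    · intro h
      have hlt : w < 2 ^ (μ + min k D + 1) := by by_contra h'; exact h (if_neg h')
      have hlt' : ¬ μ + min k D + 1 ≤ Nat.log 2 w := fun h' => by
        have := (hle_log _).2 h'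
        omega
      refine wp_nil ⟨g2, fun r hr r5 r16 r17 r19 => ?_, rfl, ?_, ?_, g5⟩
      · simp only [NatState.reg_setReg]
        rw [if_neg r17, if_neg r19, g1 r hr r5 r16 r17 r19]
      · change σ'.reg 5 = _
        omega
      · change σ'.reg 16 = _
        rw [g4]
        congr 2
        omega
    · intro h
      have hlt : 2 ^ (μ + min k D + 1) ≤ w := by
        by_contra h'
        rw [not_le] at h'
        exact absurd h (by
          change ¬ (if w < 2 ^ (μ + min k D + 1) then 1 else 0) = 0
          rw [if_pos h']
          omega)
      have hlt' := (hle_log _).1 hlt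
      refine wp_let hw (Ev.var rfl) ?_
      refine wp_let hw (Ev.add (Ev.var g3) (Ev.num (k := 1) (by omega)) (by omega)) ?_
      refine wp_nil ⟨g2, fun r hr r5 r16 r17 r19 => ?_, rfl, ?_, ?_, g5⟩
      · simp only [NatState.reg_setReg]
        rw [if_neg r17, if_neg r5, if_neg r16, if_neg r19, g1 r hr r5 r16 r17 r19]
      · change min k D + 1 = min (k + 1) D
        omega
      · change 2 ^ (μ + min k D + 1) = 2 ^ (μ + min (k + 1) D)
        congr 1
        omega
  · rintro σ' ⟨g1, g2, g3, g4, g5⟩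
    exact ⟨g1, g3, g5⟩

/-- The time for the computation of the layout. -/
def layoutTime (δ l n κ : ℕ) : ℕ :=
  (n + κ + 20) * 215 + (n + κ + 20 + (2 * δ + 2) + l + l) * 315 + 1000

theorem wp_layout {L S : ℕ} (ly : Layout P n κ l w (fieldLog n κ) L S)
    (hL : L = packLog P.δ l n κ w) {σ : NatState} (h0 : σ.reg 0 = l) (h1 : σ.reg 1 = n)
    (h2 : σ.reg 2 = κ) (h3 : σ.reg 3 = w) (h26 : σ.reg 26 = 0) :
    WP S w (layoutProg P.δ) (layoutTime P.δ l n κ) (fun σ' =>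
      σ'.mem = Function.update (Function.update σ.mem 0 (fieldLog n κ)) 1 L ∧
      σ'.reg 21 = 2 * words P l L + 2 ∧ σ'.reg 22 = 2 * words P l L + 2 + words P l L ∧
      σ'.reg 24 = 1 ∧ σ'.reg 25 = 1 ∧ σ'.reg 26 = 0) σ := by
  have hw := ly.w_pos
  have hwd := ly.width
  have hM := ly.M_eq
  have hS := ly.S_eq
  have hN := ly.words_le
  have hLle := ly.L_le
  have hμle := ly.μ_le
  have hww : 4 * w < 2 ^ w := by
    obtain ⟨k, hk⟩ : ∃ k, w = k + 4 := ⟨w - 4, by omega⟩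
    have := Nat.lt_two_pow_self (n := k)
    rw [hk, pow_add]
    omega
  have hδ : 2 * P.δ + 2 < 2 ^ w := by omega
  have h1w : 1 < 2 ^ w := by omega
  set M := n + κ + 20 with hMdef
  set Q := M + (2 * P.δ + 2) + l + l with hQdef
  set μ := fieldLog n κ with hμ
  have hpow_lt : ∀ k, 2 ^ k < M ↔ k < μ := by
    intro k
    rw [hμ, fieldLog, ← hMdef, Nat.lt_clog_iff_pow_lt (by omega)]
  have hμ2 : 2 ^ μ ≤ 2 * M := by
    obtain ⟨k, hk⟩ : ∃ k, μ = k + 1 := ⟨μ - 1, by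
      have := (hpow_lt 0).1 (by simp; omega)
      omega⟩
    have := (hpow_lt k).2 (by omega)
    rw [hk, pow_succ]
    omega
  unfold layoutTime
  rw [← hMdef, ← hQdef]
  refine wp_let (v := M) hw (Ev.add (Ev.add (Ev.var h1) (Ev.var h2) (by omega))
    (Ev.num (k := 20) (by omega)) (by omega)) ?_
  refine wp_let hw (Ev.num (k := 0) (by omega)) ?_
  refine wp_let hw (Ev.num (k := 1) (by omega)) ?_
  refine wp_cons_of (wp_fieldLog (M := M) hw (by omega) (by omega) hpow_lt (by omega) rfl rfl rfl) ?_
  rintro σ1 ⟨a1, a2, a3, a4⟩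
  have b0 : σ1.reg 0 = l := (a1 0 (by omega) (by omega) (by omega) (by omega)).trans h0
  have b3 : σ1.reg 3 = w := (a1 3 (by omega) (by omega) (by omega) (by omega)).trans h3
  have b26 : σ1.reg 26 = 0 := (a1 26 (by omega) (by omega) (by omega) (by omega)).trans h26
  have b6 : σ1.reg 6 = M := a1 6 (by omega) (by omega) (by omega) (by omega)
  refine wp_let (v := Q) hw (Ev.add (Ev.add (Ev.add (Ev.var b6) (Ev.lit hδ) (by omega))
    (Ev.var b0) (by omega)) (Ev.var b0) (by omega)) ?_
  refine wp_let hw (Ev.num (k := 0) (by omega)) ?_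
  set D := Nat.log 2 w - μ with hD
  have hLmin : L = min Q D := hL
  refine wp_cons_of (wp_packLog (Q := Q) hw hww (by omega) (by omega) hD rfl b3 rfl a3) ?_
  rintro σ2 ⟨c1, c2, c3⟩
  rw [← hLmin] at c2
  have d4 : σ2.reg 4 = μ := (c1 4 (by omega) (by omega) (by omega) (by omega) (by omega)).trans a2
  have d18 : σ2.reg 18 = Q := c1 18 (by omega) (by omega) (by omega) (by omega) (by omega)
  have d26 : σ2.reg 26 = 0 :=
    (c1 26 (by omega) (by omega) (by omega) (by omega) (by omega)).trans b26
  refine wp_write hw (Ev.num (k := 0) (by omega)) (by omega) (Ev.var d4) ?_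
  refine wp_write hw (Ev.num (k := 1) (by omega)) (by omega) (Ev.var c2) ?_
  have hQw : Q - L < w := by
    by_contra h
    have : 2 ^ w ≤ words P l L := Nat.pow_le_pow_right (by omega) (by omega)
    omega
  refine wp_let (v := words P l L) hw (Ev.cast (Ev.pow hw (Ev.sub (Ev.var d18) (Ev.var c2) (by omega)
    (by omega)) hQw) (by unfold words; congr 1; omega)) ?_
  refine wp_let (v := 2 * words P l L + 2) hw (Ev.cast (Ev.add (Ev.add
    (Ev.var (v := words P l L) rfl) (Ev.var (v := words P l L) rfl) (by omega))
    (Ev.num (k := 2) (by omega)) (by omega)) (by omega)) ?_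
  refine wp_let hw (Ev.add (Ev.var (v := 2 * words P l L + 2) rfl)
    (Ev.var (v := words P l L) rfl) (by omega)) ?_
  refine wp_let hw (Ev.num (k := 1) (by omega)) ?_
  refine wp_let hw (Ev.num (k := 1) (by omega)) ?_
  refine wp_nil ⟨?_, rfl, rfl, rfl, rfl, d26⟩
  simp only [NatState.mem_setReg, NatState.mem_setMem]
  rw [c3, NatState.mem_setReg, NatState.mem_setReg, a4]
  rfl

end

end Tabulation

/-! ### The distribution of the randomly filled memory -/

namespace Tabulation

open WordRAM

/-- The memory after the `m` words from address `a` on have been replaced. -/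
def fillMem {w : ℕ} (mem : ℕ → BitVec w) (a m : ℕ) (ω : Fin m → BitVec w) (b : ℕ) : BitVec w :=
  if h : a ≤ b ∧ b < a + m then ω ⟨b - a, by omega⟩ else mem b

theorem fillMem_cons {w : ℕ} (mem : ℕ → BitVec w) (a m : ℕ) (v : BitVec w) (ω : Fin m → BitVec w) :
    fillMem mem a (m + 1) (Fin.cons v ω) = fillMem (Function.update mem a v) (a + 1) m ω := by
  funext b
  unfold fillMem
  by_cases hb : b = a
  · subst hb
    simp
  · by_cases h : a ≤ b ∧ b < a + (m + 1)
    · rw [dif_pos h, dif_pos (by omega)]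
      have : (⟨b - a, by omega⟩ : Fin (m + 1)) = Fin.succ ⟨b - (a + 1), by omega⟩ := by
        ext
        simp
        omega
      rw [this, Fin.cons_succ]
    · rw [dif_neg h, dif_neg (by omega), Function.update_of_ne hb]

theorem toNat_one {w : ℕ} (hw : 0 < w) : (1 : BitVec w).toNat = 1 :=
  Nat.mod_eq_of_lt (Nat.one_lt_two_pow hw.ne')

theorem uniform_bind_cons {α γ : Type*} [Fintype α] [Nonempty α] {m : ℕ}
    (f : (Fin (m + 1) → α) → γ) :
    ((PMF.uniformOfFintype α).bind fun v => (PMF.uniformOfFintype (Fin m → α)).map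
      fun ω => f (Fin.cons v ω)) = (PMF.uniformOfFintype (Fin (m + 1) → α)).map f := by
  have h : ((PMF.uniformOfFintype α).bind fun v => (PMF.uniformOfFintype (Fin m → α)).map
      fun ω => (Fin.cons v ω : Fin (m + 1) → α)) = PMF.uniformOfFintype (Fin (m + 1) → α) := by
    classical
    ext ω
    rw [PMF.bind_apply, tsum_eq_single (ω 0)]
    · rw [PMF.map_apply, tsum_eq_single (Fin.tail ω)]
      · simp only [Fin.cons_self_tail, if_true, PMF.uniformOfFintype_apply, Fintype.card_fun,
          Fintype.card_fin]
        rw [pow_succ, Nat.cast_mul, mul_comm, ENNReal.mul_inv (by simp) (by simp)]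
      · intro ω' h
        rw [if_neg]
        intro h'
        exact h (by rw [h', Fin.tail_cons])
    · intro v hv
      rw [PMF.map_apply, ENNReal.tsum_eq_zero.2, mul_zero]
      intro ω'
      rw [if_neg]
      rintro rfl
      exact hv (by simp)
  rw [← h, PMF.map_bind]
  congr 1
  funext v
  rw [PMF.map_comp]
  rfl

/-- The argument `0` encodes the range `2 ^ w`, which is not itself the value of a word. -/
theorem randWord_zero (w : ℕ) : randWord (0 : BitVec w) = PMF.uniformOfFintype (BitVec w) := by
  classical
  ext v
  unfold randWord
  have hb : randBound (0 : BitVec w) = 2 ^ w := by simp [randBound]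
  rw [PMF.map_apply, tsum_eq_single v.toNat]
  · rw [if_pos (by simp), PMF.uniformOfFinset_apply, if_pos (by rw [hb]; simpa using v.isLt), hb]
    simp [card_bitVec]
  · intro k hk
    split_ifs with h
    · rw [PMF.uniformOfFinset_apply, if_neg]
      rw [hb, Finset.mem_range]
      intro hlt
      apply hk
      rw [h, BitVec.toNat_ofNat, Nat.mod_eq_of_lt hlt]
    · rfl

/-- Each round takes exactly `8` steps whatever the random word is, so the time is deterministic.
Induction on `m` splits off the first random word by `uniform_bind_cons`. -/
theorem exec_randomFill {w S : ℕ} (hw : 0 < w) (T m a : ℕ) (s : State w)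
    (h21 : (s.reg 21).toNat = a) (h22 : (s.reg 22).toNat = a + m) (hS : a + m ≤ S)
    (h24 : s.reg 24 = 1) (h25 : s.reg 25 = if 0 < m then 1 else 0) (h26 : s.reg 26 = 0) :
    (exec S (T + (8 * m + 1)) [randomFill] s).map (Option.map State.mem) =
      (PMF.uniformOfFintype (Fin m → BitVec w)).map fun ω => some (fillMem s.mem a m ω) := by
  have h1 := toNat_one hw
  have h10 : (1 : BitVec w) ≠ 0 := by
    intro h
    rw [h] at h1
    simp at h1
  induction m generalizing T a s with
  | zero =>
    have hr : exec S (T + (8 * 0 + 1)) [randomFill] s = PMF.pure (some s) := by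
      simp only [randomFill, exec]
      rw [if_neg (by simp [h25])]
    rw [hr, PMF.pure_map, show (fun ω => some (fillMem s.mem a 0 ω)) =
      Function.const (Fin 0 → BitVec w) (some s.mem) from funext fun ω => by
        simp only [Function.const_apply, Option.some.injEq]
        funext b
        exact dif_neg (by omega), PMF.map_const]
    rfl
  | succ m ih =>
    have hlt : a + m + 1 < 2 ^ w := by have := (s.reg 22).isLt; omega
    let s' : BitVec w → State w := fun v =>
      ⟨Function.update (Function.update (Function.update s.reg 23 v) 21 (s.reg 21 + 1)) 25
        (if 0 < m then 1 else 0), Function.update s.mem a v, s.inp, s.out⟩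
    have hr : exec S (T + (8 * (m + 1) + 1)) [randomFill] s =
        (PMF.uniformOfFintype (BitVec w)).bind fun v =>
          exec S (T + (8 * m + 1)) [randomFill] (s' v) := by
      rw [show T + (8 * (m + 1) + 1) = (T + (8 * m + 1)) + 8 by ring]
      generalize T + (8 * m + 1) = T'
      conv_lhs => simp only [randomFill, exec]
      rw [if_pos (by rw [h25, if_pos (by omega)]; exact h10), h26, randWord_zero]
      congr 1
      funext v
      have e1 : ((s.setReg 23 v).reg 21).toNat = a := h21
      rw [if_pos (by omega)]
      refine congrArg (exec S T' [randomFill]) ?_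
      have e2 : (s.reg 21 + 1).toNat = a + 1 := by
        rw [BitVec.toNat_add, h21, h1, Nat.mod_eq_of_lt (by omega)]
      have e3 : (if (s.reg 21 + s.reg 24).toNat < (s.reg 22).toNat then 1 else 0 : BitVec w) =
          if 0 < m then 1 else 0 := by
        rw [h24, e2, h22]
        exact if_congr (by omega) rfl rfl
      change State.mk (Function.update (Function.update (Function.update s.reg 23 v) 21
        (s.reg 21 + s.reg 24)) 25 (if (s.reg 21 + s.reg 24).toNat < (s.reg 22).toNat then 1 else 0))
        (Function.update s.mem (s.reg 21).toNat v) _ _ = _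
      rw [e3, h24, h21]
      rfl
    rw [hr, PMF.map_bind, ← uniform_bind_cons]
    congr 1
    funext v
    rw [ih T (a + 1) (s' v) ?_ ?_ (by omega) ?_ ?_ ?_]
    · congr 1
      funext ω
      rw [fillMem_cons]
    · simp only [s']
      rw [Function.update_of_ne (by decide), Function.update_self, BitVec.toNat_add, h21,
        h1, Nat.mod_eq_of_lt (by omega)]
    · simp [s', h22]
      omega
    · simp [s', h24]
    · simp [s']
    · simp [s', h26]

end Tabulation

namespace Tabulation

open WordRAM

variable {P : Params} {n κ l w μ L S : ℕ}

/-! ### Random words as random tables -/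

/-- The words of an outcome, followed by zeros. -/
def wordsOf {N : ℕ} (ω : Fin N → BitVec w) (a : ℕ) : ℕ := if h : a < N then (ω ⟨a, h⟩).toNat else 0

/-- The words with fields `K a`. -/
def pack (w μ L : ℕ) (K : ℕ → ℕ) (i : ℕ) : BitVec w :=
  BitVec.ofFnLE fun b : Fin w =>
    decide (b.val / 2 ^ μ < 2 ^ L) && (K (i * 2 ^ L + b.val / 2 ^ μ)).testBit (b.val % 2 ^ μ)

/-- The tables whose words are chosen at random. -/
def tableSpace (ly : Layout P n κ l w μ L S) : TableSpace P l (Fin (words P l L) → BitVec w) where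
  T ω := fieldAt P.M μ L (wordsOf ω) 0
  T_lt ω a := fieldAt_lt _ _ _ _ _ _
  flip K ω i := ω i ^^^ pack w μ L K i
  flip_inj K ω ω' h := by
    funext i
    have := congrArg (· ^^^ pack w μ L K i) (congrFun h i)
    simpa [BitVec.xor_assoc] using this
  T_flip K hK ω a ha := by
    have hN := ly.div_lt_words ha
    apply Nat.eq_of_testBit_eq
    intro b
    rw [Nat.testBit_xor, fieldAt_testBit, fieldAt_testBit, zero_add]
    by_cases hb : b < P.M
    · have hend := field_end_le ly.M_le ly.M_le_w ly.pack a
      have hbμ : b < 2 ^ μ := hb.trans_le ly.M_le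
      obtain ⟨e1, e2⟩ := div_mod_of_eq (show a % 2 ^ L * 2 ^ μ + b = _ from rfl) hbμ
      have e3 : (pack w μ L K (a / 2 ^ L)).toNat.testBit (a % 2 ^ L * 2 ^ μ + b)
          = (K a).testBit b := by
        rw [BitVec.testBit_toNat, pack, BitVec.getLsbD_ofFnLE, dif_pos (by omega), e1, e2,
          Nat.div_add_mod', decide_eq_true (Nat.mod_lt _ (Nat.two_pow_pos L)), Bool.true_and]
      unfold wordsOf
      rw [dif_pos hN, dif_pos hN, BitVec.toNat_xor, Nat.testBit_xor, e3, decide_eq_true hb,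
        Bool.true_and, Bool.true_and]
    · have hz : (K a).testBit b = false :=
        Nat.testBit_lt_two_pow ((hK a).trans_le (Nat.pow_le_pow_right (by omega) (by omega)))
      simp [hb, hz]

/-! ### The represented function -/

/-- The function represented by the tables `T`. -/
def tabulated (P : Params) (n κ l : ℕ) (T : ℕ → ℕ) (x : Fin (2 ^ l) → BitVec n)
    (i : Fin (2 ^ (l + 3))) : BitVec (n + κ + 4) := BitVec.ofNat _ (value P n κ l T x i)

theorem tabulated_ne {T : ℕ → ℕ} {x y : Fin (2 ^ l) → BitVec n} {i : Fin (2 ^ (l + 3))}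
    (h : value P n κ l T y i ≠ value P n κ l T x i) :
    tabulated P n κ l T x i ≠ tabulated P n κ l T y i := by
  intro h'
  apply h
  have := congrArg BitVec.toNat h'
  unfold tabulated at this
  have hlt : ∀ z, value P n κ l T z i < 2 ^ (n + κ + 4) := fun z => Nat.mod_lt _ (Nat.two_pow_pos _)
  rw [BitVec.toNat_ofNat, BitVec.toNat_ofNat, Nat.mod_eq_of_lt (hlt x), Nat.mod_eq_of_lt (hlt y)]
    at this
  exact this.symm

theorem isMajorityUnique_tabulated {T : ℕ → ℕ} (h : HasMajority P n κ l T) :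
    IsMajorityUnique (tabulated P n κ l T) (2 ^ κ) := by
  classical
  refine ⟨_, le_rfl, fun A hA hcard => ?_⟩
  obtain ⟨a, ha, hmaj⟩ := h A hA hcard
  refine ⟨a, ha, ?_⟩
  let U : Finset (Fin (2 ^ (l + 3))) := Finset.univ.filter fun i =>
    ¬ ∃ b ∈ A, b ≠ a ∧ value P n κ l T b i = value P n κ l T a i
  have hU : U.card + nonunique A (value P n κ l T) a = 2 ^ (l + 3) := by
    have h1 := Finset.card_filter_add_card_filter_not (s := (Finset.univ : Finset (Fin (2 ^ (l + 3)))))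
      (fun i => ∃ b ∈ A, b ≠ a ∧ value P n κ l T b i = value P n κ l T a i)
    rw [Finset.card_univ, Fintype.card_fin, add_comm] at h1
    refine Eq.trans ?_ h1
    unfold nonunique
    congr!
  have hsub : U.image (fun i => (i, tabulated P n κ l T a i)) ⊆
      outputs (tabulated P n κ l T) {a} \ outputs (tabulated P n κ l T) (A \ {a}) := by
    intro q hq
    obtain ⟨i, hi, rfl⟩ := Finset.mem_image.1 hq
    have hi' := (Finset.mem_filter.1 hi).2
    simp only [outputs, Finset.mem_sdiff, Finset.mem_biUnion, Finset.mem_singleton,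
      Finset.mem_image, Finset.mem_univ, true_and]
    refine ⟨⟨a, rfl, i, rfl⟩, ?_⟩
    rintro ⟨y, ⟨hy, hya⟩, j, hj⟩
    obtain ⟨rfl, hj2⟩ := Prod.mk.inj hj
    refine tabulated_ne (fun hv => hi' ⟨y, hy, hya, hv⟩) hj2.symm
  have h2 := Finset.card_le_card hsub
  rw [Finset.card_image_of_injective _ fun i j hij => (Prod.mk.inj hij).1] at h2
  have h3 : 2 ^ (l + 3) < 2 * U.card := by omega
  have h4 : ((2 ^ (l + 3) : ℕ) : ℝ) < 2 * (U.card : ℝ) := by exact_mod_cast h3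
  have h5 : (U.card : ℝ) ≤ _ := Nat.cast_le.2 h2
  linarith

theorem toNat_paramRegs (h0 : l < 2 ^ w) (h1 : n < 2 ^ w) (h2 : κ < 2 ^ w) :
    (paramRegs w l n κ 0).toNat = l ∧ (paramRegs w l n κ 1).toNat = n ∧
      (paramRegs w l n κ 2).toNat = κ ∧ (paramRegs w l n κ 3).toNat = w ∧
      (paramRegs w l n κ 26).toNat = 0 := by
  have hw : w < 2 ^ w := Nat.lt_two_pow_self
  simp [paramRegs, Nat.mod_eq_of_lt h0, Nat.mod_eq_of_lt h1, Nat.mod_eq_of_lt h2,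
    Nat.mod_eq_of_lt hw]

/-- The state with the numbers that the words of `s` represent. -/
def natState (s : State w) : NatState :=
  ⟨fun r => (s.reg r).toNat, fun a => (s.mem a).toNat, fun a => (s.inp a).toNat,
    fun a => (s.out a).toNat⟩

theorem rep_natState (s : State w) : s.Rep (natState s) :=
  ⟨fun _ _ => rfl, fun _ => rfl, fun _ => rfl, fun _ => rfl⟩

theorem exec_nil {T : ℕ} (s : State w) : exec S T [] s = PMF.pure (some s) := by
  cases T <;> rfl

theorem Layout.params_lt (ly : Layout P n κ l w μ L S) : l < 2 ^ w ∧ n < 2 ^ w ∧ κ < 2 ^ w := by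
  have := ly.width
  have := ly.M_eq
  exact ⟨small_lt (by omega), small_lt (by omega), small_lt (by omega)⟩

theorem represents_tabulated (ly : Layout P n κ l w μ L S) {mem : ℕ → BitVec w}
    (hμ : (mem 0).toNat = μ) (hL : (mem 1).toNat = L) {T : ℕ → ℕ}
    (hT : fieldAt P.M μ L (fun a => (mem a).toNat) (2 * words P l L + 2) = T) :
    Represents S (evalTime P l L) (evalProg P.γ P.δ) (paramRegs w l n κ) mem
      (tabulated P n κ l T) := by
  -- Between queries only the two buffers may have changed; the tables and the cells with `μ` and
  -- `L` are intact.
  refine ⟨{m | ∀ a, ¬ (2 ≤ a ∧ a < 2 * words P l L + 2) → m a = mem a}, fun _ _ => rfl, ?_⟩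
  intro m hm x inp hx o ho
  obtain ⟨hl, hn, hκ⟩ := ly.params_lt
  obtain ⟨r0, r1, r2, r3, -⟩ := toNat_paramRegs hl hn hκ
  have hN := words_pos (P := P) (l := l) (L := L)
  have hstr : ∀ i, str x i < 2 ^ n := fun i => str_lt le_rfl x i
  have hpk : PackedNat w n (2 ^ l) (str x) fun a => (inp a).toNat := by
    intro i hi b hb
    have := hx ⟨i, hi⟩ ⟨b, hb⟩
    simpa [str, hi, BitVec.testBit_toNat] using this
  obtain ⟨t, ht, σ', hex, hmem, hout⟩ := wp_eval ly (σ := natState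
    { reg := paramRegs w l n κ, mem := m, inp := inp, out := fun _ => 0 }) (T := T) hstr r0 r1 r2 r3
    (by rw [← hμ]; exact congrArg BitVec.toNat (hm 0 (by omega)))
    (by rw [← hL]; exact congrArg BitVec.toNat (hm 1 (by omega)))
    (fun a => (inp a).isLt) hpk (by
      rw [← hT]
      funext b
      refine fieldAt_congr (congrArg BitVec.toNat (hm _ fun h => ?_))
      have := Nat.le_add_right (2 * words P l L + 2) (b / 2 ^ L)
      omega)
  obtain ⟨s', hs', hrun⟩ := hex _ (rep_natState _)
  have hrun' := hrun [] (evalTime P l L - t)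
  rw [Nat.sub_add_cancel ht, exec_nil] at hrun'
  rw [hrun', PMF.support_pure, Set.mem_singleton_iff] at ho
  refine ⟨s', ho, fun a ha => ?_, fun i b => ?_⟩
  · rw [← hm a ha]
    exact BitVec.eq_of_toNat_eq ((hs'.mem a).trans (hmem a ha))
  · have := hout i i.isLt b b.isLt
    rw [← hs'.out, BitVec.testBit_toNat] at this
    rw [this, tabulated, value, BitVec.getLsbD_ofNat]
    simp [b.isLt]

end Tabulation

namespace Tabulation

open WordRAM

variable {P : Params} {n κ l w S : ℕ}

/-! ### The outcome of the initialization -/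

/-- The time for the initialization. -/
def initTime (P : Params) (n κ l L : ℕ) : ℕ := layoutTime P.δ l n κ + 8 * words P l L + 2

/-- Computing the layout is deterministic, so the final memory is a function `g` of the random
words. Cells after the random words remain `0`, in agreement with `wordsOf`, so the tables agree at
every address. -/
theorem map_exec_init {L : ℕ} (ly : Layout P n κ l w (fieldLog n κ) L S)
    (hL : L = packLog P.δ l n κ w) :
    ∃ g : (Fin (words P l L) → BitVec w) → ℕ → BitVec w,
      (exec S (initTime P n κ l L) [initProg P.δ]
        { reg := paramRegs w l n κ, mem := fun _ => 0, inp := fun _ => 0, out := fun _ => 0 }).map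
          (Option.map State.mem) = (PMF.uniformOfFintype _).map (fun ω => some (g ω)) ∧
      ∀ ω, (g ω 0).toNat = fieldLog n κ ∧ (g ω 1).toNat = L ∧
        fieldAt P.M (fieldLog n κ) L (fun a => (g ω a).toNat) (2 * words P l L + 2)
          = fieldAt P.M (fieldLog n κ) L (wordsOf ω) 0 := by
  obtain ⟨hl, hn, hκ⟩ := ly.params_lt
  obtain ⟨r0, r1, r2, r3, r26⟩ := toNat_paramRegs hl hn hκ
  have hw := ly.w_pos
  have hN := words_pos (P := P) (l := l) (L := L)
  have hS := ly.S_eq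
  set N := words P l L with hNdef
  obtain ⟨t, ht, σ', hex, hmem, h21, h22, h24, h25, h26⟩ := wp_layout (S := S) ly hL (σ := natState
    { reg := paramRegs w l n κ, mem := fun _ => 0, inp := fun _ => 0, out := fun _ => 0 })
    r0 r1 r2 r3 r26
  rw [← hNdef] at h21 h22
  obtain ⟨s', hs', hrun⟩ := hex _ (rep_natState _)
  have hone := toNat_one hw
  have hm0 : ∀ a, (s'.mem a).toNat = Function.update (Function.update (fun _ => 0) 0 (fieldLog n κ))
      1 L a := by
    intro a
    rw [hs'.mem, hmem]
    congr 2
  refine ⟨fun ω => fillMem s'.mem (2 * N + 2) N ω, ?_, fun ω => ⟨?_, ?_, ?_⟩⟩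
  · rw [← exec_randomFill (S := S) hw (layoutTime P.δ l n κ - t) N (2 * N + 2) s' ((hs'.reg 21 (by omega)).trans
      h21) ((hs'.reg 22 (by omega)).trans h22) (by omega)
      (BitVec.eq_of_toNat_eq (by rw [hs'.reg 24 (by omega), h24, hone]))
      (BitVec.eq_of_toNat_eq (by rw [hs'.reg 25 (by omega), h25, if_pos hN, hone]))
      (BitVec.eq_of_toNat_eq (by rw [hs'.reg 26 (by omega), h26]; simp)), ← hrun]
    rw [initTime, show layoutTime P.δ l n κ + 8 * N + 2 =
      (layoutTime P.δ l n κ - t + (8 * N + 1) + t) + 1 by omega]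
    rfl
  · simp only [fillMem]
    rw [dif_neg (by omega), hm0]
    simp
  · simp only [fillMem]
    rw [dif_neg (by omega), hm0]
    simp
  · funext b
    unfold fieldAt
    congr 2
    rw [zero_add]
    have h2 := Nat.le_add_right (2 * N + 2) (b / 2 ^ L)
    simp only [fillMem, wordsOf]
    by_cases hb : b / 2 ^ L < N
    · rw [dif_pos ⟨h2, by omega⟩, dif_pos hb]
      congr 3
      omega
    · rw [dif_neg (by omega), dif_neg hb, hm0, Function.update_of_ne (by omega),
        Function.update_of_ne (by omega)]

theorem le_toOuterMeasure_of_count {Ω : Type*} [Fintype Ω] [Nonempty Ω] (E : Ω → Prop) {q : ℝ}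
    (h : (count (fun ω => ¬ E ω) : ℝ) ≤ Fintype.card Ω * q) :
    ENNReal.ofReal (1 - q) ≤ (PMF.uniformOfFintype Ω).toOuterMeasure {ω | E ω} := by
  classical
  rw [PMF.toOuterMeasure_uniformOfFintype_apply]
  have hpos : (0 : ℝ) < Fintype.card Ω := by exact_mod_cast Fintype.card_pos
  have h1 : (Fintype.card {ω | E ω} : ℝ) + count (fun ω => ¬ E ω) = Fintype.card Ω := by
    have h2 := Finset.card_filter_add_card_filter_not (s := (Finset.univ : Finset Ω)) E
    have h3 : Fintype.card {ω | E ω} = (Finset.univ.filter E).card := by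
      rw [Fintype.card_subtype]
      rfl
    have h4 : count (fun ω => ¬ E ω) = (Finset.univ.filter fun ω => ¬ E ω).card := by
      unfold count outcomes
      congr!
    rw [h3, h4, ← Finset.card_univ]
    exact_mod_cast h2
  have h5 : (Fintype.card Ω : ENNReal) = ENNReal.ofReal (Fintype.card Ω : ℝ) := by simp
  have h6 : (Fintype.card {ω | E ω} : ENNReal) = ENNReal.ofReal (Fintype.card {ω | E ω} : ℝ) := by
    simp
  rw [h5, h6, ← ENNReal.ofReal_div_of_pos hpos]
  refine ENNReal.ofReal_le_ofReal ?_
  rw [le_div_iff₀ hpos]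
  linarith

/-! ### Bounds for space and time -/

/-- The parameters in use. -/
def stdParams (γ n κ : ℕ) : Params := ⟨n + κ + 20, n / 4 + 1, γ, 2 * γ + 6⟩

/-- Since `e > n / 4`, there are at most `4 C + 1` divisions, so `γ`, and with it `δ` and the
programs, depend only on `C`. -/
theorem stdParams_fits {C : ℕ} (hn : 0 < n) (hκ : κ ≤ C * n) :
    (stdParams (4 * C + 1) n κ).Fits n κ where
  n_pos := hn
  M_eq := rfl
  e_eq := rfl
  δ_eq := rfl
  γ_pos := Nat.succ_pos _
  div_lt := by
    change κ / (n / 4 + 1) < 2 ^ (4 * C + 1)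
    have h1 : 4 * C + 1 < 2 ^ (4 * C + 1) := Nat.lt_two_pow_self
    have h2 : κ / (n / 4 + 1) ≤ 4 * C := by
      rw [← Nat.lt_add_one_iff, Nat.div_lt_iff_lt_mul (Nat.succ_pos _)]
      have h3 : C * n ≤ C * (4 * (n / 4 + 1)) := Nat.mul_le_mul_left _ (by omega)
      have h4 : (4 * C + 1) * (n / 4 + 1) = C * (4 * (n / 4 + 1)) + (n / 4 + 1) := by ring
      change κ < (4 * C + 1) * (n / 4 + 1)
      omega
    omega

theorem lt_two_pow_packLog_add {k : ℕ} (hM : P.M = n + κ + 20)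
    (hk : k ≤ P.M + 2 * P.δ + 2 * l + 2) (h : packLog P.δ l n κ w < k) :
    w < 2 ^ (packLog P.δ l n κ w + fieldLog n κ + 1) := by
  have h1 : Nat.log 2 w < packLog P.δ l n κ w + fieldLog n κ + 1 := by
    unfold packLog at h ⊢
    generalize Nat.log 2 w = a at *
    generalize fieldLog n κ = b at *
    omega
  exact Nat.lt_pow_of_log_lt one_lt_two h1

theorem two_pow_fieldLog_le : 2 ^ fieldLog n κ ≤ 2 * (n + κ + 20) := by
  unfold fieldLog
  have h1 : 1 < n + κ + 20 := by omega
  generalize n + κ + 20 = m at h1 ⊢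
  have h3 : 0 < Nat.clog 2 m := Nat.clog_pos one_lt_two h1
  have h4 : 2 ^ (Nat.clog 2 m).pred < m := Nat.pow_pred_clog_lt_self one_lt_two h1
  calc 2 ^ Nat.clog 2 m = 2 ^ (Nat.clog 2 m).pred * 2 := by
        rw [← pow_succ, ← Nat.succ_eq_add_one, Nat.succ_pred_eq_of_pos h3]
    _ ≤ m * 2 := Nat.mul_le_mul_right _ h4.le
    _ = _ := mul_comm _ _

/-- Rounding the field distance and the number of fields per word to powers of two loses at most a
factor `2` each, hence `4 M` in place of `M`. The summand `w` covers arrays that do not fill a word.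
-/
theorem fields_mul_le {k : ℕ} (hM : P.M = n + κ + 20)
    (hk : k ≤ P.M + 2 * P.δ + 2 * l + 2) :
    2 ^ (k - min (packLog P.δ l n κ w) k) * w ≤ w + 2 ^ k * (4 * P.M) := by
  rcases le_or_gt k (packLog P.δ l n κ w) with h | h
  · rw [min_eq_right h, Nat.sub_self, pow_zero, one_mul]
    exact Nat.le_add_right _ _
  · rw [min_eq_left h.le]
    have h1 := lt_two_pow_packLog_add hM hk h
    generalize packLog P.δ l n κ w = L at h h1 ⊢
    have h5 : w ≤ 2 ^ L * (4 * P.M) := by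
      calc w ≤ 2 ^ L * 2 ^ fieldLog n κ * 2 := by rw [← pow_add, ← pow_succ]; exact h1.le
        _ ≤ 2 ^ L * (2 * P.M) * 2 := by
            rw [hM]
            exact Nat.mul_le_mul_right _ (Nat.mul_le_mul_left _ two_pow_fieldLog_le)
        _ = _ := by ring
    calc 2 ^ (k - L) * w ≤ 2 ^ (k - L) * (2 ^ L * (4 * P.M)) := Nat.mul_le_mul_left _ h5
      _ = 2 ^ k * (4 * P.M) := by
        rw [← mul_assoc, ← pow_add, Nat.sub_add_cancel h.le]
      _ ≤ _ := Nat.le_add_left _ _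

theorem fields_le {k : ℕ} (hM : P.M = n + κ + 20) (hw : 0 < w)
    (hk : k ≤ P.M + 2 * P.δ + 2 * l + 2) :
    (2 ^ (k - min (packLog P.δ l n κ w) k) : ℝ) ≤ 1 + 2 ^ k * (4 * P.M) / w := by
  have h : ((2 ^ (k - min (packLog P.δ l n κ w) k) * w : ℕ) : ℝ) ≤ (w + 2 ^ k * (4 * P.M) : ℕ) :=
    Nat.cast_le.2 (fields_mul_le hM hk)
  have hw' : (0 : ℝ) < w := by exact_mod_cast hw
  push_cast at h
  rw [show (1 : ℝ) + 2 ^ k * (4 * P.M) / w = (w + 2 ^ k * (4 * P.M)) / w by field_simp,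
    le_div_iff₀ hw']
  exact h

theorem words_le_real (hM : P.M = n + κ + 20) (hw : 0 < w) :
    (words P l (packLog P.δ l n κ w) : ℝ) ≤
      1 + 2 ^ (P.M + 2 * P.δ + 2 * l + 2) * (4 * P.M) / w := by
  have h := fields_le (P := P) (l := l) hM hw le_rfl
  rw [min_eq_left (by unfold packLog; omega)] at h
  unfold words
  exact_mod_cast h

theorem levelTime_le (hM : P.M = n + κ + 20) (hw : 0 < w) {t : ℕ} (ht : t ≤ l) :
    (levelTime P l (packLog P.δ l n κ w) t + 15 : ℝ) ≤
      2 ^ (P.δ + l) * 1630 * (1 + 2 ^ (P.δ + t + 1) * (4 * P.M) / w) + 915 := by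
  have h := fields_le (P := P) (l := l) (k := P.δ + t + 1) hM hw (by omega)
  unfold levelTime
  set q := P.δ + t + 1 - min (packLog P.δ l n κ w) (P.δ + t + 1)
  push_cast
  have h1 : (1 : ℝ) ≤ 2 ^ (P.δ + t) := one_le_pow₀ (by norm_num)
  have h2 : (2 : ℝ) ^ (P.δ + l) = 2 ^ (l - t) * 2 ^ (P.δ + t) := by
    rw [← pow_add]
    congr 1
    omega
  calc (2 : ℝ) ^ (l - t) * 2 ^ q * (2 ^ (P.δ + t) * 1015 + 615) + 900 + 15
      ≤ 2 ^ (l - t) * 2 ^ q * (2 ^ (P.δ + t) * 1630) + 900 + 15 := by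
        have : (2 : ℝ) ^ (P.δ + t) * 1015 + 615 ≤ 2 ^ (P.δ + t) * 1630 := by linarith
        gcongr
    _ = 2 ^ (P.δ + l) * 1630 * 2 ^ q + 915 := by rw [h2]; ring
    _ ≤ _ := by gcongr

/-- The number of strings halves from level to level while the number of tables doubles, so each
level has about `2 ^ (δ + l)` lookups of entries, which gives the term `2 ^ l * l`. The words per
entry grow geometrically, so the last level dominates the other term. -/
theorem evalTime_le (hM : P.M = n + κ + 20) (hw : 0 < w) (hl : 0 < l) :
    (evalTime P l (packLog P.δ l n κ w) : ℝ) ≤ (2 ^ P.δ * 1630 * 4 + 13000) * (2 ^ l * l) +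
      2 ^ (2 * P.δ) * 26080 * (2 ^ l * (2 ^ l * P.M / w)) := by
  have hgeo : ∀ m : ℕ, ∑ t ∈ Finset.range m, (2 : ℝ) ^ t ≤ 2 ^ m := by
    intro m
    induction m with
    | zero => simp
    | succ m ih => rw [Finset.sum_range_succ, pow_succ]; linarith
  have hsum : ∑ t ∈ Finset.range (l + 1), (levelTime P l (packLog P.δ l n κ w) t + 15 : ℝ) ≤
      (l + 1) * (2 ^ (P.δ + l) * 1630 + 915) +
        2 ^ (P.δ + l) * 1630 * (2 ^ (P.δ + 1) * (4 * P.M) / w) * 2 ^ (l + 1) := by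
    calc _ ≤ ∑ t ∈ Finset.range (l + 1), ((2 ^ (P.δ + l) * 1630 + 915 : ℝ) +
          2 ^ (P.δ + l) * 1630 * (2 ^ (P.δ + 1) * (4 * P.M) / w) * 2 ^ t) := by
          refine Finset.sum_le_sum fun t ht => ?_
          refine (levelTime_le hM hw (Nat.lt_succ_iff.1 (Finset.mem_range.1 ht))).trans (le_of_eq ?_)
          rw [show P.δ + t + 1 = (P.δ + 1) + t by ring, pow_add _ (P.δ + 1)]
          ring
      _ ≤ _ := by
          rw [Finset.sum_add_distrib, Finset.sum_const, Finset.card_range, nsmul_eq_mul,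
            ← Finset.mul_sum]
          push_cast
          gcongr
          exact hgeo _
  have hl1 : (1 : ℝ) ≤ l := by exact_mod_cast hl
  have hL : (0 : ℝ) < 2 ^ l := by positivity
  have hLl : (2 : ℝ) ^ l ≤ 2 ^ l * l := le_mul_of_one_le_right hL.le hl1
  have hL1 : (1 : ℝ) ≤ 2 ^ l := one_le_pow₀ (by norm_num)
  have hD : (0 : ℝ) < 2 ^ P.δ := by positivity
  unfold evalTime
  push_cast at hsum ⊢
  have e1 : (2 : ℝ) ^ (P.δ + l) = 2 ^ P.δ * 2 ^ l := pow_add _ _ _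
  have e2 : (2 : ℝ) ^ (P.δ + 1) = 2 ^ P.δ * 2 := pow_succ _ _
  have e3 : (2 : ℝ) ^ (l + 1) = 2 ^ l * 2 := pow_succ _ _
  have e4 : (2 : ℝ) ^ (l + 3) = 2 ^ l * 8 := by rw [pow_add]; norm_num
  have e5 : (2 : ℝ) ^ (2 * P.δ) = 2 ^ P.δ * 2 ^ P.δ := by rw [two_mul, pow_add]
  rw [e1, e2, e3] at hsum
  rw [e2, e4, e5]
  set D : ℝ := 2 ^ P.δ
  set Z : ℝ := 2 ^ l
  have hy : D * Z * 1630 * (D * 2 * (4 * P.M) / w) * (Z * 2) =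
      D * D * 26080 * (Z * (Z * P.M / w)) := by ring
  rw [hy] at hsum
  have h1 : D * Z ≤ D * (Z * l) := mul_le_mul_of_nonneg_left hLl hD.le
  have h2 : (l + 1 : ℝ) * (D * Z * 1630 + 915) ≤ 2 * (D * (Z * l)) * 1630 + 2 * (Z * l) * 915 := by
    have : (l : ℝ) ≤ Z * l := le_mul_of_one_le_left (by linarith) hL1
    nlinarith
  have h3 : Z * (D * 2 * 415 + 600) ≤ D * (Z * l) * 830 + (Z * l) * 600 := by nlinarith
  have h4 : Z * 8 * 1000 ≤ (Z * l) * 8000 := by linarith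
  have h5 : (2000 : ℝ) ≤ 2000 * (Z * l) := by linarith
  have h6 : 0 ≤ D * (Z * l) := by positivity
  have h7 : 0 ≤ Z * l := by positivity
  have h8 : (D * 1630 * 4 + 13000) * (Z * l) = D * (Z * l) * 6520 + Z * l * 13000 := by ring
  linarith

end Tabulation

/-! ### Final bounds and assembly -/

namespace Tabulation

open WordRAM

variable {P : Params} {n κ l w S : ℕ}

theorem M_le {C : ℕ} (hM : P.M = n + κ + 20) (hn : 0 < n) (hκ : κ ≤ C * n) :
    (P.M : ℝ) ≤ (C + 21) * n := by
  have h : P.M ≤ (C + 21) * n := by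
    rw [hM, add_mul]
    omega
  exact_mod_cast h

theorem words_le_mul {C : ℕ} (hM : P.M = n + κ + 20) (hn : 0 < n) (hw : 0 < w)
    (hκ : κ ≤ C * n) : (words P l (packLog P.δ l n κ w) : ℝ) ≤
      1 + 2 ^ (2 * P.δ + 22) * (4 * (C + 21)) * (2 ^ (n + κ + 2 * l) * n / w) := by
  refine (words_le_real hM hw).trans ?_
  have h : (2 : ℝ) ^ (P.M + 2 * P.δ + 2 * l + 2) =
      2 ^ (2 * P.δ + 22) * 2 ^ (n + κ + 2 * l) := by
    rw [← pow_add, hM]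
    congr 1
    ring
  calc (1 : ℝ) + 2 ^ (P.M + 2 * P.δ + 2 * l + 2) * (4 * P.M) / w
      ≤ 1 + 2 ^ (P.M + 2 * P.δ + 2 * l + 2) * (4 * ((C + 21) * n)) / w := by
        gcongr
        exact M_le hM hn hκ
    _ = _ := by rw [h]; ring

theorem space_le {C : ℕ} (hM : P.M = n + κ + 20) (hn : 0 < n) (hw : 0 < w) (hκ : κ ≤ C * n) :
    ((3 * words P l (packLog P.δ l n κ w) + 3 : ℕ) : ℝ) ≤
      (6 + 3 * (2 ^ (2 * P.δ + 22) * (4 * (C + 21)))) * (1 + 2 ^ (n + κ + 2 * l) * n / w) := by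
  have h := words_le_mul (l := l) hM hn hw hκ
  have hB : (0 : ℝ) ≤ 2 ^ (2 * P.δ + 22) * (4 * (C + 21)) := by positivity
  have hX : (0 : ℝ) ≤ 2 ^ (n + κ + 2 * l) * n / w := by positivity
  push_cast
  generalize (2 : ℝ) ^ (2 * P.δ + 22) * (4 * (C + 21)) = B at *
  generalize (2 : ℝ) ^ (n + κ + 2 * l) * n / w = X at *
  linarith [show (6 + 3 * B) * (1 + X) = 6 + 3 * B + 6 * X + 3 * (B * X) by ring]

theorem initTime_le {C : ℕ} (hM : P.M = n + κ + 20) (hn : 0 < n) (hw : 0 < w)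
    (hκ : κ ≤ C * n) : (initTime P n κ l (packLog P.δ l n κ w) : ℝ) ≤
      (8 * (2 ^ (2 * P.δ + 22) * (4 * (C + 21))) + 530 * (C + 21) + 630 * P.δ + 2270) *
        (2 ^ (n + κ + 2 * l) * n / w + n + l) := by
  have h := words_le_mul (l := l) hM hn hw hκ
  have hB : (0 : ℝ) ≤ 2 ^ (2 * P.δ + 22) * (4 * (C + 21)) := by positivity
  have hX : (0 : ℝ) ≤ 2 ^ (n + κ + 2 * l) * n / w := by positivity
  have hMn := M_le hM hn hκ
  have hn1 : (1 : ℝ) ≤ n := by exact_mod_cast hn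
  rw [hM] at hMn
  unfold initTime layoutTime
  push_cast at hMn ⊢
  generalize (2 : ℝ) ^ (2 * P.δ + 22) * (4 * (C + 21)) = B at *
  generalize (2 : ℝ) ^ (n + κ + 2 * l) * n / w = X at *
  have h1 : (P.δ : ℝ) ≤ P.δ * n := le_mul_of_one_le_right (by positivity) hn1
  have h2 : 0 ≤ B * (n + l) := by positivity
  have h3 : (0 : ℝ) ≤ (530 * (C + 21) + 630 * P.δ + 2270) * X := by positivity
  have h4 : (0 : ℝ) ≤ (530 * (C + 21) + 630 * P.δ) * l := by positivity
  linarith [show (8 * B + 530 * (C + 21) + 630 * P.δ + 2270) * (X + n + l) =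
    8 * (B * X) + 8 * (B * (n + l)) + (530 * (C + 21) + 630 * P.δ + 2270) * X +
      (530 * (C + 21) + 630 * P.δ) * l + 2270 * l +
      530 * ((C + 21) * n) + 630 * (P.δ * n) + 2270 * n by ring]

theorem evalTime_le_mul {C : ℕ} (hM : P.M = n + κ + 20) (hl : 0 < l) (hn : 0 < n) (hw : 0 < w)
    (hκ : κ ≤ C * n) : (evalTime P l (packLog P.δ l n κ w) : ℝ) ≤
      (2 ^ P.δ * 1630 * 4 + 13000 + 2 ^ (2 * P.δ) * 26080 * (C + 21)) *
        (2 ^ l * (l + 2 ^ l * n / w)) := by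
  refine (evalTime_le hM hw hl).trans ?_
  calc _ ≤ (2 ^ P.δ * 1630 * 4 + 13000 : ℝ) * (2 ^ l * l) +
      2 ^ (2 * P.δ) * 26080 * (2 ^ l * (2 ^ l * ((C + 21) * n) / w)) := by
        gcongr
        exact M_le hM hn hκ
    _ = (2 ^ P.δ * 1630 * 4 + 13000 : ℝ) * (2 ^ l * l) +
      2 ^ (2 * P.δ) * 26080 * (C + 21) * (2 ^ l * (2 ^ l * n / w)) := by ring
    _ ≤ (2 ^ P.δ * 1630 * 4 + 13000 : ℝ) * (2 ^ l * (l + 2 ^ l * n / w)) +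
      2 ^ (2 * P.δ) * 26080 * (C + 21) * (2 ^ l * (l + 2 ^ l * n / w)) := by
        gcongr
        · exact le_add_of_nonneg_right (by positivity)
        · exact le_add_of_nonneg_left (by positivity)
    _ = _ := by ring

end Tabulation

open Tabulation in
theorem mainTheorem2 (C : ℕ) :
    ∃ (ini ev : WordRAM.Prog) (S : ℕ → ℕ → ℕ → ℕ → ℕ) (A : ℝ),
      ∀ l n κ w : ℕ, 0 < l → 0 < n → 0 < κ → 0 < w → κ ≤ C * n →
        (S l n κ w : ℝ) ≤ A * (1 + 2 ^ (n + κ + 2 * l) * n / w) ∧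
        (S l n κ w ≤ 2 ^ w →
          ∃ T₀ T : ℕ,
            (T₀ : ℝ) ≤ A * (2 ^ (n + κ + 2 * l) * n / w + n + l) ∧
            (T : ℝ) ≤ A * (2 ^ l * (l + 2 ^ l * n / w)) ∧
            ∃ μ : PMF (Option (WordRAM.State w)),
              μ = WordRAM.exec (S l n κ w) T₀ [ini]
                { reg := WordRAM.paramRegs w l n κ, mem := fun _ => 0,
                  inp := fun _ => 0, out := fun _ => 0 } ∧
              (∀ o ∈ μ.support, ∃ s : WordRAM.State w, o = some s ∧
                ∃ Γ : (Fin (2 ^ l) → BitVec n) → (Fin (2 ^ (l + 3)) → BitVec (n + κ + 4)),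
                  WordRAM.Represents (S l n κ w) T ev (WordRAM.paramRegs w l n κ) s.mem Γ) ∧
              ENNReal.ofReal (1 - 2 ^ (-(n : ℤ) + 1)) ≤
                μ.toOuterMeasure {o | ∃ s : WordRAM.State w, o = some s ∧
                  ∃ Γ : (Fin (2 ^ l) → BitVec n) → (Fin (2 ^ (l + 3)) → BitVec (n + κ + 4)),
                    WordRAM.Represents (S l n κ w) T ev (WordRAM.paramRegs w l n κ) s.mem Γ ∧
                    IsMajorityUnique Γ (2 ^ κ)}) := by
  -- The constants in the programs depend on `C` alone, so the programs can be given before `l`,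
  -- `n`, `κ` and `w`.
  generalize hγ : 4 * C + 1 = γ
  generalize hδ : 2 * γ + 6 = δ
  obtain ⟨A₁, hA₁⟩ : ∃ A₁ : ℝ, A₁ = 6 + 3 * (2 ^ (2 * δ + 22) * (4 * (C + 21))) := ⟨_, rfl⟩
  obtain ⟨A₂, hA₂⟩ : ∃ A₂ : ℝ, A₂ = 8 * (2 ^ (2 * δ + 22) * (4 * (C + 21))) + 530 * (C + 21) +
    630 * δ + 2270 := ⟨_, rfl⟩
  obtain ⟨A₃, hA₃⟩ : ∃ A₃ : ℝ, A₃ = 2 ^ δ * 1630 * 4 + 13000 + 2 ^ (2 * δ) * 26080 * (C + 21) :=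
    ⟨_, rfl⟩
  have h₁ : 0 ≤ A₁ := by rw [hA₁]; positivity
  have h₂ : 0 ≤ A₂ := by rw [hA₂]; positivity
  have h₃ : 0 ≤ A₃ := by rw [hA₃]; positivity
  refine ⟨initProg δ, evalProg γ δ,
    fun l n κ w => 3 * words (stdParams γ n κ) l (packLog δ l n κ w) + 3, A₁ + A₂ + A₃, ?_⟩
  intro l n κ w hl hn _ hw hκ
  have hM : (stdParams γ n κ).M = n + κ + 20 := rfl
  have hd : (stdParams γ n κ).δ = δ := hδ
  have space := space_le (P := stdParams γ n κ) (l := l) hM hn hw hκ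
  have init := initTime_le (P := stdParams γ n κ) (l := l) hM hn hw hκ
  have eval := evalTime_le_mul (P := stdParams γ n κ) hM hl hn hw hκ
  rw [hd, ← hA₁] at space
  rw [hd, ← hA₂] at init
  rw [hd, ← hA₃] at eval
  refine ⟨space.trans (mul_le_mul_of_nonneg_right (by linarith) (by positivity)), fun hS => ?_⟩
  have ly := layout_of_le (P := stdParams γ n κ) (l := l) hM rfl rfl hw (hd.symm ▸ hS)
  rw [hd] at ly
  obtain ⟨g, hg, hgω⟩ := map_exec_init ly (by rw [hd])
  rw [hd] at hg
  rw [show evalProg γ δ = evalProg (stdParams γ n κ).γ (stdParams γ n κ).δ by rw [hd]; rfl]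
  have hrep : ∀ s : WordRAM.State w, ∀ ω, s.mem = g ω →
      WordRAM.Represents (3 * words (stdParams γ n κ) l (packLog δ l n κ w) + 3)
        (evalTime (stdParams γ n κ) l (packLog δ l n κ w))
        (evalProg (stdParams γ n κ).γ (stdParams γ n κ).δ) (WordRAM.paramRegs w l n κ) s.mem
        (tabulated (stdParams γ n κ) n κ l ((tableSpace ly).T ω)) := fun s ω h =>
    represents_tabulated (mem := s.mem) ly (h ▸ (hgω ω).1) (h ▸ (hgω ω).2.1) (h ▸ (hgω ω).2.2)
  refine ⟨initTime (stdParams γ n κ) n κ l (packLog δ l n κ w),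
    evalTime (stdParams γ n κ) l (packLog δ l n κ w),
    init.trans (mul_le_mul_of_nonneg_right (by linarith) (by positivity)),
    eval.trans (mul_le_mul_of_nonneg_right (by linarith) (by positivity)), _, rfl, ?_, ?_⟩
  · intro o ho
    have h1 := (PMF.mem_support_map_iff (Option.map WordRAM.State.mem) _ _).2 ⟨o, ho, rfl⟩
    have h2 := (congrArg (fun p => o.map WordRAM.State.mem ∈ p.support) hg).mp h1
    obtain ⟨ω, -, h3⟩ := (PMF.mem_support_map_iff _ _ _).1 h2
    obtain ⟨s, rfl, h4⟩ := Option.map_eq_some_iff.1 h3.symm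
    exact ⟨s, rfl, _, hrep s ω h4⟩
  · have h1 := le_toOuterMeasure_of_count
      (fun ω => HasMajority (stdParams γ n κ) n κ l ((tableSpace ly).T ω))
      (card_not_hasMajority_le (hγ ▸ stdParams_fits hn hκ) hl (tableSpace ly))
    have h2 : (2 : ℝ) ^ (-(n : ℤ) + 1) = 2 / 2 ^ n := by
      rw [zpow_add₀ two_ne_zero, zpow_neg, zpow_natCast, zpow_one, mul_comm, div_eq_mul_inv]
    rw [h2]
    refine h1.trans ?_
    -- The distribution of the memory is computed in two ways, as an image of the execution and as
    -- an image of the uniform distribution on words, which transfers the bound to the execution.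
    have h3 := PMF.toOuterMeasure_map_apply (Option.map WordRAM.State.mem)
      (WordRAM.exec (3 * words (stdParams γ n κ) l (packLog δ l n κ w) + 3)
        (initTime (stdParams γ n κ) n κ l (packLog δ l n κ w)) [initProg δ]
        { reg := WordRAM.paramRegs w l n κ, mem := fun _ => 0,
          inp := fun _ => 0, out := fun _ => 0 })
      {o | ∃ ω, o = some (g ω) ∧
        HasMajority (stdParams γ n κ) n κ l ((tableSpace ly).T ω)}
    have h4 := PMF.toOuterMeasure_map_apply (fun ω => some (g ω))
      (PMF.uniformOfFintype (Fin (words (stdParams γ n κ) l (packLog δ l n κ w)) → BitVec w))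
      {o | ∃ ω, o = some (g ω) ∧
        HasMajority (stdParams γ n κ) n κ l ((tableSpace ly).T ω)}
    rw [hg, h4] at h3
    refine (MeasureTheory.measure_mono ?_).trans (h3.le.trans (MeasureTheory.measure_mono ?_))
    · intro ω hω
      exact ⟨ω, rfl, hω⟩
    · rintro o ⟨ω, h6, h7⟩
      obtain ⟨s, rfl, h8⟩ := Option.map_eq_some_iff.1 h6
      exact ⟨s, rfl, _, hrep s ω h8, isMajorityUnique_tabulated h7⟩
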